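/- Let $k\ge-\tfrac12$, let $M=\begin{pmatrix}a&b\\c&d\end{pmatrix}\in SL(2,\mathbb R)$ with $b\neq0$, and let $s\ge 0$. Put $$d\mu_k(x)=\frac{|x|^{2k+1}\,dx}{2^{k+1}\Gamma(k+1)}\ \text{ on }\mathbb R,\qquad d\nu_k(\alpha,\beta)=d\mu_k(\beta)\,\frac{d\alpha}{\alpha^{2k+3}}\ \text{ on }\mathbb R^2_+=\{(\alpha,\beta):\alpha>0,\ \beta\in\mathbb R\},$$ $L^p_k(\mathbb R)=L^p(\mathbb R,\mu_k)$ and $L^2_k(\mathbb R^2_+)=L^2(\mathbb R^2_+,\nu_k)$ (complex-valued functions). Let $E_k(z,x)=j_k(izx)+\frac{zx}{2(k+1)}j_{k+1}(izx)$ be the Dunkl kernel of the real line, where $j_k(z)=\Gamma(k+1)\sum_{n\ge0}\frac{(-1)^n(z/2)^{2n}}{n!\,\Gamma(n+k+1)}$, and let $$D^M_kf(\lambda)=\frac1{(ib)^{k+1}}\int_{\mathbb R}f(x)\,e^{\frac i2\left(\frac db\lambda^2+\frac abx^2\right)}E_k(-i\lambda/b,x)\,d\mu_k(x)$$ (principal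 branch of the power) be the linear canonical Dunkl transform on $L^1_k(\mathbb R)$, extended by continuity from $L^1_k\cap L^2_k$ to $L^2_k(\mathbb R)$, and by duality to tempered distributions: $\langle D^M_kh,\varphi\rangle=\langle h,D^{M'}_k\varphi\rangle$ for Schwartz functions $\varphi$, where $M'=\begin{pmatrix}d&b\\c&a\end{pmatrix}$ and a function $g$ is regarded as the distribution $\varphi\mapsto\int g\varphi\,d\mu_k$. Let $$\mathbf W^s_{k,M}(\mathbb R)=\{h\in\mathcal S'(\mathbb R):(1+|\lambda|^2)^{s/2}D^M_kh\in L^2_k(\mathbb R)\},\qquad \|h\|^2_{\mathbf W^s_{k,M}(\mathbb R)}=\int_{\mathbb R}(1+|\lambda|^2)^s|D^M_kh(\lambda)|^2\,d\mu_k(\lambda).$$ Let $T_x$ be the generalized translation associated with the Dunkl transform on $\mathbb R$, that is, $T_xf(y)=f(x+y)$ if $k=-\frac12$, and for $k>-\frac12$ $$T_xf(y)=\frac{\Gamma(k+1)}{\sqrt\pi\,\Gamma(k+\frac12)}\int_{-1}^1\Big(f_e(A_t)+\frac{x+y}{A_t}f_o(A_t)\Big)(1+t)(1-t^2)^{k-\frac12}\,dt,\qquad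 A_t=\sqrt{x^2+y^2+2xyt},$$ where $f_e,f_o$ are the even and odd parts of $f$. For $\psi\in L^2_k(\mathbb R)$, $\alpha>0$ and $\beta\in\mathbb R$ let $$\psi^M_\alpha(x)=\frac1{\alpha^{2k+2}}e^{-\frac i2\frac ab\left(1-\frac1{\alpha^2}\right)x^2}\psi(x/\alpha),\qquad \psi^M_{\alpha,\beta}(x)=\alpha^{k+1}e^{-\frac i2\frac ab(\beta^2+x^2)}\,T_\beta\big(e^{\frac i2\frac ab(\cdot)^2}\psi^M_\alpha\big)(x),$$ and for $f\in L^2_k(\mathbb R)$ let $\Phi^M_\psi f(\alpha,\beta)=\frac1{(ib)^{k+1}}\int_{\mathbb R}f(y)\,\overline{\psi^M_{\alpha,\beta}(y)}\,d\mu_k(y)$. Let $\psi\in L^2_k(\mathbb R)$ be a linear canonical Dunkl wavelet: there is a constant $C^M_\psi$ with $0<C^M_\psi<\infty$ and $$\int_0^\infty|D^M_k\psi(\lambda\alpha)|^2\,\frac{d\alpha}\alpha=C^M_\psi\quad\text{for almost every }\lambda\in\mathbb R.$$ Then every element of $\mathbf W^s_{k,M}(\mathbb R)$ is a function in $L^2_k(\mathbb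 R)$, and $\Phi^M_\psi$ is a bounded linear operator from $\mathbf W^s_{k,M}(\mathbb R)$ to $L^2_k(\mathbb R^2_+)$, with $$\|\Phi^M_\psi f\|_{L^2_k(\mathbb R^2_+)}\le\sqrt{C^M_\psi}\;\|f\|_{\mathbf W^s_{k,M}(\mathbb R)}\qquad\text{for all }f\in\mathbf W^s_{k,M}(\mathbb R).$$ -/

import Mathlib

open MeasureTheory Set Filter Topology SchwartzMap
open scoped ENNReal

noncomputable section

namespace LCDunkl

/-- The weighted measure `dμ_k(x) = |x|^(2k+1) / (2^(k+1) Γ(k+1)) dx` on `ℝ`. -/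
def mu (k : ℝ) : Measure ℝ :=
  volume.withDensity fun x =>
    ENNReal.ofReal (|x| ^ (2 * k + 1) / (2 ^ (k + 1) * Real.Gamma (k + 1)))

/-- The measure `dν_k(α, β) = α^(-(2k+3)) dα dμ_k(β)` on `α > 0`, `β ∈ ℝ`
(it gives measure zero to `α ≤ 0`). -/
def nu (k : ℝ) : Measure (ℝ × ℝ) :=
  ((volume.restrict (Ioi (0 : ℝ))).withDensity fun α =>
    ENNReal.ofReal (1 / α ^ (2 * k + 3))).prod (mu k)

/-- The normalized Bessel function
`j_k(z) = Γ(k+1) ∑ (-1)^n (z/2)^(2n) / (n! Γ(n+k+1))`. -/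
def besselJ (k : ℝ) (z : ℂ) : ℂ :=
  ∑' n : ℕ, ((-1) ^ n * (Real.Gamma (k + 1) : ℂ) /
    ((n.factorial : ℂ) * (Real.Gamma (n + k + 1) : ℂ))) * (z / 2) ^ (2 * n)

/-- The Dunkl kernel of the real line,
`E_k(z, x) = j_k(izx) + zx / (2(k+1)) j_{k+1}(izx)`. -/
def dunklKernel (k : ℝ) (z : ℂ) (x : ℝ) : ℂ :=
  besselJ k (Complex.I * z * x) +
    z * x / (2 * ((k : ℂ) + 1)) * besselJ (k + 1) (Complex.I * z * x)

/-- Real unimodular matrices; `M = (a, b; c, d)` has `a = M 0 0`, `b = M 0 1`, `c = M 1 0`,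
`d = M 1 1`. -/
abbrev SL2 := Matrix.SpecialLinearGroup (Fin 2) ℝ

/-- The chirp `x ↦ exp((i/2) r x²)`. -/
def chirp (r x : ℝ) : ℂ := Complex.exp (Complex.I / 2 * r * x ^ 2)

/-- The kernel `E_k^M(l, x) = exp((i/2)((d/b) l² + (a/b) x²)) E_k(-il/b, x)`. -/
def kernelM (k : ℝ) (M : SL2) (l x : ℝ) : ℂ :=
  chirp (M 1 1 / M 0 1) l * chirp (M 0 0 / M 0 1) x *
    dunklKernel k (-Complex.I * l / (M 0 1 : ℝ)) x

/-- The factor `1 / (ib)^(k+1)`, with the principal branch of the power, so that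
`dμ_{k,b} = (ib)^(-(k+1)) dμ_k`. -/
def normFactor (k : ℝ) (M : SL2) : ℂ :=
  1 / (Complex.I * (M 0 1 : ℝ)) ^ ((k : ℂ) + 1)

/-- The linear canonical Dunkl transform of an integrable function,
`D_k^M f(l) = ∫ f(x) E_k^M(l, x) dμ_{k,b}(x)`. -/
def lcdt (k : ℝ) (M : SL2) (f : ℝ → ℂ) (l : ℝ) : ℂ :=
  normFactor k M * ∫ x, f x * kernelM k M l x ∂(mu k)

/-- `g` is the linear canonical Dunkl transform of the square integrable function `f`: it is the
limit in `L²_k(ℝ)` of the transforms of the truncations `f 1_[-n,n]`, which lie in `L¹ ∩ L²`. -/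
def IsLcdtL2 (k : ℝ) (M : SL2) (f g : ℝ → ℂ) : Prop :=
  MemLp g 2 (mu k) ∧
    Tendsto (fun n : ℕ =>
      eLpNorm (fun l => lcdt k M (indicator (Icc (-(n : ℝ)) n) f) l - g l) 2 (mu k))
      atTop (𝓝 0)

open Classical in
/-- The linear canonical Dunkl transform on `L²_k(ℝ)` (a representative of it). -/
def lcdtL2 (k : ℝ) (M : SL2) (f : ℝ → ℂ) : ℝ → ℂ :=
  if h : ∃ g, IsLcdtL2 k M f g then h.choose else 0

/-! ### Translations, wavelets and the wavelet transform -/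

open Classical in
/-- The generalized translation `T_x f(y)` associated with the Dunkl transform on the line. For
`k > -1/2`, with `A = √(x² + y² + 2xyt)`, and `f_e`, `f_o` the even and odd parts of `f`, it is
`Γ(k+1) / (√π Γ(k+1/2)) ∫_{-1}^1 (f_e(A) + ((x+y)/A) f_o(A)) (1+t) (1-t²)^(k-1/2) dt`;
for `k = -1/2` it is the ordinary translation. -/
def dunklTranslation (k x : ℝ) (f : ℝ → ℂ) (y : ℝ) : ℂ :=
  if k = -1 / 2 then f (x + y)
  else
    ((Real.Gamma (k + 1) / (√Real.pi * Real.Gamma (k + 1 / 2)) : ℝ) : ℂ) *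
      ∫ t in (-1 : ℝ)..1,
        ((f √(x ^ 2 + y ^ 2 + 2 * x * y * t) + f (-√(x ^ 2 + y ^ 2 + 2 * x * y * t))) / 2 +
          (((x + y) / √(x ^ 2 + y ^ 2 + 2 * x * y * t) : ℝ) : ℂ) *
            ((f √(x ^ 2 + y ^ 2 + 2 * x * y * t) - f (-√(x ^ 2 + y ^ 2 + 2 * x * y * t))) / 2)) *
          (((1 + t) * (1 - t ^ 2) ^ (k - 1 / 2) : ℝ) : ℂ)

/-- The translation `T_x^M f(y) = exp(-(i/2)(a/b)(x² + y²)) T_x(exp((i/2)(a/b)(·)²) f)(y)`. -/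
def translationM (k : ℝ) (M : SL2) (x : ℝ) (f : ℝ → ℂ) (y : ℝ) : ℂ :=
  chirp (-(M 0 0 / M 0 1)) x * chirp (-(M 0 0 / M 0 1)) y *
    dunklTranslation k x (fun z => chirp (M 0 0 / M 0 1) z * f z) y

/-- The dilation `ψ_α^M(x) = α^(-(2k+2)) exp(-(i/2)(a/b)(1 - 1/α²) x²) ψ(x/α)`. -/
def dilationM (k : ℝ) (M : SL2) (ψ : ℝ → ℂ) (α x : ℝ) : ℂ :=
  ((1 / α ^ (2 * k + 2) : ℝ) : ℂ) * chirp (-(M 0 0 / M 0 1 * (1 - 1 / α ^ 2))) x * ψ (x / α)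

/-- The family `ψ_{α,β}^M = α^(k+1) T_β^M(ψ_α^M)`. -/
def waveletFamily (k : ℝ) (M : SL2) (ψ : ℝ → ℂ) (α β x : ℝ) : ℂ :=
  ((α ^ (k + 1) : ℝ) : ℂ) * translationM k M β (dilationM k M ψ α) x

/-- The integral `∫_0^∞ |D_k^M ψ(lα)|² dα/α`, as a function of `l`. -/
def admissibilityIntegral (k : ℝ) (M : SL2) (ψ : ℝ → ℂ) (l : ℝ) : ℝ≥0∞ :=
  ∫⁻ α in Ioi (0 : ℝ), ENNReal.ofReal (‖lcdtL2 k M ψ (l * α)‖ ^ 2 / α)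

/-- The admissibility constant `C_ψ^M`. By scaling, the integral takes the same value at all
`l > 0` and the same value at all `l < 0`; for a wavelet the two values agree. -/
def admissibilityConstant (k : ℝ) (M : SL2) (ψ : ℝ → ℂ) : ℝ≥0∞ :=
  admissibilityIntegral k M ψ 1

/-- `ψ ∈ L²_k(ℝ)` is a linear canonical Dunkl wavelet: `∫_0^∞ |D_k^M ψ(lα)|² dα/α` is, for almost
every `l`, one and the same number `C_ψ^M`, and `0 < C_ψ^M < ∞`. -/
structure IsWavelet (k : ℝ) (M : SL2) (ψ : ℝ → ℂ) : Prop where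
  memLp : MemLp ψ 2 (mu k)
  const : ∀ᵐ l : ℝ, admissibilityIntegral k M ψ l = admissibilityConstant k M ψ
  pos : 0 < admissibilityConstant k M ψ
  lt_top : admissibilityConstant k M ψ < ∞

/-- The wavelet transform `Φ_ψ^M f(α, β) = ∫ f(y) conj(ψ_{α,β}^M(y)) dμ_{k,b}(y)`. -/
def waveletTransform (k : ℝ) (M : SL2) (ψ f : ℝ → ℂ) (p : ℝ × ℝ) : ℂ :=
  normFactor k M * ∫ y, f y * (starRingEnd ℂ) (waveletFamily k M ψ p.1 p.2 y) ∂(mu k)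

/-! ### Tempered distributions and the Sobolev space -/

/-- The distribution `h` is the function `f`, through the pairing `φ ↦ ∫ f φ dμ_k`. -/
def IsFunction (k : ℝ) (h : 𝓢'(ℝ, ℂ)) (f : ℝ → ℂ) : Prop :=
  ∀ φ : 𝓢(ℝ, ℂ), Integrable (fun x => f x * φ x) (mu k) ∧ h φ = ∫ x, f x * φ x ∂(mu k)

/-- The matrix `(d, b; c, a)`. Since `E_k^M(l, x)` is the kernel of this matrix at `(x, l)`, its
transform is the transpose of `D_k^M` for the bilinear pairing `∫ f g dμ_k`. -/
def transposed (M : SL2) : SL2 :=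
  ⟨!![M 1 1, M 0 1; M 1 0, M 0 0], by
    have h := M.det_coe
    rw [Matrix.det_fin_two] at h
    rw [Matrix.det_fin_two_of]
    linarith⟩

/-- The distributional transform `D_k^M h`, `⟨D_k^M h, φ⟩ = ⟨h, (D_k^M)ᵗ φ⟩`, is the function `g`
through the pairing `∫ g φ dμ_k`. The Schwartz function `χ` is `(D_k^M)ᵗ φ`, as the transform maps
Schwartz functions to Schwartz functions. -/
def IsLcdtDist (k : ℝ) (M : SL2) (h : 𝓢'(ℝ, ℂ)) (g : ℝ → ℂ) : Prop :=
  ∀ φ χ : 𝓢(ℝ, ℂ), (∀ x, χ x = lcdt k (transposed M) φ x) →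
    Integrable (fun l => g l * φ l) (mu k) ∧ h χ = ∫ l, g l * φ l ∂(mu k)

open Classical in
/-- The function `D_k^M h` (a representative of it), where `h` is a tempered distribution whose
transform is a function. -/
def lcdtDist (k : ℝ) (M : SL2) (h : 𝓢'(ℝ, ℂ)) : ℝ → ℂ :=
  if e : ∃ g, IsLcdtDist k M h g then e.choose else 0

/-- The Sobolev space `W^s_{k,M}(ℝ)` of the tempered distributions `h` such that `D_k^M h` is a
function with `(1 + l²)^(s/2) D_k^M h ∈ L²_k(ℝ)`. -/
def sobolevSpace (k : ℝ) (M : SL2) (s : ℝ) : Submodule ℂ 𝓢'(ℝ, ℂ) where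
  carrier := {h | ∃ g, IsLcdtDist k M h g ∧
    MemLp (fun l : ℝ => (((1 + l ^ 2) ^ (s / 2) : ℝ) : ℂ) * g l) 2 (mu k)}
  zero_mem' := ⟨0, fun φ χ _ => by simp, by simp⟩
  add_mem' := by
    rintro h₁ h₂ ⟨g₁, e₁, m₁⟩ ⟨g₂, e₂, m₂⟩
    refine ⟨g₁ + g₂, fun φ χ hχ => ?_, ?_⟩
    · obtain ⟨i₁, q₁⟩ := e₁ φ χ hχ
      obtain ⟨i₂, q₂⟩ := e₂ φ χ hχ
      simp only [Pi.add_apply, add_mul]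
      refine ⟨i₁.add i₂, ?_⟩
      rw [integral_add i₁ i₂, ← q₁, ← q₂]
      rfl
    · convert m₁.add m₂ using 1
      funext l
      simp only [Pi.add_apply, mul_add]
  smul_mem' := by
    rintro c h ⟨g, e, m⟩
    refine ⟨c • g, fun φ χ hχ => ?_, ?_⟩
    · obtain ⟨i, q⟩ := e φ χ hχ
      simp only [Pi.smul_apply, smul_eq_mul, mul_assoc]
      refine ⟨i.const_mul c, ?_⟩
      rw [integral_const_mul, ← q]
      rfl
    · simpa only [Pi.smul_apply, smul_eq_mul, mul_left_comm] using m.const_mul c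

/-- The inner product `⟨h₁, h₂⟩ = ∫ (1 + l²)^s D_k^M h₁(l) conj(D_k^M h₂(l)) dμ_k(l)`. -/
def sobolevInner (k : ℝ) (M : SL2) (s : ℝ) (h₁ h₂ : sobolevSpace k M s) : ℂ :=
  ∫ l, (((1 + l ^ 2) ^ s : ℝ) : ℂ) * lcdtDist k M h₁ l *
    (starRingEnd ℂ) (lcdtDist k M h₂ l) ∂(mu k)

/-- The norm of `W^s_{k,M}(ℝ)`. -/
def sobolevNorm (k : ℝ) (M : SL2) (s : ℝ) (h : sobolevSpace k M s) : ℝ :=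
  √(sobolevInner k M s h h).re

end LCDunkl

end

/-! The linear canonical Dunkl transform is a scalar times chirp, dilation by 1/b, Dunkl transform
and chirp, and chirps have modulus one. Everything therefore reduces to L² facts about the Dunkl
transform, denoted F below.

Plancherel. The Dunkl kernel is E_k(z, x) = e(zx), where e(w) = ∫ exp(wt) dm(t) for a probability
measure m on (-1, 1] (`dunklKernel_eq`). Hence |E_k(-il, x)| ≤ 1, and power series give the
transforms of exp(-zx²/2) and x exp(-zx²/2) for z > 0: up to a factor they are the same functions
with 1/z for z. These Gaussians are total in L² (`dense_span_gaussLp`, by Weierstrass approximation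
in the variable exp(-x²/2)), and F preserves their Gram matrix (`inner_gaussLp_dual`). So F extends
to an isometry `dunklL2`, which agrees with the integral on L¹ ∩ L² (`dunklL2_toLp`). Later
identities on L² compare two bounded operators on Gaussians.

Translation. Polar coordinates in the plane bound T_x on L² (`exists_eLpNorm_dunklTranslation_le`),
and a computation with Gaussians gives F(T_x f)(l) = E_k(ix, l) Ff(l) (`dunklL2_translation`).

Wavelet transform. Let u and v be the Dunkl transforms of the chirped f and ψ. For fixed α, Parseval
turns Φf(α, β) into a unimodular chirp in β times a scalar times α^(k+1) times the Dunkl transform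
at β of l ↦ u(l) conj v(αl) (`waveletTransform_eq`). Plancherel in β, Tonelli and the admissibility
condition, which makes ∫ |v(αl)|² dα/α constant in l, yield ‖Φf‖² ≤ C ‖f‖²
(`lintegral_waveletTransform_sq_le`).

Sobolev space. Since s ≥ 0, the weight is at least 1 and D^M h lies in L². The transposed transform
maps the Schwartz space onto itself, so h is determined by D^M h; inverting the factors on L²
produces a function f that represents h and satisfies ‖f‖ = ‖D^M h‖ ≤ ‖h‖_W
(`exists_isFunction_of_isLcdtDist`). This f is unique almost everywhere, so f ↦ Φf gives a linear
map on the Sobolev space. -/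

noncomputable section

namespace LCDunkl

/-! ### The angular measure -/

/-- The normalization of the weight `(1 + t) (1 - t²)^(k - 1/2)` on `(-1, 1)`. -/
def angularConst (k : ℝ) : ℝ := Real.Gamma (k + 1) / (√Real.pi * Real.Gamma (k + 1 / 2))

/-- The weight `(1 + t) (1 - t²)^(k - 1/2)`. -/
def angularWeight (k t : ℝ) : ℝ := (1 + t) * (1 - t ^ 2) ^ (k - 1 / 2)

/-- The probability measure on `(-1, 1]` with `E_k(z, x) = ∫ exp(zxt) dm(t)`. -/
def angularMeasure (k : ℝ) : Measure ℝ :=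
  if k = -1 / 2 then Measure.dirac 1
  else (volume.restrict (Ioc (-1) 1)).withDensity fun t =>
    ENNReal.ofReal (angularConst k * angularWeight k t)

theorem angularConst_pos {k : ℝ} (hk : -1 / 2 < k) : 0 < angularConst k :=
  div_pos (Real.Gamma_pos_of_pos (by linarith))
    (mul_pos (Real.sqrt_pos.2 Real.pi_pos) (Real.Gamma_pos_of_pos (by linarith)))

theorem measurable_angularWeight (k : ℝ) : Measurable (angularWeight k) := by
  unfold angularWeight; fun_prop

theorem angularWeight_nonneg (k : ℝ) {t : ℝ} (ht : t ∈ Ioc (-1 : ℝ) 1) : 0 ≤ angularWeight k t :=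
  mul_nonneg (by linarith [ht.1]) (Real.rpow_nonneg (by nlinarith [ht.1, ht.2]) _)

/-- The substitution t = 2x - 1 gives the Beta integral B(k+1/2, k+1/2), and the duplication formula
for Γ simplifies Γ(k+1/2)²/Γ(2k+1). -/
theorem integral_one_sub_sq_rpow {k : ℝ} (hk : -1 / 2 < k) :
    ∫ t in (-1 : ℝ)..1, (1 - t ^ 2) ^ (k - 1 / 2) = (angularConst k)⁻¹ := by
  have hu : (0 : ℝ) < k + 1 / 2 := by linarith
  have h1 : ∫ x in (0 : ℝ)..1, (1 - (2 * x - 1) ^ 2) ^ (k - 1 / 2)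
      = 1 / 2 * ∫ t in (-1 : ℝ)..1, (1 - t ^ 2) ^ (k - 1 / 2) := by
    rw [intervalIntegral.integral_comp_mul_sub (fun t : ℝ => (1 - t ^ 2) ^ (k - 1 / 2))
      (two_ne_zero)]
    norm_num
  have h2 : ∫ x in (0 : ℝ)..1, (1 - (2 * x - 1) ^ 2) ^ (k - 1 / 2)
      = 4 ^ (k - 1 / 2) * ∫ x in (0 : ℝ)..1, x ^ (k - 1 / 2) * (1 - x) ^ (k - 1 / 2) := by
    rw [← intervalIntegral.integral_const_mul]
    refine intervalIntegral.integral_congr fun x hx => ?_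
    rw [uIcc_of_le zero_le_one] at hx
    have e : 1 - (2 * x - 1) ^ 2 = 4 * (x * (1 - x)) := by ring
    simp only [e]
    rw [Real.mul_rpow (by norm_num) (mul_nonneg hx.1 (by linarith [hx.2])),
      Real.mul_rpow hx.1 (by linarith [hx.2])]
  have h3 : ((∫ x in (0 : ℝ)..1, x ^ (k - 1 / 2) * (1 - x) ^ (k - 1 / 2) : ℝ) : ℂ)
      = Complex.betaIntegral ((k + 1 / 2 : ℝ) : ℂ) ((k + 1 / 2 : ℝ) : ℂ) := by
    rw [← intervalIntegral.integral_ofReal, Complex.betaIntegral]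
    refine intervalIntegral.integral_congr fun x hx => ?_
    rw [uIcc_of_le zero_le_one] at hx
    simp only [Complex.ofReal_mul]
    rw [Complex.ofReal_cpow hx.1, Complex.ofReal_cpow (by linarith [hx.2] : (0 : ℝ) ≤ 1 - x)]
    push_cast
    ring_nf
  rw [Complex.betaIntegral_eq_Gamma_mul_div _ _ (by simpa using hu) (by simpa using hu),
    ← Complex.ofReal_add, Complex.Gamma_ofReal, Complex.Gamma_ofReal] at h3
  have h3' : ∫ x in (0 : ℝ)..1, x ^ (k - 1 / 2) * (1 - x) ^ (k - 1 / 2)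
      = Real.Gamma (k + 1 / 2) * Real.Gamma (k + 1 / 2) / Real.Gamma (k + 1 / 2 + (k + 1 / 2)) := by
    exact_mod_cast h3
  have hd := Real.Gamma_mul_Gamma_add_half (k + 1 / 2)
  rw [show k + 1 / 2 + 1 / 2 = k + 1 by ring, show 2 * (k + 1 / 2) = 2 * k + 1 by ring] at hd
  rw [h2, h3', show k + 1 / 2 + (k + 1 / 2) = 2 * k + 1 by ring] at h1
  have hp : (4 : ℝ) ^ (k - 1 / 2) * (2 : ℝ) ^ (1 - (2 * k + 1)) = 1 / 2 := by
    rw [show (4 : ℝ) = 2 ^ (2 : ℝ) by norm_num, ← Real.rpow_mul (by norm_num),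
      ← Real.rpow_add (by norm_num), show 2 * (k - 1 / 2) + (1 - (2 * k + 1)) = -1 by ring,
      Real.rpow_neg_one]
    norm_num
  have g1 : Real.Gamma (k + 1) ≠ 0 := (Real.Gamma_pos_of_pos (by linarith)).ne'
  have g2 : Real.Gamma (k + 1 / 2) ≠ 0 := (Real.Gamma_pos_of_pos (by linarith)).ne'
  have g3 : Real.Gamma (2 * k + 1) ≠ 0 := (Real.Gamma_pos_of_pos (by linarith)).ne'
  rw [angularConst, inv_div, eq_div_iff g1]
  rw [← mul_div_assoc, div_eq_iff g3] at h1
  set I := ∫ t in (-1 : ℝ)..1, (1 - t ^ 2) ^ (k - 1 / 2)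
  have : I * Real.Gamma (k + 1) * (Real.Gamma (k + 1 / 2) * Real.Gamma (2 * k + 1))
      = √Real.pi * Real.Gamma (k + 1 / 2) * (Real.Gamma (k + 1 / 2) * Real.Gamma (2 * k + 1)) := by
    calc I * Real.Gamma (k + 1) * (Real.Gamma (k + 1 / 2) * Real.Gamma (2 * k + 1))
        = (Real.Gamma (2 * k + 1) * I) * (Real.Gamma (k + 1 / 2) * Real.Gamma (k + 1)) := by ring
      _ = 2 * ((4 : ℝ) ^ (k - 1 / 2) * (2 : ℝ) ^ (1 - (2 * k + 1))) *
          (√Real.pi * Real.Gamma (k + 1 / 2) *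
            (Real.Gamma (k + 1 / 2) * Real.Gamma (2 * k + 1))) := by
          rw [hd]
          linear_combination (-2 * (Real.Gamma (2 * k + 1) * 2 ^ (1 - (2 * k + 1)) * √Real.pi)) * h1
      _ = _ := by rw [hp]; ring
  exact mul_right_cancel₀ (mul_ne_zero g2 g3) this

theorem intervalIntegrable_one_sub_sq_rpow {k : ℝ} (hk : -1 / 2 < k) :
    IntervalIntegrable (fun t : ℝ => (1 - t ^ 2) ^ (k - 1 / 2)) volume (-1) 1 := by
  -- The integral of a non-integrable function is 0 by convention, so a nonzero value proves
  -- integrability.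
  apply intervalIntegral.intervalIntegrable_of_integral_ne_zero
  rw [integral_one_sub_sq_rpow hk]
  exact inv_ne_zero (angularConst_pos hk).ne'

theorem intervalIntegrable_mul_rpow {k : ℝ} (hk : -1 / 2 < k) {p : ℝ → ℝ} (hp : Continuous p) :
    IntervalIntegrable (fun t : ℝ => p t * (1 - t ^ 2) ^ (k - 1 / 2)) volume (-1) 1 :=
  (intervalIntegrable_one_sub_sq_rpow hk).continuousOn_mul hp.continuousOn

theorem integral_odd_mul_rpow (r : ℝ) {p : ℝ → ℝ} (hp : ∀ t, p (-t) = -p t) :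
    ∫ t in (-1 : ℝ)..1, p t * (1 - t ^ 2) ^ r = 0 := by
  have h := intervalIntegral.integral_comp_neg (a := -1) (b := 1)
    (fun t : ℝ => p t * (1 - t ^ 2) ^ r)
  simp only [hp, neg_neg, neg_sq, neg_mul, intervalIntegral.integral_neg] at h
  linarith

theorem integral_angularMeasure {E : Type*} [NormedAddCommGroup E] [NormedSpace ℝ E] {k : ℝ}
    (hk : -1 / 2 < k) (F : ℝ → E) :
    ∫ t, F t ∂angularMeasure k
      = angularConst k • ∫ t in (-1 : ℝ)..1, angularWeight k t • F t := by
  have h0 : k ≠ -1 / 2 := hk.ne'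
  rw [angularMeasure, if_neg h0, integral_withDensity_eq_integral_toReal_smul
    (by have := measurable_angularWeight k; fun_prop) (by simp),
    intervalIntegral.integral_of_le (by norm_num), ← integral_smul]
  refine setIntegral_congr_fun measurableSet_Ioc fun t ht => ?_
  rw [ENNReal.toReal_ofReal (mul_nonneg (angularConst_pos hk).le (angularWeight_nonneg k ht)),
    mul_smul]

theorem lintegral_angularMeasure {k : ℝ} (hk : -1 / 2 < k) (F : ℝ → ℝ≥0∞) (hF : Measurable F) :
    ∫⁻ t, F t ∂angularMeasure k
      = ∫⁻ t in Ioc (-1 : ℝ) 1, ENNReal.ofReal (angularConst k * angularWeight k t) * F t := by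
  have h0 : k ≠ -1 / 2 := hk.ne'
  rw [angularMeasure, if_neg h0, lintegral_withDensity_eq_lintegral_mul _
    (by have := measurable_angularWeight k; fun_prop) hF]
  rfl

theorem angularMeasure_neg_half : angularMeasure (-1 / 2) = Measure.dirac 1 := if_pos rfl

theorem ae_angularMeasure (k : ℝ) : ∀ᵐ t ∂angularMeasure k, t ∈ Ioc (-1 : ℝ) 1 := by
  unfold angularMeasure
  split_ifs
  · refine (ae_dirac_iff (p := fun t => t ∈ Ioc (-1 : ℝ) 1) measurableSet_Ioc).2 ?_
    norm_num
  · exact (withDensity_absolutelyContinuous _ _).ae_le (ae_restrict_mem measurableSet_Ioc)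

theorem intervalIntegral_angularWeight {k : ℝ} (hk : -1 / 2 < k) {p : ℝ → ℝ} (hp : Continuous p) :
    ∫ t in (-1 : ℝ)..1, angularWeight k t • p t
      = (∫ t in (-1 : ℝ)..1, p t * (1 - t ^ 2) ^ (k - 1 / 2))
        + ∫ t in (-1 : ℝ)..1, (t * p t) * (1 - t ^ 2) ^ (k - 1 / 2) := by
  rw [← intervalIntegral.integral_add (intervalIntegrable_mul_rpow hk hp)
    (intervalIntegrable_mul_rpow hk (p := fun t => t * p t) (by fun_prop))]
  refine intervalIntegral.integral_congr fun t _ => ?_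
  simp only [angularWeight, smul_eq_mul]
  ring

theorem isProbabilityMeasure_angularMeasure {k : ℝ} (hk : -1 / 2 ≤ k) :
    IsProbabilityMeasure (angularMeasure k) := by
  rcases hk.eq_or_lt with rfl | hk
  · rw [angularMeasure_neg_half]; infer_instance
  have h1 : ∫ t in (-1 : ℝ)..1, angularWeight k t = (angularConst k)⁻¹ := by
    have := intervalIntegral_angularWeight hk (p := fun _ => 1) continuous_const
    simp only [smul_eq_mul, mul_one, one_mul] at this
    rw [this, integral_one_sub_sq_rpow hk, integral_odd_mul_rpow (p := fun t => t) _ (by simp)]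
    simp
  have hint : IntegrableOn (angularWeight k) (Ioc (-1) 1) := by
    have := (intervalIntegrable_mul_rpow hk (p := fun t => 1 + t) (by fun_prop))
    rw [intervalIntegrable_iff_integrableOn_Ioc_of_le (by norm_num)] at this
    exact this
  refine ⟨?_⟩
  have := lintegral_angularMeasure hk (fun _ => 1) measurable_const
  simp only [mul_one, lintegral_one] at this
  rw [this, ← ofReal_integral_eq_lintegral_ofReal (hint.const_mul _)
    ((ae_restrict_mem measurableSet_Ioc).mono fun t ht =>
      mul_nonneg (angularConst_pos hk).le (angularWeight_nonneg k ht)),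
    integral_const_mul, ← intervalIntegral.integral_of_le (by norm_num), h1,
    mul_inv_cancel₀ (angularConst_pos hk).ne', ENNReal.ofReal_one]

/-- The moments of the angular measure. -/
def angularMoment (k : ℝ) (n : ℕ) : ℝ := ∫ t, t ^ n ∂angularMeasure k

theorem angularMoment_zero {k : ℝ} (hk : -1 / 2 ≤ k) : angularMoment k 0 = 1 := by
  have := isProbabilityMeasure_angularMeasure hk
  simp [angularMoment]

/-- Apart from the factor 1 + t the weight is even, so only the even part of tⁿ(1 + t) contributes.
It is t^(2m+2) for both exponents. -/
theorem angularMoment_odd_add_one {k : ℝ} (hk : -1 / 2 ≤ k) (m : ℕ) :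
    angularMoment k (2 * m + 2) = angularMoment k (2 * m + 1) := by
  rcases hk.eq_or_lt with rfl | hk
  · simp [angularMoment, angularMeasure_neg_half]
  rw [angularMoment, angularMoment, integral_angularMeasure hk, integral_angularMeasure hk,
    intervalIntegral_angularWeight hk (by fun_prop),
    intervalIntegral_angularWeight hk (by fun_prop),
    integral_odd_mul_rpow (p := fun t => t * t ^ (2 * m + 2)) _
      (by intro t; rw [Even.neg_pow ⟨m + 1, by ring⟩]; ring),
    integral_odd_mul_rpow (p := fun t => t ^ (2 * m + 1)) _
      (by intro t; exact Odd.neg_pow ⟨m, rfl⟩ t)]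
  simp only [add_zero, zero_add]
  congr 2
  funext t
  ring

/-- Integration by parts: the derivative of t^(2m+1) (1 - t²)^(k+1/2) has integral zero over [-1,
1], because k + 1/2 > 0 kills the boundary values. -/
theorem angularMoment_even_add_one {k : ℝ} (hk : -1 / 2 ≤ k) (m : ℕ) :
    (2 * m + 2 * k + 2) * angularMoment k (2 * m + 1) = (2 * m + 1) * angularMoment k (2 * m) := by
  rcases hk.eq_or_lt with rfl | hk
  · simp [angularMoment, angularMeasure_neg_half]
    ring
  have o1 : ∫ t in (-1 : ℝ)..1, t ^ (2 * m + 1) * (1 - t ^ 2) ^ (k - 1 / 2) = 0 :=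
    integral_odd_mul_rpow (p := fun t => t ^ (2 * m + 1)) _
      (by intro t; exact Odd.neg_pow ⟨m, rfl⟩ t)
  have o2 : ∫ t in (-1 : ℝ)..1, (t * t ^ (2 * m)) * (1 - t ^ 2) ^ (k - 1 / 2) = 0 := by
    rw [← o1]; congr 1; funext t; ring
  rw [angularMoment, angularMoment, integral_angularMeasure hk, integral_angularMeasure hk,
    intervalIntegral_angularWeight hk (by fun_prop),
    intervalIntegral_angularWeight hk (by fun_prop), o1, o2]
  simp only [add_zero, zero_add, smul_eq_mul]
  have i1 := intervalIntegrable_mul_rpow hk (p := fun t => t ^ (2 * m)) (by fun_prop)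
  have i2 := intervalIntegrable_mul_rpow hk (p := fun t => t * t ^ (2 * m + 1)) (by fun_prop)
  have key : ∫ t in (-1 : ℝ)..1, ((2 * m + 1) * (t ^ (2 * m) * (1 - t ^ 2) ^ (k - 1 / 2))
      - (2 * m + 2 * k + 2) * (t * t ^ (2 * m + 1) * (1 - t ^ 2) ^ (k - 1 / 2))) = 0 := by
    rw [intervalIntegral.integral_eq_sub_of_hasDerivAt_of_le (by norm_num)
      (f := fun t : ℝ => t ^ (2 * m + 1) * (1 - t ^ 2) ^ (k + 1 / 2)) ?_ ?_
      ((i1.const_mul _).sub (i2.const_mul _))]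
    · have h0 : k + 1 / 2 ≠ 0 := by linarith
      norm_num [Real.zero_rpow h0]
    · refine Continuous.continuousOn ?_
      refine (continuous_pow _).mul (Continuous.rpow_const (by fun_prop) fun x => Or.inr ?_)
      linarith
    · intro t ht
      have hpos : 0 < 1 - t ^ 2 := by nlinarith [ht.1, ht.2]
      have d1 : HasDerivAt (fun t : ℝ => 1 - t ^ 2) (-(2 * t)) t := by
        simpa using (hasDerivAt_pow 2 t).const_sub 1
      have d2 := d1.rpow_const (p := k + 1 / 2) (Or.inl hpos.ne')
      have d3 := (hasDerivAt_pow (2 * m + 1) t).mul d2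
      refine d3.congr_deriv ?_
      have e : (1 - t ^ 2) ^ (k + 1 / 2) = (1 - t ^ 2) * (1 - t ^ 2) ^ (k - 1 / 2) := by
        rw [← Real.rpow_one_add' hpos.le (by linarith)]; congr 1; ring
      rw [e, show k + 1 / 2 - 1 = k - 1 / 2 by ring]
      simp only [Nat.add_sub_cancel]
      push_cast
      ring
  rw [intervalIntegral.integral_sub (i1.const_mul _) (i2.const_mul _),
    intervalIntegral.integral_const_mul, intervalIntegral.integral_const_mul] at key
  linear_combination (-angularConst k) * key

theorem angularMoment_even_add_two {k : ℝ} (hk : -1 / 2 ≤ k) (m : ℕ) :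
    (2 * m + 2 * k + 2) * angularMoment k (2 * (m + 1)) = (2 * m + 1) * angularMoment k (2 * m) := by
  rw [← angularMoment_even_add_one hk, ← angularMoment_odd_add_one hk]
  rfl

/-! ### The Dunkl exponential -/

/-- The derivatives `∫ t^n exp(wt) dm(t)` of the Dunkl exponential. -/
def dexpDeriv (k : ℝ) (n : ℕ) (w : ℂ) : ℂ := ∫ t, (t : ℂ) ^ n * Complex.exp (w * t) ∂angularMeasure k

/-- The Dunkl exponential `e(w) = ∫ exp(wt) dm(t)`, so that `E_k(z, x) = e(zx)`. -/
def dexp (k : ℝ) (w : ℂ) : ℂ := ∫ t, Complex.exp (w * t) ∂angularMeasure k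

theorem dexpDeriv_zero (k : ℝ) : dexpDeriv k 0 = dexp k := by
  funext w; simp [dexpDeriv, dexp]

theorem norm_exp_mul_le {w : ℂ} {t : ℝ} (ht : t ∈ Ioc (-1 : ℝ) 1) :
    ‖Complex.exp (w * t)‖ ≤ Real.exp |w.re| := by
  rw [Complex.norm_exp, Complex.re_mul_ofReal]
  refine Real.exp_le_exp.2 ((le_abs_self _).trans ?_)
  rw [abs_mul]
  exact mul_le_of_le_one_right (abs_nonneg _) (abs_le.2 ⟨ht.1.le, ht.2⟩)

theorem norm_pow_le_one {t : ℝ} (ht : t ∈ Ioc (-1 : ℝ) 1) (n : ℕ) : ‖(t : ℂ) ^ n‖ ≤ 1 := by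
  rw [norm_pow, Complex.norm_real]
  exact pow_le_one₀ (norm_nonneg _) (abs_le.2 ⟨ht.1.le, ht.2⟩)

/-- The representing measure is a probability measure on (-1, 1]. On the imaginary axis the bound
becomes 1, which is what makes the Dunkl transform bounded on L¹. -/
theorem norm_dexpDeriv_le {k : ℝ} (hk : -1 / 2 ≤ k) (n : ℕ) (w : ℂ) :
    ‖dexpDeriv k n w‖ ≤ Real.exp |w.re| := by
  have := isProbabilityMeasure_angularMeasure hk
  refine (norm_integral_le_of_norm_le_const (C := Real.exp |w.re|) ?_).trans (by simp)
  filter_upwards [ae_angularMeasure k] with t ht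
  rw [norm_mul]
  exact (mul_le_of_le_one_left (norm_nonneg _) (norm_pow_le_one ht n)).trans (norm_exp_mul_le ht)

theorem norm_dexp_le {k : ℝ} (hk : -1 / 2 ≤ k) (w : ℂ) : ‖dexp k w‖ ≤ Real.exp |w.re| := by
  rw [← dexpDeriv_zero]; exact norm_dexpDeriv_le hk 0 w

theorem norm_dexpDeriv_le_one {k : ℝ} (hk : -1 / 2 ≤ k) (n : ℕ) {w : ℂ} (hw : w.re = 0) :
    ‖dexpDeriv k n w‖ ≤ 1 := by
  simpa [hw] using norm_dexpDeriv_le hk n w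

theorem norm_dexp_le_one {k : ℝ} (hk : -1 / 2 ≤ k) {w : ℂ} (hw : w.re = 0) :
    ‖dexp k w‖ ≤ 1 := by
  rw [← dexpDeriv_zero]; exact norm_dexpDeriv_le_one hk 0 hw

theorem hasDerivAt_dexpDeriv {k : ℝ} (hk : -1 / 2 ≤ k) (n : ℕ) (w : ℂ) :
    HasDerivAt (dexpDeriv k n) (dexpDeriv k (n + 1) w) w := by
  have := isProbabilityMeasure_angularMeasure hk
  refine (hasDerivAt_integral_of_dominated_loc_of_deriv_le (μ := angularMeasure k)
    (F := fun (w : ℂ) (t : ℝ) => (t : ℂ) ^ n * Complex.exp (w * t))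
    (F' := fun (w : ℂ) (t : ℝ) => (t : ℂ) ^ (n + 1) * Complex.exp (w * t))
    (bound := fun _ => Real.exp (‖w‖ + 1)) (Metric.ball_mem_nhds w one_pos) ?_ ?_ ?_ ?_ ?_ ?_).2
  · exact Eventually.of_forall fun w => (by fun_prop : Continuous _).aestronglyMeasurable
  · refine Integrable.of_bound (C := Real.exp |w.re|)
      (by fun_prop : Continuous _).aestronglyMeasurable ?_
    filter_upwards [ae_angularMeasure k] with t ht
    rw [norm_mul]
    exact (mul_le_of_le_one_left (norm_nonneg _) (norm_pow_le_one ht n)).trans (norm_exp_mul_le ht)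
  · exact (by fun_prop : Continuous _).aestronglyMeasurable
  · filter_upwards [ae_angularMeasure k] with t ht v hv
    rw [norm_mul]
    refine (mul_le_of_le_one_left (norm_nonneg _) (norm_pow_le_one ht _)).trans
      ((norm_exp_mul_le ht).trans (Real.exp_le_exp.2 ((Complex.abs_re_le_norm v).trans ?_)))
    have h1 : ‖v - w‖ < 1 := by simpa [dist_eq_norm] using hv
    linarith [norm_le_norm_add_norm_sub' v w]
  · exact integrable_const _
  · refine Eventually.of_forall fun t v _ => ?_
    have h := ((hasDerivAt_id v).mul_const (t : ℂ)).cexp.const_mul ((t : ℂ) ^ n)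
    refine h.congr_deriv ?_
    simp only [id, one_mul]
    ring

theorem continuous_dexpDeriv {k : ℝ} (hk : -1 / 2 ≤ k) (n : ℕ) : Continuous (dexpDeriv k n) :=
  continuous_iff_continuousAt.2 fun w => (hasDerivAt_dexpDeriv hk n w).continuousAt

theorem continuous_dexp {k : ℝ} (hk : -1 / 2 ≤ k) : Continuous (dexp k) := by
  rw [← dexpDeriv_zero]; exact continuous_dexpDeriv hk 0

theorem conj_dexp (k : ℝ) (w : ℂ) : (starRingEnd ℂ) (dexp k w) = dexp k ((starRingEnd ℂ) w) := by
  rw [dexp, dexp, ← integral_conj]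
  simp [← Complex.exp_conj]

theorem hasSum_of_forall_eq {ι : Type*} {f g : ι → ℂ} {a : ℂ} (h : HasSum f a)
    (e : ∀ n, f n = g n) : HasSum g a := (funext e : f = g) ▸ h

theorem hasSum_dexpDeriv {k : ℝ} (hk : -1 / 2 ≤ k) (j : ℕ) (w : ℂ) :
    HasSum (fun n : ℕ => (angularMoment k (n + j) : ℂ) * (w ^ n / n.factorial))
      (dexpDeriv k j w) := by
  have := isProbabilityMeasure_angularMeasure hk
  have h := hasSum_integral_of_dominated_convergence (μ := angularMeasure k)
    (F := fun (n : ℕ) (t : ℝ) => (t : ℂ) ^ (n + j) * (w ^ n / n.factorial))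
    (f := fun t : ℝ => (t : ℂ) ^ j * Complex.exp (w * t))
    (fun n _ => ‖w‖ ^ n / n.factorial) ?_ ?_ ?_ ?_ ?_
  · refine hasSum_of_forall_eq h fun n => ?_
    rw [integral_mul_const, angularMoment, ← integral_complex_ofReal]
    simp
  · exact fun n => (by fun_prop : Continuous _).aestronglyMeasurable
  · intro n
    filter_upwards [ae_angularMeasure k] with t ht
    rw [norm_mul]
    refine (mul_le_of_le_one_left (norm_nonneg _) (norm_pow_le_one ht _)).trans ?_
    simp
  · exact Eventually.of_forall fun _ => Real.summable_pow_div_factorial _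
  · exact integrable_const _
  · refine Eventually.of_forall fun t => ?_
    have h1 := (NormedSpace.expSeries_div_hasSum_exp (w * (t : ℂ))).mul_left ((t : ℂ) ^ j)
    rw [← Complex.exp_eq_exp_ℂ] at h1
    refine hasSum_of_forall_eq h1 fun n => ?_
    rw [mul_pow, pow_add]
    ring

theorem hasSum_dexp {k : ℝ} (hk : -1 / 2 ≤ k) (w : ℂ) :
    HasSum (fun n : ℕ => (angularMoment k n : ℂ) * (w ^ n / n.factorial)) (dexp k w) := by
  rw [← dexpDeriv_zero]; exact hasSum_dexpDeriv hk 0 w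

/-- Solves the two-step recursion for the moments; the result is the form in which they appear as
coefficients of the Bessel series. -/
theorem angularMoment_even {k : ℝ} (hk : -1 / 2 ≤ k) (m : ℕ) :
    angularMoment k (2 * m) * (4 ^ m * m.factorial * Real.Gamma (m + k + 1))
      = Real.Gamma (k + 1) * (2 * m).factorial := by
  induction m with
  | zero => simp [angularMoment_zero hk]
  | succ m ih =>
    have h := angularMoment_even_add_two hk m
    have hm : (0 : ℝ) ≤ m := Nat.cast_nonneg m
    have hG : Real.Gamma ((m + 1 : ℕ) + k + 1) = (m + k + 1) * Real.Gamma (m + k + 1) := by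
      rw [← Real.Gamma_add_one (by linarith)]; push_cast; ring_nf
    have hf : ((2 * (m + 1)).factorial : ℝ) = (2 * m + 2) * ((2 * m + 1) * (2 * m).factorial) := by
      rw [show 2 * (m + 1) = 2 * m + 1 + 1 by ring, Nat.factorial_succ, Nat.factorial_succ]
      push_cast; ring
    rw [hG, hf, Nat.factorial_succ, pow_succ]
    push_cast
    linear_combination (2 * (4 ^ m * (m + 1) * m.factorial * Real.Gamma (m + k + 1))) * h +
      (2 * m + 2) * (2 * m + 1) * ih

theorem besselJ_coeff {k : ℝ} (hk : -1 / 2 ≤ k) (w : ℂ) (m : ℕ) :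
    ((-1) ^ m * (Real.Gamma (k + 1) : ℂ) / ((m.factorial : ℂ) * (Real.Gamma (m + k + 1) : ℂ))) *
      (Complex.I * w / 2) ^ (2 * m)
      = (angularMoment k (2 * m) : ℂ) * (w ^ (2 * m) / (2 * m).factorial) := by
  have hG : (Real.Gamma (m + k + 1) : ℂ) ≠ 0 := by
    have : (0 : ℝ) ≤ m := Nat.cast_nonneg m
    exact_mod_cast (Real.Gamma_pos_of_pos (by linarith)).ne'
  have hI : (Complex.I * w / 2) ^ (2 * m) = (-1) ^ m * w ^ (2 * m) / 4 ^ m := by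
    rw [div_pow, mul_pow, pow_mul, Complex.I_sq, pow_mul (2 : ℂ)]
    norm_num
  have hM : (angularMoment k (2 * m) : ℂ) * (4 ^ m * m.factorial * Real.Gamma (m + k + 1))
      = Real.Gamma (k + 1) * (2 * m).factorial := by
    exact_mod_cast angularMoment_even hk m
  have hsq : ((-1 : ℂ) ^ m) * (-1) ^ m = 1 := by rw [← mul_pow]; simp
  have h1 : (m.factorial : ℂ) ≠ 0 := by exact_mod_cast m.factorial_ne_zero
  have h2 : ((2 * m).factorial : ℂ) ≠ 0 := by exact_mod_cast (2 * m).factorial_ne_zero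
  have h4 : (4 : ℂ) ^ m ≠ 0 := pow_ne_zero _ (by norm_num)
  rw [hI]
  generalize ((2 * m).factorial : ℂ) = F at *
  generalize (m.factorial : ℂ) = f at *
  generalize (Real.Gamma (m + k + 1) : ℂ) = G at *
  generalize (4 : ℂ) ^ m = q at *
  generalize ((-1 : ℂ) ^ m) = s at *
  field_simp
  linear_combination (w ^ (2 * m) * F * Real.Gamma (k + 1)) * hsq - w ^ (2 * m) * hM

/-- Both Γ factors are lowered by the functional equation and the odd moment by its recursion, which
leaves the even case. -/
theorem besselJ_coeff_odd {k : ℝ} (hk : -1 / 2 ≤ k) (w : ℂ) (m : ℕ) :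
    w / (2 * ((k : ℂ) + 1)) * (((-1) ^ m * (Real.Gamma (k + 1 + 1) : ℂ) /
      ((m.factorial : ℂ) * (Real.Gamma (m + (k + 1) + 1) : ℂ))) * (Complex.I * w / 2) ^ (2 * m))
      = (angularMoment k (2 * m + 1) : ℂ) * (w ^ (2 * m + 1) / (2 * m + 1).factorial) := by
  have hk1 : (k : ℂ) + 1 ≠ 0 := by
    have : k + 1 ≠ 0 := by linarith
    exact_mod_cast this
  have hm0 : (0 : ℝ) ≤ m := Nat.cast_nonneg m
  have e1 : (Real.Gamma (k + 1 + 1) : ℂ) = (k + 1) * Real.Gamma (k + 1) := by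
    rw [Real.Gamma_add_one (by linarith)]; push_cast; ring
  have e2 : (Real.Gamma (m + (k + 1) + 1) : ℂ) = (m + k + 1) * Real.Gamma (m + k + 1) := by
    rw [← add_assoc, Real.Gamma_add_one (by linarith)]; push_cast; ring
  have hM : ((2 * m + 2 * k + 2 : ℂ)) * angularMoment k (2 * m + 1)
      = (2 * m + 1) * angularMoment k (2 * m) := by
    exact_mod_cast angularMoment_even_add_one hk m
  have hf : (((2 * m + 1).factorial : ℕ) : ℂ) = (2 * m + 1) * (2 * m).factorial := by
    rw [Nat.factorial_succ]; push_cast; ring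
  have hmk : (m : ℂ) + k + 1 ≠ 0 := by
    have : (m : ℝ) + k + 1 ≠ 0 := by linarith
    exact_mod_cast this
  have h2m : 2 * (m : ℂ) + 1 ≠ 0 := by exact_mod_cast (2 * m).succ_ne_zero
  have h1 : (m.factorial : ℂ) ≠ 0 := by exact_mod_cast m.factorial_ne_zero
  have h2 : ((2 * m).factorial : ℂ) ≠ 0 := by exact_mod_cast (2 * m).factorial_ne_zero
  have hG : (Real.Gamma (m + k + 1) : ℂ) ≠ 0 := by
    exact_mod_cast (Real.Gamma_pos_of_pos (by linarith)).ne'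
  have hM' : (angularMoment k (2 * m + 1) : ℂ)
      = (2 * m + 1) * angularMoment k (2 * m) / (2 * (m + k + 1)) := by
    rw [eq_div_iff (mul_ne_zero two_ne_zero hmk), ← hM]; ring
  have key := besselJ_coeff hk w m
  rw [e1, e2, hf, hM', pow_succ]
  rw [show w / (2 * ((k : ℂ) + 1)) * ((-1) ^ m * ((k + 1) * (Real.Gamma (k + 1) : ℂ)) /
      (m.factorial * ((m + k + 1) * Real.Gamma (m + k + 1))) * (Complex.I * w / 2) ^ (2 * m))
      = w / (2 * (m + k + 1)) * (((-1) ^ m * (Real.Gamma (k + 1) : ℂ) /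
        ((m.factorial : ℂ) * (Real.Gamma (m + k + 1) : ℂ))) * (Complex.I * w / 2) ^ (2 * m)) by
    field_simp, key]
  generalize ((2 * m).factorial : ℂ) = F at *
  field_simp

theorem tsum_even_add_tsum_odd {F : ℕ → ℂ} {a : ℂ} (hs : HasSum F a) :
    ∑' m : ℕ, F (2 * m) + ∑' m : ℕ, F (2 * m + 1) = a := by
  rw [← hs.tsum_eq]
  exact tsum_even_add_odd (f := F)
    (hs.summable.comp_injective (i := fun m : ℕ => 2 * m) fun a b h => by simpa using h)
    (hs.summable.comp_injective (i := fun m : ℕ => 2 * m + 1) fun a b h => by simpa using h)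

/-- In the power series of e(w), the even terms sum to j_k(iw) and the odd ones to w/(2(k+1))
j_{k+1}(iw). -/
theorem dunklKernel_eq {k : ℝ} (hk : -1 / 2 ≤ k) (z : ℂ) (x : ℝ) :
    dunklKernel k z x = dexp k (z * x) := by
  have e1 : besselJ k (Complex.I * (z * x)) = _ :=
    tsum_congr fun m => besselJ_coeff hk (z * x) m
  have e2 : z * x / (2 * ((k : ℂ) + 1)) * besselJ (k + 1) (Complex.I * (z * x)) = _ :=
    tsum_mul_left.symm.trans (tsum_congr fun m => besselJ_coeff_odd hk (z * x) m)
  rw [dunklKernel, mul_assoc, e1, e2]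
  exact tsum_even_add_tsum_odd (hasSum_dexp hk (z * x))

/-- The eigenvalue equation Te = e of the Dunkl operator Tf = f' + (k + 1/2)(f(w) - f(-w))/w,
multiplied by w to avoid the division. Comparing coefficients, it is the pair of recursions for the
moments. -/
theorem dexp_sub_dexp_neg {k : ℝ} (hk : -1 / 2 ≤ k) (w : ℂ) :
    w * dexpDeriv k 1 w + (2 * k + 1) / 2 * (dexp k w - dexp k (-w)) = w * dexp k w := by
  have h1 := (hasSum_dexpDeriv hk 1 w).mul_left w
  have h2 := ((hasSum_dexp hk w).sub (hasSum_dexp hk (-w))).mul_left (((2 * k + 1) / 2 : ℂ))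
  have h3 := (hasSum_dexp hk w).mul_left w
  -- The constant terms of e(w) and e(-w) cancel, so this series may start at index 1, in step with
  -- the two that carry a factor w.
  rw [← hasSum_nat_add_iff' 1] at h2
  have h4 := h1.add h2
  simp only [Finset.range_one, Finset.sum_singleton, pow_zero, sub_self, mul_zero, sub_zero] at h4
  refine h4.unique (hasSum_of_forall_eq h3 fun n => ?_)
  have hf : ((n + 1).factorial : ℂ) = (n + 1) * n.factorial := by
    rw [Nat.factorial_succ]; push_cast; ring
  have hn : (n.factorial : ℂ) ≠ 0 := by exact_mod_cast n.factorial_ne_zero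
  have hn1 : (n : ℂ) + 1 ≠ 0 := by exact_mod_cast n.succ_ne_zero
  rw [hf]
  rcases Nat.even_or_odd' n with ⟨m, rfl | rfl⟩
  · have hM : ((2 * m + 2 * k + 2 : ℂ)) * angularMoment k (2 * m + 1)
        = (2 * m + 1) * angularMoment k (2 * m) := by
      exact_mod_cast angularMoment_even_add_one hk m
    rw [Odd.neg_pow ⟨m, rfl⟩]
    push_cast at hn1 ⊢
    field_simp
    linear_combination (-2 * w ^ (2 * m + 1)) * hM
  · rw [Even.neg_pow ⟨m + 1, by ring⟩, angularMoment_odd_add_one hk]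
    push_cast
    ring

/-! ### The translation as an integral -/

/-- The integrand of the generalized translation. -/
def translationKernel (f : ℝ → ℂ) (x y t : ℝ) : ℂ :=
  (f √(x ^ 2 + y ^ 2 + 2 * x * y * t) + f (-√(x ^ 2 + y ^ 2 + 2 * x * y * t))) / 2 +
    (((x + y) / √(x ^ 2 + y ^ 2 + 2 * x * y * t) : ℝ) : ℂ) *
      ((f √(x ^ 2 + y ^ 2 + 2 * x * y * t) - f (-√(x ^ 2 + y ^ 2 + 2 * x * y * t))) / 2)

/-- For k = -1/2 the Dirac mass at t = 1 gives A = |x + y|, and the even and odd parts recombine to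
f(x + y). One formula thus covers both cases of the definition. -/
theorem dunklTranslation_eq {k : ℝ} (hk : -1 / 2 ≤ k) (x : ℝ) (f : ℝ → ℂ) (y : ℝ) :
    dunklTranslation k x f y = ∫ t, translationKernel f x y t ∂angularMeasure k := by
  rcases hk.eq_or_lt with rfl | hk
  · rw [dunklTranslation, if_pos rfl, angularMeasure_neg_half, integral_dirac, translationKernel,
      show x ^ 2 + y ^ 2 + 2 * x * y * 1 = (x + y) ^ 2 by ring, Real.sqrt_sq_eq_abs]
    rcases lt_trichotomy (x + y) 0 with h | h | h
    · rw [abs_of_neg h, neg_neg, div_neg, div_self h.ne]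
      push_cast
      ring
    · simp [h]
    · rw [abs_of_pos h, div_self h.ne']
      push_cast
      ring
  · rw [dunklTranslation, if_neg hk.ne', integral_angularMeasure hk]
    rw [angularConst, Complex.real_smul]
    congr 1
    refine intervalIntegral.integral_congr fun t _ => ?_
    simp only [translationKernel, angularWeight, Complex.real_smul]
    ring

/-! ### The weighted measure -/

/-- The density of `μ_k`. -/
def muDensity (k x : ℝ) : ℝ := |x| ^ (2 * k + 1) / (2 ^ (k + 1) * Real.Gamma (k + 1))

theorem muDensity_const_pos {k : ℝ} (hk : -1 / 2 ≤ k) : 0 < 2 ^ (k + 1) * Real.Gamma (k + 1) :=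
  mul_pos (Real.rpow_pos_of_pos two_pos _) (Real.Gamma_pos_of_pos (by linarith))

theorem muDensity_nonneg {k : ℝ} (hk : -1 / 2 ≤ k) (x : ℝ) : 0 ≤ muDensity k x :=
  div_nonneg (Real.rpow_nonneg (abs_nonneg _) _) (muDensity_const_pos hk).le

theorem muDensity_pos {k : ℝ} (hk : -1 / 2 ≤ k) {x : ℝ} (hx : x ≠ 0) : 0 < muDensity k x :=
  div_pos (Real.rpow_pos_of_pos (abs_pos.2 hx) _) (muDensity_const_pos hk)

theorem muDensity_neg (k x : ℝ) : muDensity k (-x) = muDensity k x := by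
  simp [muDensity]

theorem measurable_muDensity (k : ℝ) : Measurable (muDensity k) := by
  unfold muDensity; fun_prop

theorem continuous_muDensity {k : ℝ} (hk : -1 / 2 ≤ k) : Continuous (muDensity k) :=
  (continuous_abs.rpow_const fun _ => Or.inr (by linarith)).div_const _

theorem muDensity_mul (k r x : ℝ) : muDensity k (r * x) = |r| ^ (2 * k + 1) * muDensity k x := by
  rw [muDensity, muDensity, abs_mul, Real.mul_rpow (abs_nonneg _) (abs_nonneg _), mul_div_assoc]

theorem mu_eq (k : ℝ) : mu k = volume.withDensity fun x => ENNReal.ofReal (muDensity k x) := rfl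

instance sigmaFinite_mu (k : ℝ) : SigmaFinite (mu k) := by
  rw [mu_eq]; infer_instance

theorem isLocallyFiniteMeasure_mu {k : ℝ} (hk : -1 / 2 ≤ k) : IsLocallyFiniteMeasure (mu k) :=
  IsLocallyFiniteMeasure.withDensity_ofReal (continuous_muDensity hk)

theorem mu_absolutelyContinuous (k : ℝ) : mu k ≪ volume := withDensity_absolutelyContinuous _ _

theorem absolutelyContinuous_mu {k : ℝ} (hk : -1 / 2 ≤ k) : volume ≪ mu k := by
  refine withDensity_absolutelyContinuous' (measurable_muDensity k).ennreal_ofReal.aemeasurable ?_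
  filter_upwards [Measure.ae_ne volume 0] with x hx
  exact (ENNReal.ofReal_pos.2 (muDensity_pos hk hx)).ne'

theorem lintegral_mu (k : ℝ) (f : ℝ → ℝ≥0∞) :
    ∫⁻ x, f x ∂mu k = ∫⁻ x, ENNReal.ofReal (muDensity k x) * f x := by
  rw [mu_eq, lintegral_withDensity_eq_lintegral_mul_non_measurable _
    (measurable_muDensity k).ennreal_ofReal (by simp)]
  rfl

theorem integral_mu {E : Type*} [NormedAddCommGroup E] [NormedSpace ℝ E] {k : ℝ} (hk : -1 / 2 ≤ k)
    (f : ℝ → E) : ∫ x, f x ∂mu k = ∫ x, muDensity k x • f x := by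
  rw [mu_eq, integral_withDensity_eq_integral_toReal_smul
    (measurable_muDensity k).ennreal_ofReal (by simp)]
  simp only [ENNReal.toReal_ofReal (muDensity_nonneg hk _)]

theorem integrable_mu_iff {E : Type*} [NormedAddCommGroup E] [NormedSpace ℝ E] {k : ℝ}
    (hk : -1 / 2 ≤ k) {f : ℝ → E} :
    Integrable f (mu k) ↔ Integrable fun x => muDensity k x • f x := by
  rw [mu_eq, integrable_withDensity_iff_integrable_smul'
    (measurable_muDensity k).ennreal_ofReal (by simp)]
  simp only [ENNReal.toReal_ofReal (muDensity_nonneg hk _)]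

theorem map_mul_left_mu (k : ℝ) {r : ℝ} (hr : r ≠ 0) :
    Measure.map (r * ·) (mu k) = ENNReal.ofReal (|r| ^ (-(2 * k + 2))) • mu k := by
  refine Measure.ext_of_lintegral _ fun f hf => ?_
  have hm := measurable_muDensity k
  rw [lintegral_map hf (measurable_const_mul r), lintegral_smul_measure, lintegral_mu, lintegral_mu]
  have h0 : 0 < |r| := abs_pos.2 hr
  have h1 : ∀ x, ENNReal.ofReal (muDensity k x) * f (r * x)
      = ENNReal.ofReal (|r| ^ (-(2 * k + 1))) * (ENNReal.ofReal (muDensity k (r * x)) * f (r * x)) := by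
    intro x
    rw [← mul_assoc, ← ENNReal.ofReal_mul (Real.rpow_nonneg h0.le _), muDensity_mul, ← mul_assoc,
      ← Real.rpow_add h0]
    simp
  simp_rw [h1]
  have h2 : Measurable fun x => ENNReal.ofReal (muDensity k x) * f x :=
    hm.ennreal_ofReal.mul hf
  have h3 := lintegral_map (μ := volume) h2 (measurable_const_mul r)
  rw [lintegral_const_mul _ (by fun_prop), ← h3,
    Real.map_volume_mul_left hr, lintegral_smul_measure, smul_eq_mul, smul_eq_mul, ← mul_assoc,
    ← ENNReal.ofReal_mul (Real.rpow_nonneg h0.le _), abs_inv, ← Real.rpow_neg_one,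
    ← Real.rpow_add h0]
  ring_nf

theorem lintegral_mu_mul_left {k : ℝ} {r : ℝ} (hr : r ≠ 0) (f : ℝ → ℝ≥0∞) :
    ∫⁻ x, f (r * x) ∂mu k = ENNReal.ofReal (|r| ^ (-(2 * k + 2))) * ∫⁻ x, f x ∂mu k := by
  rw [← smul_eq_mul, ← lintegral_smul_measure, ← map_mul_left_mu k hr]
  exact ((Homeomorph.mulLeft₀ r hr).measurableEmbedding.lintegral_map f).symm

theorem integral_mu_mul_left {E : Type*} [NormedAddCommGroup E] [NormedSpace ℝ E] {k : ℝ} {r : ℝ}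
    (hr : r ≠ 0) (f : ℝ → E) :
    ∫ x, f (r * x) ∂mu k = |r| ^ (-(2 * k + 2)) • ∫ x, f x ∂mu k := by
  rw [← ENNReal.toReal_ofReal (Real.rpow_nonneg (abs_nonneg r) (-(2 * k + 2))),
    ← integral_smul_measure, ← map_mul_left_mu k hr]
  exact ((Homeomorph.mulLeft₀ r hr).measurableEmbedding.integral_map f).symm

theorem quasiMeasurePreserving_mul_left_mu (k : ℝ) {r : ℝ} (hr : r ≠ 0) :
    Measure.QuasiMeasurePreserving (r * ·) (mu k) (mu k) :=
  ⟨measurable_const_mul r, by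
    rw [map_mul_left_mu k hr]; exact Measure.smul_absolutelyContinuous⟩

theorem measurePreserving_neg_mu (k : ℝ) : MeasurePreserving (fun x : ℝ => -x) (mu k) (mu k) := by
  refine ⟨measurable_neg, ?_⟩
  have := map_mul_left_mu k (r := -1) (by norm_num)
  simpa using this

theorem integral_mu_neg {E : Type*} [NormedAddCommGroup E] [NormedSpace ℝ E] (k : ℝ) (f : ℝ → E) :
    ∫ x, f (-x) ∂mu k = ∫ x, f x ∂mu k :=
  (measurePreserving_neg_mu k).integral_comp (Homeomorph.neg ℝ).measurableEmbedding f

theorem integral_mu_eq_zero_of_odd {k : ℝ} {f : ℝ → ℂ} (hf : ∀ x, f (-x) = -f x) :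
    ∫ x, f x ∂mu k = 0 := by
  have h := integral_mu_neg k f
  simp only [hf, integral_neg] at h
  exact self_eq_neg.1 h.symm

theorem hasTemperateGrowth_mu {k : ℝ} (hk : -1 / 2 ≤ k) : (mu k).HasTemperateGrowth := by
  obtain ⟨N, hN⟩ := exists_nat_ge (2 * k + 1)
  -- N absorbs the growth of the density, and the remaining exponent 2 makes (1 + |x|)^(-2)
  -- integrable on the line.
  refine ⟨N + 2, ?_⟩
  rw [integrable_mu_iff hk]
  have hi := (integrable_one_add_norm (E := ℝ) (μ := volume) (r := 2) (by simp)).const_mul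
    (2 ^ (k + 1) * Real.Gamma (k + 1))⁻¹
  refine hi.mono' ?_ ?_
  · have := (measurable_muDensity k)
    exact (this.smul (by fun_prop)).aestronglyMeasurable
  · refine Eventually.of_forall fun x => ?_
    have h1 : (1 : ℝ) ≤ 1 + ‖x‖ := by linarith [norm_nonneg x]
    have h0 : (0 : ℝ) < 1 + ‖x‖ := by linarith
    rw [norm_smul, Real.norm_of_nonneg (muDensity_nonneg hk x),
      Real.norm_of_nonneg (Real.rpow_nonneg h0.le _), muDensity, div_eq_inv_mul, mul_assoc]
    refine mul_le_mul_of_nonneg_left ?_ (inv_nonneg.2 (muDensity_const_pos hk).le)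
    have h2 : |x| ^ (2 * k + 1) ≤ (1 + ‖x‖) ^ (N : ℝ) :=
      (Real.rpow_le_rpow (abs_nonneg x) (by rw [Real.norm_eq_abs]; linarith) (by linarith)).trans
        (Real.rpow_le_rpow_of_exponent_le h1 hN)
    refine (mul_le_mul_of_nonneg_right h2 (Real.rpow_nonneg h0.le _)).trans ?_
    rw [← Real.rpow_add h0]
    refine (Real.rpow_le_rpow_of_exponent_le h1 ?_)
    push_cast; linarith

/-! ### Gaussian integrals -/

/-- The Gaussian `exp(-z x² / 2)`. -/
def gauss (z x : ℝ) : ℂ := (Real.exp (-(z * x ^ 2 / 2)) : ℝ)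

theorem continuous_gauss (z : ℝ) : Continuous (gauss z) := by
  unfold gauss; fun_prop

theorem gauss_neg (z x : ℝ) : gauss z (-x) = gauss z x := by simp [gauss]

theorem norm_gauss (z x : ℝ) : ‖gauss z x‖ = Real.exp (-(z * x ^ 2 / 2)) := by
  rw [gauss, Complex.norm_real, Real.norm_of_nonneg (Real.exp_pos _).le]

theorem gauss_mul_gauss (z w x : ℝ) : gauss z x * gauss w x = gauss (z + w) x := by
  rw [gauss, gauss, gauss, ← Complex.ofReal_mul, ← Real.exp_add]; ring_nf

theorem conj_gauss (z x : ℝ) : (starRingEnd ℂ) (gauss z x) = gauss z x := Complex.conj_ofReal _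

/-- Each of the two powers is at most a factorial times an exponential, which raises the rate c to c
+ 2; completing the square then beats the linear exponent by the Gaussian. -/
theorem abs_pow_mul_exp_le {z : ℝ} (hz : 0 < z) (n j : ℕ) (c x : ℝ) :
    (1 + |x|) ^ n * (|x| ^ j * Real.exp (c * |x|) * Real.exp (-(z * x ^ 2 / 2)))
      ≤ n.factorial * j.factorial * Real.exp 1 * Real.exp ((c + 2) ^ 2 / (2 * z)) := by
  have h1 : (1 + |x|) ^ n ≤ n.factorial * Real.exp (1 + |x|) := by
    have := Real.pow_div_factorial_le_exp (1 + |x|) (by positivity) n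
    rwa [div_le_iff₀' (by positivity)] at this
  have h2 : |x| ^ j ≤ j.factorial * Real.exp |x| := by
    have := Real.pow_div_factorial_le_exp |x| (by positivity) j
    rwa [div_le_iff₀' (by positivity)] at this
  have h3 : Real.exp ((c + 2) * |x|) * Real.exp (-(z * x ^ 2 / 2))
      ≤ Real.exp ((c + 2) ^ 2 / (2 * z)) := by
    rw [← Real.exp_add]
    refine Real.exp_le_exp.2 ?_
    rw [le_div_iff₀ (by positivity), ← sq_abs x]
    nlinarith [sq_nonneg (c + 2 - z * |x|)]
  calc (1 + |x|) ^ n * (|x| ^ j * Real.exp (c * |x|) * Real.exp (-(z * x ^ 2 / 2)))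
      ≤ (n.factorial * Real.exp (1 + |x|)) * ((j.factorial * Real.exp |x|) * Real.exp (c * |x|) *
          Real.exp (-(z * x ^ 2 / 2))) := by gcongr
    _ = n.factorial * j.factorial * Real.exp 1 *
          (Real.exp ((c + 2) * |x|) * Real.exp (-(z * x ^ 2 / 2))) := by
        rw [Real.exp_add, show (c + 2) * |x| = c * |x| + |x| + |x| by ring, Real.exp_add,
          Real.exp_add]
        ring
    _ ≤ _ := by gcongr

theorem integrable_of_norm_le_gauss {k : ℝ} (hk : -1 / 2 ≤ k) {z : ℝ} (hz : 0 < z) {f : ℝ → ℂ}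
    (hf : AEStronglyMeasurable f (mu k)) {C c : ℝ} {j : ℕ} (hC : 0 ≤ C)
    (h : ∀ x, ‖f x‖ ≤ C * (|x| ^ j * Real.exp (c * |x|) * Real.exp (-(z * x ^ 2 / 2)))) :
    Integrable f (mu k) := by
  have := hasTemperateGrowth_mu hk
  refine ((Measure.integrable_pow_neg_integrablePower (mu k)).const_mul
    (C * ((mu k).integrablePower.factorial * j.factorial * Real.exp 1 *
      Real.exp ((c + 2) ^ 2 / (2 * z))))).mono' hf ?_
  refine Eventually.of_forall fun x => (h x).trans ?_
  have h0 : (0 : ℝ) < 1 + |x| := by positivity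
  have := abs_pow_mul_exp_le hz (mu k).integrablePower j c x
  refine (mul_le_mul_of_nonneg_left ?_ hC).trans (mul_assoc _ _ _).ge
  rw [Real.norm_eq_abs, Real.rpow_neg h0.le, Real.rpow_natCast, ← div_eq_mul_inv, le_div_iff₀' (by positivity)]
  exact this

theorem memLp_of_norm_le_gauss {k : ℝ} (hk : -1 / 2 ≤ k) {z : ℝ} (hz : 0 < z) {f : ℝ → ℂ}
    (hf : AEStronglyMeasurable f (mu k)) {C c : ℝ} {j : ℕ}
    (h : ∀ x, ‖f x‖ ≤ C * (|x| ^ j * Real.exp (c * |x|) * Real.exp (-(z * x ^ 2 / 2)))) :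
    MemLp f 2 (mu k) := by
  rw [memLp_two_iff_integrable_sq_norm hf]
  have hm : AEStronglyMeasurable (fun x => ‖f x‖ ^ 2) (mu k) := hf.norm.pow 2
  have := integrable_of_norm_le_gauss hk (z := 2 * z) (by positivity) (f := fun x => ((‖f x‖ ^ 2 : ℝ) : ℂ))
    (C := C ^ 2) (c := 2 * c) (j := 2 * j)
    (Complex.continuous_ofReal.comp_aestronglyMeasurable hm) (by positivity) ?_
  · simpa using this.norm
  intro x
  rw [Complex.norm_real, norm_pow, norm_norm]
  refine (pow_le_pow_left₀ (norm_nonneg _) (h x) 2).trans (le_of_eq ?_)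
  rw [mul_pow, mul_pow, mul_pow, ← Real.exp_nat_mul, ← Real.exp_nat_mul, ← pow_mul]
  push_cast
  ring_nf

theorem integral_pow_mul_gauss {k : ℝ} (hk : -1 / 2 ≤ k) {z : ℝ} (hz : 0 < z) (m : ℕ) :
    ∫ y : ℝ, (y : ℂ) ^ (2 * m) * gauss z y ∂mu k
      = ((z / 2) ^ (-(m + k + 1)) * Real.Gamma (m + k + 1) / (2 ^ (k + 1) * Real.Gamma (k + 1)) : ℝ) := by
  have hm : (0 : ℝ) ≤ m := Nat.cast_nonneg m
  have h1 := integral_rpow_mul_exp_neg_mul_rpow (p := 2) (q := 2 * m + 2 * k + 1) (b := z / 2)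
    (by norm_num) (by linarith) (by positivity)
  have h2 := integral_comp_abs (f := fun y : ℝ => y ^ (2 * m + 2 * k + 1) *
    Real.exp (-(z / 2) * y ^ (2 : ℝ)))
  rw [h1] at h2
  rw [integral_mu hk]
  trans ((∫ x : ℝ, |x| ^ (2 * m + 2 * k + 1) *
    Real.exp (-(z / 2) * |x| ^ (2 : ℝ)) / (2 ^ (k + 1) * Real.Gamma (k + 1)) : ℝ) : ℂ)
  · rw [← integral_complex_ofReal]
    refine integral_congr_ae ?_
    filter_upwards [Measure.ae_ne volume (0 : ℝ)] with x hx
    have hx' : 0 < |x| := abs_pos.2 hx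
    rw [muDensity, gauss, Complex.real_smul, ← Complex.ofReal_pow, ← Complex.ofReal_mul,
      ← Complex.ofReal_mul]
    congr 1
    rw [show 2 * (m : ℝ) + 2 * k + 1 = (2 * m : ℕ) + (2 * k + 1) by push_cast; ring,
      Real.rpow_add hx' ((2 * m : ℕ) : ℝ), Real.rpow_natCast, pow_mul |x|, sq_abs, ← pow_mul, Real.rpow_two, sq_abs]
    ring_nf
  · rw [integral_div, h2]
    congr 1
    rw [show -(2 * (m : ℝ) + 2 * k + 1 + 1) / 2 = -(m + k + 1) by ring,
      show (2 * (m : ℝ) + 2 * k + 1 + 1) / 2 = m + k + 1 by ring]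
    ring

theorem integral_gauss {k : ℝ} (hk : -1 / 2 ≤ k) {z : ℝ} (hz : 0 < z) :
    ∫ y : ℝ, gauss z y ∂mu k = (z ^ (-(k + 1)) : ℝ) := by
  have h := integral_pow_mul_gauss hk hz 0
  simp only [mul_zero, pow_zero, one_mul, Nat.cast_zero, zero_add] at h
  rw [h]
  have h1 : Real.Gamma (k + 1) ≠ 0 := (Real.Gamma_pos_of_pos (by linarith)).ne'
  have h2 : (2 : ℝ) ^ (k + 1) ≠ 0 := (Real.rpow_pos_of_pos two_pos _).ne'
  rw [Real.div_rpow hz.le two_pos.le, Real.rpow_neg two_pos.le]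
  congr 1
  field_simp

theorem integral_pow_succ_mul_gauss {k : ℝ} (hk : -1 / 2 ≤ k) {z : ℝ} (hz : 0 < z) (m : ℕ) :
    ∫ y : ℝ, (y : ℂ) ^ (2 * (m + 1)) * gauss z y ∂mu k
      = 2 * (m + k + 1) / z * ∫ y : ℝ, (y : ℂ) ^ (2 * m) * gauss z y ∂mu k := by
  have hm : (0 : ℝ) ≤ m := Nat.cast_nonneg m
  rw [integral_pow_mul_gauss hk hz, integral_pow_mul_gauss hk hz]
  have h1 : Real.Gamma ((m + 1 : ℕ) + k + 1) = (m + k + 1) * Real.Gamma (m + k + 1) := by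
    rw [← Real.Gamma_add_one (by linarith)]; push_cast; ring_nf
  have h2 : (z / 2) ^ (-(((m + 1 : ℕ) : ℝ) + k + 1)) = 2 / z * (z / 2) ^ (-(m + k + 1)) := by
    rw [show -(((m + 1 : ℕ) : ℝ) + k + 1) = -1 + -(m + k + 1) by push_cast; ring,
      Real.rpow_add (by positivity), Real.rpow_neg_one, inv_div]
  rw [h1, h2]
  push_cast
  ring

theorem norm_dexp_mul_le {k : ℝ} (hk : -1 / 2 ≤ k) (q : ℂ) (y : ℝ) :
    ‖dexp k (q * y)‖ ≤ Real.exp (‖q‖ * |y|) := by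
  refine (norm_dexp_le hk _).trans (Real.exp_le_exp.2 ?_)
  refine (Complex.abs_re_le_norm _).trans (le_of_eq ?_)
  rw [norm_mul, Complex.norm_real, Real.norm_eq_abs]

theorem integrable_pow_mul_gauss_mul_dexp {k : ℝ} (hk : -1 / 2 ≤ k) {z : ℝ} (hz : 0 < z) (j : ℕ)
    (q : ℂ) : Integrable (fun y : ℝ => (y : ℂ) ^ j * gauss z y * dexp k (q * y)) (mu k) := by
  have := continuous_dexp hk
  have := continuous_gauss z
  refine integrable_of_norm_le_gauss hk hz (by fun_prop : Continuous _).aestronglyMeasurable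
    zero_le_one (c := ‖q‖) (j := j) fun y => ?_
  rw [norm_mul, norm_mul, norm_gauss, norm_pow, Complex.norm_real, Real.norm_eq_abs, one_mul,
    mul_right_comm]
  have := norm_dexp_mul_le hk q y
  gcongr

/-- Termwise integration of the series of e(qy), dominated by |y|^j exp(-zy²/2) exp(‖q‖|y|). -/
theorem hasSum_integral_gauss {k : ℝ} (hk : -1 / 2 ≤ k) {z : ℝ} (hz : 0 < z) (j : ℕ) (q : ℂ) :
    HasSum (fun n : ℕ => (angularMoment k n * (q ^ n / n.factorial)) *
        ∫ y : ℝ, (y : ℂ) ^ (n + j) * gauss z y ∂mu k)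
      (∫ y : ℝ, (y : ℂ) ^ j * gauss z y * dexp k (q * y) ∂mu k) := by
  have := isProbabilityMeasure_angularMeasure hk
  have hg := continuous_gauss z
  -- The moments are the derivatives of e at 0.
  have hM : ∀ n, ‖(angularMoment k n : ℂ)‖ ≤ 1 := by
    intro n
    have : (angularMoment k n : ℂ) = dexpDeriv k n 0 := by
      rw [angularMoment, dexpDeriv, ← integral_complex_ofReal]; simp
    rw [this]
    exact norm_dexpDeriv_le_one hk n rfl
  have hexp : ∀ a : ℝ, HasSum (fun n : ℕ => a ^ n / n.factorial) (Real.exp a) := fun a => by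
    have := NormedSpace.expSeries_div_hasSum_exp a
    rwa [← Real.exp_eq_exp_ℝ] at this
  have h := hasSum_integral_of_dominated_convergence (μ := mu k)
    (F := fun (n : ℕ) (y : ℝ) => (angularMoment k n * (q ^ n / n.factorial)) *
      ((y : ℂ) ^ (n + j) * gauss z y))
    (f := fun y : ℝ => (y : ℂ) ^ j * gauss z y * dexp k (q * y))
    (fun n y => (|y| ^ j * Real.exp (-(z * y ^ 2 / 2))) * ((‖q‖ * |y|) ^ n / n.factorial))
    ?_ ?_ ?_ ?_ ?_
  · exact hasSum_of_forall_eq h fun n => integral_const_mul _ _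
  · exact fun n => (by fun_prop : Continuous _).aestronglyMeasurable
  · refine fun n => Eventually.of_forall fun y => ?_
    rw [norm_mul, norm_mul, norm_mul, norm_div, norm_pow, norm_pow, norm_gauss, Complex.norm_real y,
      Real.norm_eq_abs y, Complex.norm_natCast]
    calc ‖(angularMoment k n : ℂ)‖ * (‖q‖ ^ n / n.factorial) *
          (|y| ^ (n + j) * Real.exp (-(z * y ^ 2 / 2)))
        ≤ 1 * (‖q‖ ^ n / n.factorial) * (|y| ^ (n + j) * Real.exp (-(z * y ^ 2 / 2))) := by
          have := hM n
          gcongr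
      _ = _ := by rw [mul_pow, pow_add]; ring
  · exact Eventually.of_forall fun y => (hexp _).summable.mul_left _
  · simp_rw [tsum_mul_left, (hexp _).tsum_eq]
    have := integrable_of_norm_le_gauss hk hz (f := fun y : ℝ =>
      ((|y| ^ j * Real.exp (-(z * y ^ 2 / 2)) * Real.exp (‖q‖ * |y|) : ℝ) : ℂ)) (C := 1) (c := ‖q‖)
      (j := j) (by fun_prop : Continuous _).aestronglyMeasurable zero_le_one ?_
    · exact this.re
    · intro y
      rw [Complex.norm_real, Real.norm_of_nonneg (by positivity)]
      exact le_of_eq (by ring)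
  · refine Eventually.of_forall fun y => ?_
    refine hasSum_of_forall_eq ((hasSum_dexp hk (q * y)).mul_left ((y : ℂ) ^ j * gauss z y))
      fun n => ?_
    rw [mul_pow, pow_add]
    ring

theorem integral_odd_pow_mul_gauss (k z : ℝ) {n : ℕ} (hn : Odd n) :
    ∫ y : ℝ, (y : ℂ) ^ n * gauss z y ∂mu k = 0 :=
  integral_mu_eq_zero_of_odd fun y => by
    rw [gauss_neg, Complex.ofReal_neg, hn.neg_pow, neg_mul]

/-- The even terms of the series of the transform of a Gaussian. -/
theorem gauss_series_term {k : ℝ} (hk : -1 / 2 ≤ k) {z : ℝ} (hz : 0 < z) (q : ℂ) (m : ℕ) :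
    (angularMoment k (2 * m) * (q ^ (2 * m) / (2 * m).factorial)) *
        ∫ y : ℝ, (y : ℂ) ^ (2 * m) * gauss z y ∂mu k
      = (z ^ (-(k + 1)) : ℝ) * ((q ^ 2 / (2 * z)) ^ m / m.factorial) := by
  have hz' : (z : ℂ) ≠ 0 := by exact_mod_cast hz.ne'
  induction m with
  | zero => simp [angularMoment_zero hk, integral_gauss hk hz]
  | succ m ih =>
    have h1 : (2 * (m : ℂ) + 2 * k + 2) * angularMoment k (2 * (m + 1))
        = (2 * m + 1) * angularMoment k (2 * m) := by
      exact_mod_cast angularMoment_even_add_two hk m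
    have hf : (((2 * (m + 1)).factorial : ℕ) : ℂ)
        = (2 * m + 2) * ((2 * m + 1) * (2 * m).factorial) := by
      rw [show 2 * (m + 1) = 2 * m + 1 + 1 by ring, Nat.factorial_succ, Nat.factorial_succ]
      push_cast; ring
    have hm1 : (m : ℂ) + 1 ≠ 0 := by exact_mod_cast m.succ_ne_zero
    have hm2 : 2 * (m : ℂ) + 1 ≠ 0 := by exact_mod_cast (2 * m).succ_ne_zero
    have hfm : ((2 * m).factorial : ℂ) ≠ 0 := by exact_mod_cast (2 * m).factorial_ne_zero
    have e : (angularMoment k (2 * (m + 1)) * (q ^ (2 * (m + 1)) / (2 * (m + 1)).factorial)) *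
        ∫ y : ℝ, (y : ℂ) ^ (2 * (m + 1)) * gauss z y ∂mu k
        = q ^ 2 / (2 * z) / (m + 1) * ((angularMoment k (2 * m) * (q ^ (2 * m) / (2 * m).factorial)) *
        ∫ y : ℝ, (y : ℂ) ^ (2 * m) * gauss z y ∂mu k) := by
      rw [integral_pow_succ_mul_gauss hk hz, hf]
      generalize ∫ y : ℝ, (y : ℂ) ^ (2 * m) * gauss z y ∂mu k = I
      generalize ((2 * m).factorial : ℂ) = F at *
      rw [show q ^ (2 * (m + 1)) = q ^ (2 * m) * q ^ 2 by ring]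
      generalize q ^ (2 * m) = Q
      field_simp
      linear_combination (q ^ 2 * Q * I) * h1
    rw [e, ih, Nat.factorial_succ, pow_succ (q ^ 2 / (2 * (z : ℂ)))]
    push_cast
    field_simp

theorem injective_two_mul_add (j : ℕ) : Function.Injective fun m : ℕ => 2 * m + j :=
  fun a b h => by simpa using h

/-- The factor m + k + 1 in the recursion of the Gaussian moments cancels the one in the recursion
of the angular moments, so the series is an ordinary exponential. Odd powers integrate to zero. -/
theorem integral_gauss_mul_dexp {k : ℝ} (hk : -1 / 2 ≤ k) {z : ℝ} (hz : 0 < z) (q : ℂ) :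
    ∫ y : ℝ, gauss z y * dexp k (q * y) ∂mu k
      = (z ^ (-(k + 1)) : ℝ) * Complex.exp (q ^ 2 / (2 * z)) := by
  have h := hasSum_integral_gauss hk hz 0 q
  rw [← (injective_two_mul_add 0).hasSum_iff] at h
  · simp only [pow_zero, one_mul] at h
    refine h.unique ?_
    have h2 := (NormedSpace.expSeries_div_hasSum_exp (q ^ 2 / (2 * (z : ℂ)))).mul_left
      ((z ^ (-(k + 1)) : ℝ) : ℂ)
    rw [← Complex.exp_eq_exp_ℂ] at h2
    exact hasSum_of_forall_eq h2 fun m => (gauss_series_term hk hz q m).symm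
  · intro n hn
    have : Odd n := by
      rw [← Nat.not_even_iff_odd]
      rintro ⟨m, rfl⟩
      exact hn ⟨m, by ring⟩
    rw [add_zero, integral_odd_pow_mul_gauss k z this, mul_zero]

theorem integral_mul_gauss_mul_dexp {k : ℝ} (hk : -1 / 2 ≤ k) {z : ℝ} (hz : 0 < z) (q : ℂ) :
    ∫ y : ℝ, (y : ℂ) * gauss z y * dexp k (q * y) ∂mu k
      = q / z * ((z ^ (-(k + 1)) : ℝ) * Complex.exp (q ^ 2 / (2 * z))) := by
  have hz' : (z : ℂ) ≠ 0 := by exact_mod_cast hz.ne'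
  have h := hasSum_integral_gauss hk hz 1 q
  rw [← (injective_two_mul_add 1).hasSum_iff] at h
  · simp only [pow_one] at h
    refine h.unique ?_
    have h2 := ((NormedSpace.expSeries_div_hasSum_exp (q ^ 2 / (2 * (z : ℂ)))).mul_left
      ((z ^ (-(k + 1)) : ℝ) : ℂ)).mul_left (q / z)
    rw [← Complex.exp_eq_exp_ℂ] at h2
    refine hasSum_of_forall_eq h2 fun m => ?_
    rw [← gauss_series_term hk hz q m]
    simp only [Function.comp]
    have h1 : (2 * (m : ℂ) + 2 * k + 2) * angularMoment k (2 * m + 1)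
        = (2 * m + 1) * angularMoment k (2 * m) := by
      exact_mod_cast angularMoment_even_add_one hk m
    have hf : (((2 * m + 1).factorial : ℕ) : ℂ) = (2 * m + 1) * (2 * m).factorial := by
      rw [Nat.factorial_succ]; push_cast; ring
    have hm2 : 2 * (m : ℂ) + 1 ≠ 0 := by exact_mod_cast (2 * m).succ_ne_zero
    have hfm : ((2 * m).factorial : ℂ) ≠ 0 := by exact_mod_cast (2 * m).factorial_ne_zero
    rw [show 2 * m + 1 + 1 = 2 * (m + 1) by ring, integral_pow_succ_mul_gauss hk hz, hf]
    generalize ∫ y : ℝ, (y : ℂ) ^ (2 * m) * gauss z y ∂mu k = I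
    generalize ((2 * m).factorial : ℂ) = F at *
    rw [pow_succ]
    generalize q ^ (2 * m) = Q
    field_simp
    linear_combination (-(q * Q * I)) * h1
  · intro n hn
    have : Odd (n + 1) := by
      rw [← Nat.not_even_iff_odd, Nat.even_add_one, not_not, ← Nat.not_odd_iff_even]
      rintro ⟨m, rfl⟩
      exact hn ⟨m, by ring⟩
    rw [integral_odd_pow_mul_gauss k z this, mul_zero]

theorem integral_sq_mul_gauss_mul_dexp {k : ℝ} (hk : -1 / 2 ≤ k) {z : ℝ} (hz : 0 < z) (q : ℂ) :
    ∫ y : ℝ, (y : ℂ) ^ 2 * gauss z y * dexp k (q * y) ∂mu k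
      = (2 * (k + 1) / z + q ^ 2 / z ^ 2) *
        ((z ^ (-(k + 1)) : ℝ) * Complex.exp (q ^ 2 / (2 * z))) := by
  have hz' : (z : ℂ) ≠ 0 := by exact_mod_cast hz.ne'
  have h := hasSum_integral_gauss hk hz 2 q
  rw [← (injective_two_mul_add 0).hasSum_iff] at h
  · refine h.unique ?_
    set a : ℂ := q ^ 2 / (2 * (z : ℂ)) with ha
    have h2 := (NormedSpace.expSeries_div_hasSum_exp a).mul_left
      ((z ^ (-(k + 1)) : ℝ) : ℂ)
    rw [← Complex.exp_eq_exp_ℂ] at h2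
    -- The extra y² contributes 2(m + k + 1)/z to the m-th term. The part proportional to m is
    -- summed by ∑ m aᵐ/m! = a eᵃ.
    have h3 : HasSum (fun m : ℕ => (m : ℂ) * (((z ^ (-(k + 1)) : ℝ) : ℂ) * (a ^ m / m.factorial)))
        (a * (((z ^ (-(k + 1)) : ℝ) : ℂ) * Complex.exp a)) := by
      rw [← hasSum_nat_add_iff' 1]
      simp only [Finset.range_one, Finset.sum_singleton, Nat.cast_zero, zero_mul, sub_zero]
      refine hasSum_of_forall_eq (h2.mul_left a) fun m => ?_
      have hm1 : (m : ℂ) + 1 ≠ 0 := by exact_mod_cast m.succ_ne_zero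
      rw [Nat.factorial_succ, pow_succ]
      push_cast
      field_simp
    have h4 := (h3.add (h2.mul_left ((k : ℂ) + 1))).mul_left (2 / (z : ℂ))
    have e : 2 / (z : ℂ) * (a * (((z ^ (-(k + 1)) : ℝ) : ℂ) * Complex.exp a) +
        ((k : ℂ) + 1) * (((z ^ (-(k + 1)) : ℝ) : ℂ) * Complex.exp a))
        = (2 * (k + 1) / z + q ^ 2 / z ^ 2) * ((z ^ (-(k + 1)) : ℝ) * Complex.exp a) := by
      rw [ha]; field_simp; ring
    rw [e] at h4
    refine hasSum_of_forall_eq h4 fun m => ?_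
    have := gauss_series_term hk hz q m
    rw [← ha] at this
    rw [← this]
    simp only [Function.comp, add_zero]
    rw [show 2 * m + 2 = 2 * (m + 1) by ring, integral_pow_succ_mul_gauss hk hz]
    ring
  · intro n hn
    have : Odd (n + 2) := by
      rw [← Nat.not_even_iff_odd]
      rintro ⟨m, hm⟩
      -- From n + 2 = m + m one gets m ≥ 1, so the truncated subtraction is exact.
      exact hn ⟨m - 1, by simp only; omega⟩
    rw [integral_odd_pow_mul_gauss k z this, mul_zero]

/-! ### Gaussians separate functions -/

theorem gauss_natCast (n : ℕ) (x : ℝ) :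
    gauss n x = ((Real.exp (-(x ^ 2 / 2))) ^ n : ℝ) := by
  rw [gauss, ← Real.exp_nat_mul]; ring_nf

theorem exp_neg_sq_half_mem (x : ℝ) : Real.exp (-(x ^ 2 / 2)) ∈ Icc (0 : ℝ) 1 :=
  ⟨(Real.exp_pos _).le, Real.exp_le_one_iff.2 (by nlinarith [sq_nonneg x])⟩

/-- With t = exp(-x²/2), the Gaussian of index n is tⁿ. The hypothesis thus kills all polynomials in
t, and Weierstrass approximation on [0, 1] passes to continuous functions of t. -/
theorem integral_mul_comp_exp_eq_zero {G : ℝ → ℂ} (hG : IntegrableOn G (Ioi 0))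
    (h : ∀ n : ℕ, ∫ x in Ioi (0 : ℝ), G x * gauss n x = 0) {q : ℝ → ℝ}
    (hq : ContinuousOn q (Icc 0 1)) (hqm : Measurable q) :
    ∫ x in Ioi (0 : ℝ), G x * (q (Real.exp (-(x ^ 2 / 2))) : ℝ) = 0 := by
  have hpoly : ∀ p : Polynomial ℝ,
      ∫ x in Ioi (0 : ℝ), G x * (p.eval (Real.exp (-(x ^ 2 / 2))) : ℝ) = 0 := by
    intro p
    simp_rw [Polynomial.eval_eq_sum_range, Complex.ofReal_sum, Complex.ofReal_mul, Finset.mul_sum]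
    rw [integral_finsetSum]
    · refine Finset.sum_eq_zero fun n _ => ?_
      simp_rw [mul_left_comm (G _), ← gauss_natCast]
      rw [integral_const_mul, h, mul_zero]
    · intro n _
      simp_rw [mul_left_comm (G _), ← gauss_natCast]
      refine Integrable.const_mul ?_ _
      refine hG.mul_bdd (c := 1) (continuous_gauss n).aestronglyMeasurable
        (Eventually.of_forall fun x => ?_)
      rw [norm_gauss]
      exact Real.exp_le_one_iff.2 (by have := sq_nonneg x; have : (0 : ℝ) ≤ n := Nat.cast_nonneg n
                                      have := mul_nonneg this (sq_nonneg x); linarith)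
  have hmeas : Measurable fun x : ℝ => q (Real.exp (-(x ^ 2 / 2))) := hqm.comp (by fun_prop)
  have hpm : ∀ p : Polynomial ℝ, Measurable fun x : ℝ => p.eval (Real.exp (-(x ^ 2 / 2))) :=
    fun p => (p.continuous.comp (by fun_prop)).measurable
  have key : ∀ ε > 0, ‖∫ x in Ioi (0 : ℝ), G x * (q (Real.exp (-(x ^ 2 / 2))) : ℝ)‖
      ≤ ε * ∫ x in Ioi (0 : ℝ), ‖G x‖ := by
    intro ε hε
    obtain ⟨p, hp⟩ := exists_polynomial_near_of_continuousOn 0 1 q hq ε hε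
    have hd : ∀ x : ℝ, ‖((q (Real.exp (-(x ^ 2 / 2))) - p.eval (Real.exp (-(x ^ 2 / 2))) : ℝ) : ℂ)‖
        ≤ ε := by
      intro x
      rw [Complex.norm_real, Real.norm_eq_abs, abs_sub_comm]
      exact (hp _ (exp_neg_sq_half_mem x)).le
    have hdm : AEStronglyMeasurable (fun x : ℝ =>
        ((q (Real.exp (-(x ^ 2 / 2))) - p.eval (Real.exp (-(x ^ 2 / 2))) : ℝ) : ℂ))
        (volume.restrict (Ioi 0)) :=
      (Complex.measurable_ofReal.comp (hmeas.sub (hpm p))).aestronglyMeasurable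
    have hi : IntegrableOn (fun x => G x * ((q (Real.exp (-(x ^ 2 / 2)))
        - p.eval (Real.exp (-(x ^ 2 / 2))) : ℝ) : ℂ)) (Ioi 0) :=
      hG.mul_bdd hdm (Eventually.of_forall hd)
    obtain ⟨C, hC⟩ := isCompact_Icc.exists_bound_of_continuousOn
      (p.continuous.continuousOn (s := Icc (0 : ℝ) 1))
    have hi2 : IntegrableOn (fun x => G x * (p.eval (Real.exp (-(x ^ 2 / 2))) : ℝ)) (Ioi 0) := by
      refine hG.mul_bdd (c := C)
        (Complex.measurable_ofReal.comp (hpm p)).aestronglyMeasurable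
        (Eventually.of_forall fun x => ?_)
      rw [Complex.norm_real]
      exact hC _ (exp_neg_sq_half_mem x)
    have e : ∫ x in Ioi (0 : ℝ), G x * (q (Real.exp (-(x ^ 2 / 2))) : ℝ)
        = ∫ x in Ioi (0 : ℝ), G x * ((q (Real.exp (-(x ^ 2 / 2)))
          - p.eval (Real.exp (-(x ^ 2 / 2))) : ℝ) : ℂ) := by
      rw [← add_zero (∫ x in Ioi (0 : ℝ), G x * ((q (Real.exp (-(x ^ 2 / 2)))
          - p.eval (Real.exp (-(x ^ 2 / 2))) : ℝ) : ℂ)), ← hpoly p, ← integral_add hi hi2]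
      congr 1
      funext x
      push_cast
      ring
    rw [e, ← integral_const_mul]
    refine norm_integral_le_of_norm_le (hG.norm.const_mul ε) (Eventually.of_forall fun x => ?_)
    rw [norm_mul, mul_comm]
    exact mul_le_mul_of_nonneg_right (hd x) (norm_nonneg _)
  have h0 : 0 ≤ ∫ x in Ioi (0 : ℝ), ‖G x‖ := integral_nonneg fun _ => norm_nonneg _
  rw [← norm_le_zero_iff]
  refine le_of_forall_pos_le_add fun δ hδ => ?_
  refine (key (δ / ((∫ x in Ioi (0 : ℝ), ‖G x‖) + 1)) (by positivity)).trans ?_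
  rw [zero_add, div_mul_eq_mul_div, div_le_iff₀ (by positivity)]
  nlinarith

/-- A test function g supported in (0, ∞) is a continuous function of t = exp(-x²/2), namely g(√(-2
log t)), so the integral of G against every such g vanishes. -/
theorem ae_eq_zero_of_integral_gauss_Ioi {G : ℝ → ℂ} (hG : IntegrableOn G (Ioi 0))
    (h : ∀ n : ℕ, ∫ x in Ioi (0 : ℝ), G x * gauss n x = 0) :
    ∀ᵐ x, x ∈ Ioi (0 : ℝ) → G x = 0 := by
  refine isOpen_Ioi.ae_eq_zero_of_integral_contDiff_smul_eq_zero hG.locallyIntegrableOn ?_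
  intro g hg hgc hgs
  have hg0 : g 0 = 0 := image_eq_zero_of_notMem_tsupport fun h => lt_irrefl (0 : ℝ) (hgs h)
  have hlog : ∀ x : ℝ, 0 < x → √(-2 * Real.log (Real.exp (-(x ^ 2 / 2)))) = x := fun x hx => by
    rw [Real.log_exp, show -2 * -(x ^ 2 / 2) = x ^ 2 by ring, Real.sqrt_sq hx.le]
  have h1 := integral_mul_comp_exp_eq_zero hG h (q := fun t => g √(-2 * Real.log t)) ?_ ?_
  · rw [← setIntegral_eq_integral_of_forall_compl_eq_zero (s := Ioi (0 : ℝ)), ← h1]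
    · refine setIntegral_congr_fun measurableSet_Ioi fun x hx => ?_
      simp only [hlog x hx, Complex.real_smul, mul_comm]
    · intro x hx
      rw [image_eq_zero_of_notMem_tsupport fun h => hx (hgs h), zero_smul]
  · intro t ht
    rcases ht.1.eq_or_lt with rfl | ht0
    -- Continuity at t = 0, which corresponds to x = ∞: if the support lies in a ball of radius R,
    -- the function vanishes for 0 < t < exp(-R²/2). At t = 0 itself the convention log 0 = 0 gives
    -- the value g(0) = 0, as needed.
    · obtain ⟨R, hR⟩ := hgc.isCompact.isBounded.subset_closedBall (0 : ℝ)
      have hz : ∀ t ∈ Iio (Real.exp (-(R ^ 2 / 2))), g √(-2 * Real.log t) = 0 ∨ t < 0 := by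
        intro t ht
        rcases lt_trichotomy t 0 with h | rfl | h
        · exact Or.inr h
        · left; simpa using hg0
        · left
          refine image_eq_zero_of_notMem_tsupport fun hm => ?_
          have h2 := hR hm
          rw [mem_closedBall_zero_iff, Real.norm_of_nonneg (Real.sqrt_nonneg _)] at h2
          have h3 : Real.log t < -(R ^ 2 / 2) := (Real.log_lt_iff_lt_exp h).2 ht
          have h4 : R < √(-2 * Real.log t) := Real.lt_sqrt_of_sq_lt (by linarith)
          linarith
      refine ContinuousWithinAt.congr_of_eventuallyEq (f := fun _ => (0 : ℝ))
        continuousWithinAt_const ?_ (by simpa using hg0)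
      filter_upwards [mem_nhdsWithin_of_mem_nhds (Iio_mem_nhds (Real.exp_pos _)),
        self_mem_nhdsWithin] with t ht ht'
      exact (hz t ht).resolve_right (not_lt.2 ht'.1)
    · refine ContinuousAt.continuousWithinAt ?_
      exact hg.continuous.continuousAt.comp ((continuousAt_const.mul
        (Real.continuousAt_log ht0.ne')).sqrt)
  · exact hg.continuous.measurable.comp (by fun_prop)

theorem integral_eq_integral_Ioi_add {f : ℝ → ℂ} (hf : Integrable f) :
    ∫ x, f x = ∫ x in Ioi (0 : ℝ), (f x + f (-x)) := by
  rw [integral_add hf.integrableOn hf.comp_neg.integrableOn, integral_comp_neg_Ioi, neg_zero,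
    add_comm, intervalIntegral.integral_Iic_add_Ioi hf.integrableOn hf.integrableOn]

/-- Folding the line onto the half-line, the even Gaussians see H(x) + H(-x) and the odd ones x(H(x)
- H(-x)). Both vanish on x > 0, hence so does H on either side. -/
theorem ae_eq_zero_of_integral_gauss {k : ℝ} (hk : -1 / 2 ≤ k) {g : ℝ → ℂ}
    (i0 : Integrable (fun x => g x * gauss 1 x) (mu k))
    (i1 : Integrable (fun x : ℝ => g x * (x * gauss 1 x)) (mu k))
    (h0 : ∀ z : ℝ, 0 < z → ∫ x, g x * gauss z x ∂mu k = 0)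
    (h1 : ∀ z : ℝ, 0 < z → ∫ x : ℝ, g x * (x * gauss z x) ∂mu k = 0) :
    g =ᵐ[mu k] 0 := by
  -- One unit of the Gaussian exponent is kept in H for integrability; the exponents 1 + n then
  -- leave all powers n for the approximation argument.
  set H : ℝ → ℂ := fun x => muDensity k x • (g x * gauss 1 x) with hH
  have iH : Integrable H := (integrable_mu_iff hk).1 i0
  have iH1 : Integrable fun x : ℝ => x * H x := by
    refine ((integrable_mu_iff hk).1 i1).congr (Eventually.of_forall fun x => ?_)
    simp only [hH, Complex.real_smul]; ring
  have bdd : ∀ n : ℕ, ∀ x, ‖gauss n x‖ ≤ 1 := fun n x => by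
    rw [norm_gauss]
    have := mul_nonneg (Nat.cast_nonneg (α := ℝ) n) (sq_nonneg x)
    exact Real.exp_le_one_iff.2 (by linarith)
  have e0 : ∀ n : ℕ, ∫ x in Ioi (0 : ℝ), (H x + H (-x)) * gauss n x = 0 := by
    intro n
    have := h0 (1 + n) (by positivity)
    rw [integral_mu hk] at this
    have i : Integrable fun x => H x * gauss n x :=
      iH.mul_bdd (continuous_gauss n).aestronglyMeasurable (Eventually.of_forall (bdd n))
    rw [← this, show (fun x => muDensity k x • (g x * gauss (1 + n) x)) = fun x => H x * gauss n x by
      funext x; simp only [hH, ← gauss_mul_gauss, Complex.real_smul]; ring,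
      integral_eq_integral_Ioi_add i]
    simp only [gauss_neg, add_mul]
  have e1 : ∀ n : ℕ, ∫ x in Ioi (0 : ℝ), (x * H x + (-x : ℝ) * H (-x)) * gauss n x = 0 := by
    intro n
    have := h1 (1 + n) (by positivity)
    rw [integral_mu hk] at this
    have i : Integrable fun x : ℝ => x * H x * gauss n x :=
      iH1.mul_bdd (continuous_gauss n).aestronglyMeasurable (Eventually.of_forall (bdd n))
    rw [← this, show (fun x : ℝ => muDensity k x • (g x * (x * gauss (1 + n) x)))
      = fun x : ℝ => x * H x * gauss n x by
      funext x; simp only [hH, ← gauss_mul_gauss, Complex.real_smul]; ring,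
      integral_eq_integral_Ioi_add i]
    simp only [gauss_neg, add_mul]
  have z0 := ae_eq_zero_of_integral_gauss_Ioi (iH.add iH.comp_neg).integrableOn e0
  have z1 := ae_eq_zero_of_integral_gauss_Ioi (iH1.add iH1.comp_neg).integrableOn e1
  have zp : ∀ᵐ x : ℝ, 0 < x → H x = 0 ∧ H (-x) = 0 := by
    filter_upwards [z0, z1] with x h0 h1 hx
    have h0 := h0 hx
    have h1 := h1 hx
    simp only [Complex.ofReal_neg, Pi.add_apply] at h0 h1
    have hx' : (x : ℂ) ≠ 0 := by exact_mod_cast hx.ne'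
    have h2 : H x - H (-x) = 0 := mul_left_cancel₀ hx' (by linear_combination h1)
    constructor
    · linear_combination (h0 + h2) / 2
    · linear_combination (h0 - h2) / 2
  have zn := (Measure.measurePreserving_neg (volume : Measure ℝ)).quasiMeasurePreserving.ae zp
  refine (mu_absolutelyContinuous k).ae_le ?_
  filter_upwards [zp, zn, Measure.ae_ne volume (0 : ℝ)] with x hp hn hx
  have hH0 : H x = 0 := by
    rcases hx.lt_or_gt with h | h
    · simpa using (hn (by simpa using h)).2
    · exact (hp h).1
  have : gauss 1 x ≠ 0 := by rw [← norm_pos_iff, norm_gauss]; exact Real.exp_pos _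
  simpa [hH, (muDensity_pos hk hx).ne', this] using hH0

/-! ### The Dunkl transform of integrable functions -/

/-- The Dunkl transform `∫ f(x) E_k(-il, x) dμ_k(x)`. -/
def dunklF (k : ℝ) (f : ℝ → ℂ) (l : ℝ) : ℂ :=
  ∫ x : ℝ, f x * dexp k (-Complex.I * l * x) ∂mu k

theorem norm_dexp_neg_I_le {k : ℝ} (hk : -1 / 2 ≤ k) (l x : ℝ) :
    ‖dexp k (-Complex.I * l * x)‖ ≤ 1 := norm_dexp_le_one hk (by simp)

theorem norm_dexp_I_le {k : ℝ} (hk : -1 / 2 ≤ k) (l x : ℝ) :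
    ‖dexp k (Complex.I * l * x)‖ ≤ 1 := norm_dexp_le_one hk (by simp)

theorem conj_dexp_I (k : ℝ) (l x : ℝ) :
    (starRingEnd ℂ) (dexp k (Complex.I * l * x)) = dexp k (-Complex.I * l * x) := by
  rw [conj_dexp]; simp

theorem integrable_mul_dexp {k : ℝ} (hk : -1 / 2 ≤ k) {f : ℝ → ℂ} (hf : Integrable f (mu k))
    (l : ℝ) : Integrable (fun x : ℝ => f x * dexp k (-Complex.I * l * x)) (mu k) := by
  have := continuous_dexp hk
  exact hf.mul_bdd (c := 1) (by fun_prop : Continuous _).aestronglyMeasurable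
    (Eventually.of_forall fun x => norm_dexp_neg_I_le hk l x)

theorem norm_dunklF_le {k : ℝ} (hk : -1 / 2 ≤ k) {f : ℝ → ℂ} (hf : Integrable f (mu k)) (l : ℝ) :
    ‖dunklF k f l‖ ≤ ∫ x, ‖f x‖ ∂mu k :=
  norm_integral_le_of_norm_le hf.norm (Eventually.of_forall fun x => by
    rw [norm_mul]; exact mul_le_of_le_one_right (norm_nonneg _) (norm_dexp_neg_I_le hk l x))

theorem continuous_dunklF {k : ℝ} (hk : -1 / 2 ≤ k) {f : ℝ → ℂ} (hf : Integrable f (mu k)) :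
    Continuous (dunklF k f) := by
  have := continuous_dexp hk
  refine continuous_of_dominated (bound := fun x => ‖f x‖)
    (fun l => (integrable_mul_dexp hk hf l).aestronglyMeasurable) ?_ hf.norm ?_
  · intro l
    refine Eventually.of_forall fun x => ?_
    rw [norm_mul]; exact mul_le_of_le_one_right (norm_nonneg _) (norm_dexp_neg_I_le hk l x)
  · exact Eventually.of_forall fun x => by fun_prop

/-- Fubini, as the kernel E_k(-il, x) is symmetric in l and x and bounded by 1. -/
theorem integral_dunklF_mul {k : ℝ} (hk : -1 / 2 ≤ k) {f g : ℝ → ℂ} (hf : Integrable f (mu k))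
    (hg : Integrable g (mu k)) :
    ∫ l, dunklF k f l * g l ∂mu k = ∫ x, f x * dunklF k g x ∂mu k := by
  have hc := continuous_dexp hk
  simp only [dunklF]
  simp_rw [← integral_mul_const, ← integral_const_mul]
  rw [integral_integral_swap]
  · congr 1; funext x; congr 1; funext l
    rw [mul_right_comm (-Complex.I)]; ring
  · have : Integrable (fun p : ℝ × ℝ => (g p.1 * f p.2) * dexp k (-Complex.I * p.1 * p.2))
        ((mu k).prod (mu k)) :=
      (hg.mul_prod hf).mul_bdd (c := 1) (by fun_prop : Continuous _).aestronglyMeasurable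
        (Eventually.of_forall fun p => norm_dexp_neg_I_le hk p.1 p.2)
    refine this.congr (Eventually.of_forall fun p => ?_)
    simp only [Function.uncurry]; ring

/-! ### The family of Gaussians -/

/-- The functions `exp(-z x² / 2)` and `x exp(-z x² / 2)`. -/
def gaussFamily (i : Ioi (0 : ℝ) × Bool) (x : ℝ) : ℂ :=
  (bif i.2 then (x : ℂ) else 1) * gauss i.1 x

/-- The index of the Gaussian that the Dunkl transform maps a Gaussian to. -/
def dualIndex (i : Ioi (0 : ℝ) × Bool) : Ioi (0 : ℝ) × Bool :=
  (⟨(i.1 : ℝ)⁻¹, mem_Ioi.2 (inv_pos.2 (mem_Ioi.1 i.1.2))⟩, i.2)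

/-- The factor in the Dunkl transform of a Gaussian. -/
def gaussFactor (k : ℝ) (i : Ioi (0 : ℝ) × Bool) : ℂ :=
  (bif i.2 then -Complex.I / (i.1 : ℝ) else 1) * (((i.1 : ℝ) ^ (-(k + 1)) : ℝ) : ℂ)

theorem continuous_gaussFamily (i : Ioi (0 : ℝ) × Bool) : Continuous (gaussFamily i) := by
  have := continuous_gauss i.1
  unfold gaussFamily
  rcases i with ⟨z, _ | _⟩ <;> simp only [cond_true, cond_false] <;> fun_prop

theorem conj_gaussFamily (i : Ioi (0 : ℝ) × Bool) (x : ℝ) :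
    (starRingEnd ℂ) (gaussFamily i x) = gaussFamily i x := by
  rcases i with ⟨z, _ | _⟩ <;> simp [gaussFamily, conj_gauss]

theorem norm_gaussFamily_le (i : Ioi (0 : ℝ) × Bool) (x : ℝ) :
    ‖gaussFamily i x‖ ≤ 1 * (|x| ^ (bif i.2 then 1 else 0) * Real.exp (0 * |x|) *
      Real.exp (-(i.1 * x ^ 2 / 2))) := by
  rcases i with ⟨z, _ | _⟩ <;> simp [gaussFamily, norm_gauss]

theorem integrable_gaussFamily {k : ℝ} (hk : -1 / 2 ≤ k) (i : Ioi (0 : ℝ) × Bool) :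
    Integrable (gaussFamily i) (mu k) :=
  integrable_of_norm_le_gauss hk i.1.2 (continuous_gaussFamily i).aestronglyMeasurable zero_le_one
    (norm_gaussFamily_le i)

theorem memLp_gaussFamily {k : ℝ} (hk : -1 / 2 ≤ k) (i : Ioi (0 : ℝ) × Bool) :
    MemLp (gaussFamily i) 2 (mu k) :=
  memLp_of_norm_le_gauss hk i.1.2 (continuous_gaussFamily i).aestronglyMeasurable
    (norm_gaussFamily_le i)

theorem exp_neg_I_mul_sq_div (z l : ℝ) :
    Complex.exp ((-Complex.I * l) ^ 2 / (2 * z)) = gauss z⁻¹ l := by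
  rw [gauss, mul_pow, neg_sq, Complex.I_sq, Complex.ofReal_exp]
  congr 1
  push_cast
  ring

theorem dunklF_gaussFamily {k : ℝ} (hk : -1 / 2 ≤ k) (i : Ioi (0 : ℝ) × Bool) :
    dunklF k (gaussFamily i) = fun l => gaussFactor k i * gaussFamily (dualIndex i) l := by
  funext l
  rcases i with ⟨⟨z, hz⟩, _ | _⟩
  · simp only [dunklF, gaussFamily, gaussFactor, dualIndex, cond_false, one_mul]
    rw [integral_gauss_mul_dexp hk hz, exp_neg_I_mul_sq_div]
  · simp only [dunklF, gaussFamily, gaussFactor, dualIndex, cond_true]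
    rw [integral_mul_gauss_mul_dexp hk hz, exp_neg_I_mul_sq_div]
    ring

/-- The Gaussians as elements of `L²_k(ℝ)`. -/
def gaussLp {k : ℝ} (hk : -1 / 2 ≤ k) (i : Ioi (0 : ℝ) × Bool) : Lp ℂ 2 (mu k) :=
  (memLp_gaussFamily hk i).toLp _

theorem coeFn_gaussLp {k : ℝ} (hk : -1 / 2 ≤ k) (i : Ioi (0 : ℝ) × Bool) :
    gaussLp hk i =ᵐ[mu k] gaussFamily i := (memLp_gaussFamily hk i).coeFn_toLp

theorem inner_gaussLp {k : ℝ} (hk : -1 / 2 ≤ k) (i : Ioi (0 : ℝ) × Bool) (v : Lp ℂ 2 (mu k)) :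
    inner ℂ (gaussLp hk i) v = ∫ x, v x * gaussFamily i x ∂mu k := by
  rw [L2.inner_def]
  refine integral_congr_ae ?_
  filter_upwards [coeFn_gaussLp hk i] with x hx
  rw [hx, RCLike.inner_apply, conj_gaussFamily]

theorem gaussFamily_mul (z w : Ioi (0 : ℝ)) (x : ℝ) :
    gaussFamily (z, true) x * gaussFamily (w, true) x = (x : ℂ) ^ 2 * gauss (z + w) x ∧
    gaussFamily (z, true) x * gaussFamily (w, false) x = (x : ℂ) * gauss (z + w) x ∧
    gaussFamily (z, false) x * gaussFamily (w, true) x = (x : ℂ) * gauss (z + w) x ∧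
    gaussFamily (z, false) x * gaussFamily (w, false) x = gauss (z + w) x := by
  simp only [gaussFamily, cond_true, cond_false, ← gauss_mul_gauss]
  refine ⟨?_, ?_, ?_, ?_⟩ <;> ring

theorem integral_sq_mul_gauss {k : ℝ} (hk : -1 / 2 ≤ k) {z : ℝ} (hz : 0 < z) :
    ∫ y : ℝ, (y : ℂ) ^ 2 * gauss z y ∂mu k = 2 * (k + 1) / z * (z ^ (-(k + 1)) : ℝ) := by
  have := integral_pow_succ_mul_gauss hk hz 0
  simpa [integral_gauss hk hz] using this

theorem rpow_inv_add_inv {z w : ℝ} (hz : 0 < z) (hw : 0 < w) (r : ℝ) :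
    z ^ r * w ^ r * (z⁻¹ + w⁻¹) ^ r = (z + w) ^ r := by
  rw [← Real.mul_rpow hz.le hw.le, ← Real.mul_rpow (by positivity) (by positivity)]
  congr 1
  field_simp
  ring

/-- Plancherel on the total family. Products of Gaussians are Gaussians, and the identity zw(1/z +
1/w) = z + w matches the two sides; in mixed parity both inner products are integrals of odd
functions, hence zero. -/
theorem inner_gaussLp_dual {k : ℝ} (hk : -1 / 2 ≤ k) (i j : Ioi (0 : ℝ) × Bool) :
    inner ℂ (gaussFactor k i • gaussLp hk (dualIndex i)) (gaussFactor k j • gaussLp hk (dualIndex j))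
      = inner ℂ (gaussLp hk i) (gaussLp hk j) := by
  have e : ∀ i j, inner ℂ (gaussLp hk i) (gaussLp hk j)
      = ∫ x, gaussFamily i x * gaussFamily j x ∂mu k := by
    intro i j
    rw [inner_gaussLp]
    refine integral_congr_ae ?_
    filter_upwards [coeFn_gaussLp hk j] with x hx
    rw [hx, mul_comm]
  rw [inner_smul_left, inner_smul_right, e, e]
  rcases i with ⟨⟨z, hz⟩, _ | _⟩ <;> rcases j with ⟨⟨w, hw⟩, _ | _⟩ <;>
    simp only [dualIndex, (gaussFamily_mul _ _ _).1, (gaussFamily_mul _ _ _).2.1,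
      (gaussFamily_mul _ _ _).2.2.1, (gaussFamily_mul _ _ _).2.2.2, gaussFactor, cond_true,
      cond_false, one_mul, map_mul, Complex.conj_ofReal]
  · simp only [mem_Ioi] at hz hw
    rw [integral_gauss hk (add_pos hz hw), integral_gauss hk (add_pos (inv_pos.2 hz) (inv_pos.2 hw)),
      ← rpow_inv_add_inv hz hw]
    push_cast; ring
  · have := integral_odd_pow_mul_gauss k (z + w) (n := 1) odd_one
    have h2 := integral_odd_pow_mul_gauss k (z⁻¹ + w⁻¹) (n := 1) odd_one
    simp only [pow_one] at this h2
    rw [this, h2]; ring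
  · have := integral_odd_pow_mul_gauss k (z + w) (n := 1) odd_one
    have h2 := integral_odd_pow_mul_gauss k (z⁻¹ + w⁻¹) (n := 1) odd_one
    simp only [pow_one] at this h2
    rw [this, h2]; ring
  · simp only [mem_Ioi] at hz hw
    rw [integral_sq_mul_gauss hk (add_pos hz hw),
      integral_sq_mul_gauss hk (add_pos (inv_pos.2 hz) (inv_pos.2 hw)),
      ← rpow_inv_add_inv hz hw]
    have hz' : (z : ℂ) ≠ 0 := by exact_mod_cast hz.ne'
    have hw' : (w : ℂ) ≠ 0 := by exact_mod_cast hw.ne'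
    have hzw : (z : ℂ) + w ≠ 0 := by exact_mod_cast (by positivity : z + w ≠ 0)
    have hwz : (w : ℂ) + z ≠ 0 := by rwa [add_comm]
    have hinv : (z : ℂ)⁻¹ + (w : ℂ)⁻¹ = (z + w) / (z * w) := by field_simp; ring
    push_cast
    rw [hinv]
    simp only [map_div₀, map_neg, Complex.conj_I, Complex.conj_ofReal, neg_neg]
    field_simp
    rw [Complex.I_sq]
    ring

/-- Two families with the same Gram matrix, one of them total, are related by an isometry. -/
theorem exists_isometry_of_gram {H ι : Type*} [NormedAddCommGroup H] [InnerProductSpace ℂ H]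
    [CompleteSpace H] (a b : ι → H) (hd : Dense (Submodule.span ℂ (range a) : Set H))
    (hg : ∀ i j, inner ℂ (b i) (b j) = inner ℂ (a i) (a j)) :
    ∃ U : H →ₗᵢ[ℂ] H, ∀ i, U (a i) = b i := by
  classical
  set La := Finsupp.linearCombination ℂ a
  set Lb := Finsupp.linearCombination ℂ b
  have hdr : DenseRange La := by
    rw [← Finsupp.range_linearCombination] at hd
    exact hd
  -- The norm of a finite combination depends only on the Gram matrix, so matching combinations have
  -- equal norms and the correspondence extends by density.
  have hn : ∀ x, ‖Lb x‖ = ‖La x‖ := by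
    intro x
    have : inner ℂ (Lb x) (Lb x) = inner ℂ (La x) (La x) := by
      simp only [La, Lb, Finsupp.linearCombination_apply, Finsupp.sum_inner, Finsupp.inner_sum,
        inner_smul_left, inner_smul_right, hg]
    rw [inner_self_eq_norm_sq_to_K, inner_self_eq_norm_sq_to_K] at this
    have h2 : ‖Lb x‖ ^ 2 = ‖La x‖ ^ 2 := by exact_mod_cast this
    exact (pow_left_inj₀ (norm_nonneg _) (norm_nonneg _) two_ne_zero).1 h2
  have hb : ∀ x, ‖Lb x‖ ≤ 1 * ‖La x‖ := fun x => by rw [hn, one_mul]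
  have he := LinearMap.extendOfNorm_eq hdr ⟨1, hb⟩
  refine ⟨⟨(Lb.extendOfNorm La).toLinearMap, fun x => ?_⟩, fun i => ?_⟩
  · refine hdr.induction_on (p := fun x => ‖Lb.extendOfNorm La x‖ = ‖x‖) x
      (isClosed_eq (by fun_prop) (by fun_prop)) fun y => ?_
    rw [he, hn]
  · have := he (Finsupp.single i 1)
    simpa [La, Lb] using this

theorem integrable_mul_of_memLp {k : ℝ} {f g : ℝ → ℂ} (hf : MemLp f 2 (mu k))
    (hg : MemLp g 2 (mu k)) : Integrable (fun x => f x * g x) (mu k) := hf.integrable_mul hg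

theorem ae_eq_zero_of_integral_gaussFamily {k : ℝ} (hk : -1 / 2 ≤ k) {g : ℝ → ℂ}
    (hi : ∀ i, Integrable (fun x => g x * gaussFamily i x) (mu k))
    (h : ∀ i, ∫ x, g x * gaussFamily i x ∂mu k = 0) : g =ᵐ[mu k] 0 := by
  refine ae_eq_zero_of_integral_gauss hk ?_ ?_ (fun z hz => ?_) fun z hz => ?_
  · simpa [gaussFamily] using hi (⟨1, mem_Ioi.2 one_pos⟩, false)
  · simpa [gaussFamily] using hi (⟨1, mem_Ioi.2 one_pos⟩, true)
  · simpa [gaussFamily] using h (⟨z, hz⟩, false)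
  · simpa [gaussFamily] using h (⟨z, hz⟩, true)

/-- A vector orthogonal to the span integrates to zero against all Gaussians, which separate
functions. -/
theorem dense_span_gaussLp {k : ℝ} (hk : -1 / 2 ≤ k) :
    Dense (Submodule.span ℂ (range (gaussLp hk)) : Set (Lp ℂ 2 (mu k))) := by
  rw [Submodule.dense_iff_topologicalClosure_eq_top, Submodule.topologicalClosure_eq_top_iff,
    Submodule.eq_bot_iff]
  intro v hv
  rw [Submodule.mem_orthogonal] at hv
  rw [Lp.eq_zero_iff_ae_eq_zero]
  refine ae_eq_zero_of_integral_gaussFamily hk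
    (fun i => integrable_mul_of_memLp (Lp.memLp v) (memLp_gaussFamily hk i)) fun i => ?_
  rw [← inner_gaussLp hk]
  exact hv _ (Submodule.subset_span ⟨i, rfl⟩)

/-! ### The Dunkl transform on `L²` -/

theorem exists_dunklL2 {k : ℝ} (hk : -1 / 2 ≤ k) : ∃ U : Lp ℂ 2 (mu k) →ₗᵢ[ℂ] Lp ℂ 2 (mu k),
    ∀ i, U (gaussLp hk i) = gaussFactor k i • gaussLp hk (dualIndex i) :=
  exists_isometry_of_gram _ _ (dense_span_gaussLp hk) (inner_gaussLp_dual hk)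

/-- The Dunkl transform on `L²_k(ℝ)`. -/
def dunklL2 {k : ℝ} (hk : -1 / 2 ≤ k) : Lp ℂ 2 (mu k) →ₗᵢ[ℂ] Lp ℂ 2 (mu k) :=
  (exists_dunklL2 hk).choose

theorem dunklL2_gaussLp {k : ℝ} (hk : -1 / 2 ≤ k) (i : Ioi (0 : ℝ) × Bool) :
    dunklL2 hk (gaussLp hk i) = gaussFactor k i • gaussLp hk (dualIndex i) :=
  (exists_dunklL2 hk).choose_spec i

/-- Both sides are continuous in v, so it suffices to take v Gaussian, where this is Fubini for the
integral transform. -/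
theorem integral_dunklL2_mul_gaussFamily {k : ℝ} (hk : -1 / 2 ≤ k) (i : Ioi (0 : ℝ) × Bool)
    (v : Lp ℂ 2 (mu k)) :
    ∫ x, dunklL2 hk v x * gaussFamily i x ∂mu k = ∫ x, v x * dunklF k (gaussFamily i) x ∂mu k := by
  have e : ∀ v : Lp ℂ 2 (mu k), ∫ x, v x * dunklF k (gaussFamily i) x ∂mu k
      = gaussFactor k i * inner ℂ (gaussLp hk (dualIndex i)) v := by
    intro v
    rw [inner_gaussLp, ← integral_const_mul, dunklF_gaussFamily hk]
    congr 1; funext x; ring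
  rw [e, ← inner_gaussLp hk]
  have hc : (innerSL ℂ (gaussLp hk i)).comp (dunklL2 hk).toContinuousLinearMap
      = gaussFactor k i • innerSL ℂ (gaussLp hk (dualIndex i)) := by
    refine ContinuousLinearMap.ext_on (dense_span_gaussLp hk) ?_
    rintro _ ⟨j, rfl⟩
    simp only [ContinuousLinearMap.comp_apply, LinearIsometry.coe_toContinuousLinearMap,
      innerSL_apply_apply, smul_apply, smul_eq_mul]
    rw [← e, dunklL2_gaussLp, inner_smul_right, inner_gaussLp, ← integral_const_mul]
    have h1 := integral_dunklF_mul hk (integrable_gaussFamily hk j) (integrable_gaussFamily hk i)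
    rw [dunklF_gaussFamily hk j] at h1
    trans ∫ l, gaussFactor k j * gaussFamily (dualIndex j) l * gaussFamily i l ∂mu k
    · refine integral_congr_ae ?_
      filter_upwards [coeFn_gaussLp hk (dualIndex j)] with x hx
      rw [hx, mul_assoc]
    · rw [h1]
      refine integral_congr_ae ?_
      filter_upwards [coeFn_gaussLp hk j] with x hx
      rw [hx]
  exact congrArg (fun T => T v) hc

/-- The isometry was built abstractly from Gaussians. It agrees with the integral formula because
both have the same pairing with each Gaussian, after transposition. -/
theorem dunklL2_toLp {k : ℝ} (hk : -1 / 2 ≤ k) {f : ℝ → ℂ} (hf : MemLp f 2 (mu k))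
    (hf1 : Integrable f (mu k)) : dunklL2 hk (hf.toLp f) =ᵐ[mu k] dunklF k f := by
  have hi1 : ∀ i, Integrable (fun x => dunklL2 hk (hf.toLp f) x * gaussFamily i x) (mu k) :=
    fun i => integrable_mul_of_memLp (Lp.memLp _) (memLp_gaussFamily hk i)
  have hi2 : ∀ i, Integrable (fun x => dunklF k f x * gaussFamily i x) (mu k) := fun i =>
    (integrable_gaussFamily hk i).bdd_mul (continuous_dunklF hk hf1).aestronglyMeasurable
      (Eventually.of_forall (norm_dunklF_le hk hf1))
  have := ae_eq_zero_of_integral_gaussFamily hk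
    (g := fun x => dunklL2 hk (hf.toLp f) x - dunklF k f x) ?_ ?_
  · filter_upwards [this] with x hx using sub_eq_zero.1 hx
  · intro i
    simp only [sub_mul]
    exact (hi1 i).sub (hi2 i)
  · intro i
    simp only [sub_mul]
    rw [integral_sub (hi1 i) (hi2 i), integral_dunklL2_mul_gaussFamily,
      integral_dunklF_mul hk hf1 (integrable_gaussFamily hk i), sub_eq_zero]
    refine integral_congr_ae ?_
    filter_upwards [hf.coeFn_toLp] with x hx
    rw [hx]

theorem memLp_dunklF {k : ℝ} (hk : -1 / 2 ≤ k) {f : ℝ → ℂ} (hf : MemLp f 2 (mu k))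
    (hf1 : Integrable f (mu k)) : MemLp (dunklF k f) 2 (mu k) :=
  (memLp_congr_ae (dunklL2_toLp hk hf hf1)).1 (Lp.memLp _)

theorem eLpNorm_dunklF {k : ℝ} (hk : -1 / 2 ≤ k) {f : ℝ → ℂ} (hf : MemLp f 2 (mu k))
    (hf1 : Integrable f (mu k)) : eLpNorm (dunklF k f) 2 (mu k) = eLpNorm f 2 (mu k) := by
  rw [← eLpNorm_congr_ae (dunklL2_toLp hk hf hf1), ← Lp.enorm_def, ← Lp.enorm_toLp hf,
    ← ofReal_norm, ← ofReal_norm, LinearIsometry.norm_map]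

/-! ### Operators on `L²` given by formulas -/

theorem eLpNorm_two_sq {α : Type*} [MeasurableSpace α] (μ : Measure α) (f : α → ℂ) :
    eLpNorm f 2 μ ^ 2 = ∫⁻ x, ‖f x‖ₑ ^ 2 ∂μ := by
  have := eLpNorm_nnreal_pow_eq_lintegral (μ := μ) (f := f) (p := 2) two_ne_zero
  simpa using this

theorem eLpNorm_two_le_of_lintegral_le {α β : Type*} [MeasurableSpace α] [MeasurableSpace β]
    {μ : Measure α} {ν : Measure β} {f : α → ℂ} {g : β → ℂ} {C : ℝ≥0∞}
    (h : ∫⁻ x, ‖f x‖ₑ ^ 2 ∂μ ≤ C ^ 2 * ∫⁻ x, ‖g x‖ₑ ^ 2 ∂ν) :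
    eLpNorm f 2 μ ≤ C * eLpNorm g 2 ν := by
  rw [← eLpNorm_two_sq, ← eLpNorm_two_sq, ← mul_pow] at h
  exact (ENNReal.pow_le_pow_left_iff two_ne_zero).1 h

/-- Lets a formula on functions act on L² classes: additivity and the norm bound together force the
formula to respect equality almost everywhere. -/
theorem exists_clm_of_bound {α : Type*} [MeasurableSpace α] {μ : Measure α}
    (L : (α → ℂ) → α → ℂ) (C : NNReal)
    (hm : ∀ f, MemLp f 2 μ → AEStronglyMeasurable (L f) μ)
    (hb : ∀ f, MemLp f 2 μ → eLpNorm (L f) 2 μ ≤ C * eLpNorm f 2 μ)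
    (hadd : ∀ f g, MemLp f 2 μ → MemLp g 2 μ → L (f + g) =ᵐ[μ] L f + L g)
    (hsmul : ∀ (c : ℂ) f, MemLp f 2 μ → L (c • f) =ᵐ[μ] c • L f) :
    ∃ A : Lp ℂ 2 μ →L[ℂ] Lp ℂ 2 μ, ∀ f (hf : MemLp f 2 μ), A (hf.toLp f) =ᵐ[μ] L f := by
  have hL : ∀ f, MemLp f 2 μ → MemLp (L f) 2 μ := fun f hf =>
    ⟨hm f hf, (hb f hf).trans_lt (ENNReal.mul_lt_top ENNReal.coe_lt_top hf.2)⟩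
  have hcongr : ∀ f g, MemLp f 2 μ → MemLp g 2 μ → f =ᵐ[μ] g → L f =ᵐ[μ] L g := by
    intro f g hf hg hfg
    -- Write f = g + (f - g); the bound makes L(f - g) null.
    have h1 := hadd g (f - g) hg (hf.sub hg)
    rw [add_sub_cancel] at h1
    have h2 : L (f - g) =ᵐ[μ] 0 := by
      rw [← eLpNorm_eq_zero_iff (hm _ (hf.sub hg)) two_ne_zero]
      refine le_antisymm ((hb _ (hf.sub hg)).trans ?_) bot_le
      have : f - g =ᵐ[μ] 0 := hfg.mono fun x hx => by simp [hx]
      rw [eLpNorm_congr_ae this]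
      simp
    filter_upwards [h1, h2] with x h1 h2
    rw [h1, Pi.add_apply, h2, Pi.zero_apply, add_zero]
  refine ⟨LinearMap.mkContinuous
    { toFun := fun v => (hL v (Lp.memLp v)).toLp _
      map_add' := fun v w => ?_
      map_smul' := fun c v => ?_ } C fun v => ?_, fun f hf => ?_⟩
  · rw [← MemLp.toLp_add, MemLp.toLp_eq_toLp_iff]
    exact (hcongr _ _ (Lp.memLp _) ((Lp.memLp v).add (Lp.memLp w)) (Lp.coeFn_add v w)).trans
      (hadd _ _ (Lp.memLp v) (Lp.memLp w))
  · rw [RingHom.id_apply, ← MemLp.toLp_const_smul, MemLp.toLp_eq_toLp_iff]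
    exact (hcongr _ _ (Lp.memLp _) ((Lp.memLp v).const_smul c) (Lp.coeFn_smul c v)).trans
      (hsmul _ _ (Lp.memLp v))
  · simp only [LinearMap.coe_mk, AddHom.coe_mk, Lp.norm_toLp]
    rw [Lp.norm_def, ← ENNReal.coe_toReal, ← ENNReal.toReal_mul]
    exact ENNReal.toReal_mono (ENNReal.mul_ne_top ENNReal.coe_ne_top (Lp.memLp v).2.ne)
      (hb _ (Lp.memLp v))
  · simp only [LinearMap.mkContinuous_apply, LinearMap.coe_mk, AddHom.coe_mk]
    exact (MemLp.coeFn_toLp _).trans (hcongr _ _ (Lp.memLp _) hf hf.coeFn_toLp)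

/-! ### Dilations -/

theorem ofReal_rpow_sq (a k : ℝ) (ha : 0 ≤ a) :
    ENNReal.ofReal (a ^ (-(k + 1))) ^ 2 = ENNReal.ofReal (a ^ (-(2 * k + 2))) := by
  rw [← ENNReal.ofReal_pow (Real.rpow_nonneg ha _), ← Real.rpow_mul_natCast ha]
  push_cast
  ring_nf

theorem lintegral_sq_comp_mul_left (k : ℝ) {r : ℝ} (hr : r ≠ 0) (f : ℝ → ℂ) :
    ∫⁻ x, ‖f (r * x)‖ₑ ^ 2 ∂mu k
      = ENNReal.ofReal (|r| ^ (-(k + 1))) ^ 2 * ∫⁻ x, ‖f x‖ₑ ^ 2 ∂mu k := by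
  rw [ofReal_rpow_sq |r| k (abs_nonneg r)]
  exact lintegral_mu_mul_left hr fun x => ‖f x‖ₑ ^ 2

theorem memLp_comp_mul_left {k : ℝ} {r : ℝ} (hr : r ≠ 0) {f : ℝ → ℂ} (hf : MemLp f 2 (mu k)) :
    MemLp (fun x => f (r * x)) 2 (mu k) :=
  ⟨hf.1.comp_quasiMeasurePreserving (quasiMeasurePreserving_mul_left_mu k hr),
    (eLpNorm_two_le_of_lintegral_le (lintegral_sq_comp_mul_left k hr f).le).trans_lt
      (ENNReal.mul_lt_top ENNReal.ofReal_lt_top hf.2)⟩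

theorem integrable_comp_mul_left {k : ℝ} {r : ℝ} (hr : r ≠ 0) {f : ℝ → ℂ}
    (hf : Integrable f (mu k)) : Integrable (fun x => f (r * x)) (mu k) := by
  refine ⟨hf.1.comp_quasiMeasurePreserving (quasiMeasurePreserving_mul_left_mu k hr), ?_⟩
  have := lintegral_mu_mul_left (k := k) hr fun x => ‖f x‖ₑ
  rw [hasFiniteIntegral_def, this]
  exact ENNReal.mul_lt_top ENNReal.ofReal_lt_top hf.2

theorem exists_dilationOp (k : ℝ) {r : ℝ} (hr : r ≠ 0) :
    ∃ A : Lp ℂ 2 (mu k) →L[ℂ] Lp ℂ 2 (mu k),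
      ∀ f (hf : MemLp f 2 (mu k)), A (hf.toLp f) =ᵐ[mu k] fun x => f (r * x) :=
  exists_clm_of_bound (fun f x => f (r * x)) (Real.toNNReal (|r| ^ (-(k + 1))))
    (fun _ hf => (memLp_comp_mul_left hr hf).1)
    (fun f _ => eLpNorm_two_le_of_lintegral_le (lintegral_sq_comp_mul_left k hr f).le)
    (fun _ _ _ _ => EventuallyEq.rfl) (fun _ _ _ => EventuallyEq.rfl)

theorem dunklF_comp_mul_left (k : ℝ) {r : ℝ} (hr : r ≠ 0) (f : ℝ → ℂ) (l : ℝ) :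
    dunklF k (fun x => f (r * x)) l = (|r| ^ (-(2 * k + 2)) : ℝ) * dunklF k f (r⁻¹ * l) := by
  have hr' : (r : ℂ) ≠ 0 := by exact_mod_cast hr
  have := integral_mu_mul_left (k := k) hr
    fun x : ℝ => f x * dexp k (-Complex.I * (r⁻¹ * l : ℝ) * x)
  rw [Complex.real_smul] at this
  rw [dunklF, dunklF, ← this]
  congr 1
  funext x
  congr 2
  push_cast
  field_simp

/-- The integral formula gives the rule on Gaussians, and both sides are bounded operators on L², so
it extends by density. -/
theorem dunklL2_comp_mul_left {k : ℝ} (hk : -1 / 2 ≤ k) {r : ℝ} (hr : r ≠ 0) {f : ℝ → ℂ}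
    (hf : MemLp f 2 (mu k)) :
    dunklL2 hk ((memLp_comp_mul_left hr hf).toLp _)
      =ᵐ[mu k] fun l => (|r| ^ (-(2 * k + 2)) : ℝ) * dunklL2 hk (hf.toLp f) (r⁻¹ * l) := by
  obtain ⟨A, hA⟩ := exists_dilationOp k hr
  obtain ⟨B, hB⟩ := exists_dilationOp k (inv_ne_zero hr)
  have hAB : (dunklL2 hk).toContinuousLinearMap.comp A
      = ((|r| ^ (-(2 * k + 2)) : ℝ) : ℂ) • B.comp (dunklL2 hk).toContinuousLinearMap := by
    refine ContinuousLinearMap.ext_on (dense_span_gaussLp hk) ?_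
    rintro _ ⟨i, rfl⟩
    have hi := memLp_gaussFamily hk i
    have h1 : A (gaussLp hk i) = (memLp_comp_mul_left hr hi).toLp _ :=
      Lp.ext ((hA _ hi).trans (MemLp.coeFn_toLp _).symm)
    have h2 : dunklL2 hk (gaussLp hk i)
        = (memLp_dunklF hk hi (integrable_gaussFamily hk i)).toLp _ :=
      Lp.ext ((dunklL2_toLp hk hi (integrable_gaussFamily hk i)).trans (MemLp.coeFn_toLp _).symm)
    simp only [ContinuousLinearMap.comp_apply, LinearIsometry.coe_toContinuousLinearMap,
      smul_apply]
    rw [h1, h2]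
    refine Lp.ext ?_
    refine (dunklL2_toLp hk _ (integrable_comp_mul_left hr (integrable_gaussFamily hk i))).trans ?_
    refine EventuallyEq.trans ?_ (Lp.coeFn_smul _ _).symm
    filter_upwards [hB _ (memLp_dunklF hk hi (integrable_gaussFamily hk i))] with l hl
    rw [Pi.smul_apply, hl, smul_eq_mul, dunklF_comp_mul_left k hr]
  have h1 : A (hf.toLp f) = (memLp_comp_mul_left hr hf).toLp _ :=
    Lp.ext ((hA _ hf).trans (MemLp.coeFn_toLp _).symm)
  have h2 := congrArg (fun T => T (hf.toLp f)) hAB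
  simp only [ContinuousLinearMap.comp_apply, LinearIsometry.coe_toContinuousLinearMap,
    smul_apply, h1] at h2
  rw [h2]
  have h3 := hB _ (Lp.memLp (dunklL2 hk (hf.toLp f)))
  rw [Lp.toLp_coeFn] at h3
  filter_upwards [Lp.coeFn_smul ((|r| ^ (-(2 * k + 2)) : ℝ) : ℂ) (B (dunklL2 hk (hf.toLp f))), h3]
    with l h4 h5
  rw [h4, Pi.smul_apply, h5, smul_eq_mul]

/-! ### Inversion -/

theorem dualIndex_dualIndex (i : Ioi (0 : ℝ) × Bool) : dualIndex (dualIndex i) = i := by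
  simp [dualIndex]

theorem gaussFactor_mul_dual (k : ℝ) (i : Ioi (0 : ℝ) × Bool) :
    gaussFactor k i * gaussFactor k (dualIndex i) = bif i.2 then -1 else 1 := by
  rcases i with ⟨⟨z, hz⟩, b⟩
  have hz : 0 < z := hz
  have hz' : (z : ℂ) ≠ 0 := by exact_mod_cast hz.ne'
  have h : ((z ^ (-(k + 1)) : ℝ) : ℂ) * ((z⁻¹ ^ (-(k + 1)) : ℝ) : ℂ) = 1 := by
    rw [← Complex.ofReal_mul, ← Real.mul_rpow hz.le (inv_pos.2 hz).le, mul_inv_cancel₀ hz.ne',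
      Real.one_rpow, Complex.ofReal_one]
  rcases b with _ | _
  · simpa [gaussFactor, dualIndex] using h
  · simp only [gaussFactor, dualIndex, cond_true]
    have e : -Complex.I / (z : ℂ) * (-Complex.I / ((z⁻¹ : ℝ) : ℂ)) = -1 := by
      push_cast
      field_simp
      exact Complex.I_sq
    linear_combination ((z ^ (-(k + 1)) : ℝ) : ℂ) * ((z⁻¹ ^ (-(k + 1)) : ℝ) : ℂ) * e - h

/-- Applied twice, the transform fixes even Gaussians and negates odd ones, as reflection does. -/
theorem dunklL2_dunklL2 {k : ℝ} (hk : -1 / 2 ≤ k) {f : ℝ → ℂ} (hf : MemLp f 2 (mu k)) :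
    dunklL2 hk (dunklL2 hk (hf.toLp f)) =ᵐ[mu k] fun x => f (-x) := by
  obtain ⟨A, hA⟩ := exists_dilationOp k (r := -1) (by norm_num)
  have hAU : (dunklL2 hk).toContinuousLinearMap.comp (dunklL2 hk).toContinuousLinearMap = A := by
    refine ContinuousLinearMap.ext_on (dense_span_gaussLp hk) ?_
    rintro _ ⟨i, rfl⟩
    simp only [ContinuousLinearMap.comp_apply, LinearIsometry.coe_toContinuousLinearMap]
    rw [dunklL2_gaussLp, map_smul, dunklL2_gaussLp, dualIndex_dualIndex, smul_smul,
      gaussFactor_mul_dual]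
    refine Lp.ext ((Lp.coeFn_smul _ _).trans
      (EventuallyEq.trans ?_ (hA _ (memLp_gaussFamily hk i)).symm))
    filter_upwards [coeFn_gaussLp hk i] with x hx
    rw [Pi.smul_apply, hx, smul_eq_mul]
    rcases i with ⟨z, _ | _⟩ <;> simp [gaussFamily, gauss_neg]
  have h := hA f hf
  rw [← hAU] at h
  simpa using h

theorem integral_dunklL2_mul {k : ℝ} (hk : -1 / 2 ≤ k) {g : ℝ → ℂ} (hg : MemLp g 2 (mu k))
    (hg1 : Integrable g (mu k)) (v : Lp ℂ 2 (mu k)) :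
    ∫ x, dunklL2 hk v x * g x ∂mu k = ∫ x, v x * dunklF k g x ∂mu k := by
  -- The bilinear pairing is an inner product with the conjugate, hence continuous in v; the rest is
  -- the density argument.
  have e : ∀ {w : ℝ → ℂ} (hw : MemLp w 2 (mu k)) (v : Lp ℂ 2 (mu k)),
      ∫ x, v x * w x ∂mu k = inner ℂ (hw.star.toLp _) v := by
    intro w hw v
    rw [L2.inner_def]
    refine integral_congr_ae ?_
    filter_upwards [hw.star.coeFn_toLp] with x hx
    rw [hx, RCLike.inner_apply]
    simp
  have hF := memLp_dunklF hk hg hg1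
  rw [e hg, e hF]
  have hc : (innerSL ℂ (hg.star.toLp _)).comp (dunklL2 hk).toContinuousLinearMap
      = innerSL ℂ (hF.star.toLp _) := by
    refine ContinuousLinearMap.ext_on (dense_span_gaussLp hk) ?_
    rintro _ ⟨i, rfl⟩
    simp only [ContinuousLinearMap.comp_apply, LinearIsometry.coe_toContinuousLinearMap,
      innerSL_apply_apply]
    rw [← e hg, ← e hF]
    trans ∫ x, dunklF k (gaussFamily i) x * g x ∂mu k
    · refine integral_congr_ae ?_
      filter_upwards [dunklL2_toLp hk (memLp_gaussFamily hk i) (integrable_gaussFamily hk i)]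
        with x hx
      rw [gaussLp, hx]
    · rw [integral_dunklF_mul hk (integrable_gaussFamily hk i) hg1]
      refine integral_congr_ae ?_
      filter_upwards [coeFn_gaussLp hk i] with x hx
      rw [hx]
  exact congrArg (fun T => T v) hc

theorem integral_dunklL2_mul_conj {k : ℝ} (hk : -1 / 2 ≤ k) {f g : ℝ → ℂ} (hf : MemLp f 2 (mu k))
    (hg : MemLp g 2 (mu k)) :
    ∫ x, f x * (starRingEnd ℂ) (g x) ∂mu k = ∫ l, dunklL2 hk (hf.toLp f) l *
      (starRingEnd ℂ) (dunklL2 hk (hg.toLp g) l) ∂mu k := by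
  have := (dunklL2 hk).inner_map_map (hg.toLp g) (hf.toLp f)
  rw [L2.inner_def, L2.inner_def] at this
  simp only [RCLike.inner_apply] at this
  rw [this]
  refine integral_congr_ae ?_
  filter_upwards [hf.coeFn_toLp, hg.coeFn_toLp] with x h1 h2
  rw [h1, h2]

/-! ### Spherical means -/

theorem lintegral_one_sub_sq_rpow_eq {k : ℝ} (F : ℝ → ℝ≥0∞) :
    ∫⁻ t in Ioo (-1 : ℝ) 1, ENNReal.ofReal ((1 - t ^ 2) ^ (k - 1 / 2)) * F t
      = ∫⁻ θ in Ioo 0 Real.pi, ENNReal.ofReal (|Real.sin θ| ^ (2 * k)) * F (Real.cos θ) := by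
  have himg : Real.cos '' Ioo 0 Real.pi = Ioo (-1) 1 :=
    Real.cosPartialHomeomorph.image_source_eq_target
  rw [← himg, lintegral_image_eq_lintegral_abs_deriv_mul measurableSet_Ioo
    (fun θ _ => (Real.hasDerivAt_cos θ).hasDerivWithinAt)
    (Real.injOn_cos.mono Ioo_subset_Icc_self)]
  refine setLIntegral_congr_fun measurableSet_Ioo fun θ hθ => ?_
  have hs : 0 < Real.sin θ := Real.sin_pos_of_mem_Ioo hθ
  rw [← mul_assoc, ← ENNReal.ofReal_mul (abs_nonneg _), abs_neg, abs_of_pos hs,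
    ← Real.sin_sq, ← Real.rpow_natCast, ← Real.rpow_mul hs.le]
  congr 2
  nth_rw 1 [← Real.rpow_one (Real.sin θ)]
  rw [← Real.rpow_add hs]
  congr 1; push_cast; ring

/-- In the plane, (y, θ) are polar coordinates and √(x² + y² + 2xy cos θ) is the distance to (-x,
0). The Jacobian y and the weight |y sin θ|^(2k) produce y^(2k+1) |sin θ|^(2k). -/
theorem polar_spherical {k : ℝ} {G : ℝ → ℝ≥0∞} (hG : Measurable G) (x : ℝ) :
    ∫⁻ y in Ioi (0 : ℝ), ENNReal.ofReal (y ^ (2 * k + 1)) *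
      ∫⁻ θ in Ioo (-Real.pi) Real.pi, ENNReal.ofReal (|Real.sin θ| ^ (2 * k)) *
        G √(x ^ 2 + y ^ 2 + 2 * x * y * Real.cos θ)
      = ∫⁻ p : ℝ × ℝ, ENNReal.ofReal (|p.2| ^ (2 * k)) * G √((p.1 + x) ^ 2 + p.2 ^ 2) := by
  rw [← lintegral_comp_polarCoord_symm, polarCoord_target, Measure.volume_eq_prod,
    ← Measure.prod_restrict, lintegral_prod]
  · refine setLIntegral_congr_fun measurableSet_Ioi fun y hy => ?_
    have hy : 0 < y := hy
    simp only [polarCoord_symm_apply, smul_eq_mul]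
    rw [← lintegral_const_mul _ (by fun_prop)]
    congr 1
    funext θ
    have e1 : (y * Real.cos θ + x) ^ 2 + (y * Real.sin θ) ^ 2
        = x ^ 2 + y ^ 2 + 2 * x * y * Real.cos θ := by
      linear_combination y ^ 2 * Real.sin_sq_add_cos_sq θ
    have e2 : y ^ (2 * k + 1) * |Real.sin θ| ^ (2 * k) = y * |y * Real.sin θ| ^ (2 * k) := by
      rw [abs_mul, abs_of_pos hy, Real.mul_rpow hy.le (abs_nonneg _), Real.rpow_add_one hy.ne']
      ring
    rw [e1, ← mul_assoc, ← mul_assoc, ← ENNReal.ofReal_mul (Real.rpow_nonneg hy.le _), e2,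
      ENNReal.ofReal_mul hy.le]
  · refine Measurable.aemeasurable ?_
    simp only [polarCoord_symm_apply]
    fun_prop

/-- The weight depends only on the second coordinate, so the integral is invariant under translation
in the first. -/
theorem lintegral_translate_prod {k : ℝ} {G : ℝ → ℝ≥0∞} (hG : Measurable G) (x : ℝ) :
    ∫⁻ p : ℝ × ℝ, ENNReal.ofReal (|p.2| ^ (2 * k)) * G √((p.1 + x) ^ 2 + p.2 ^ 2)
      = ∫⁻ p : ℝ × ℝ, ENNReal.ofReal (|p.2| ^ (2 * k)) * G √((p.1 + 0) ^ 2 + p.2 ^ 2) := by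
  rw [Measure.volume_eq_prod, lintegral_prod_symm _ (by fun_prop), lintegral_prod_symm _ (by fun_prop)]
  congr 1
  funext v
  simp only [add_zero]
  exact lintegral_add_right_eq_self
    (fun u : ℝ => ENNReal.ofReal (|v| ^ (2 * k)) * G √(u ^ 2 + v ^ 2)) x

theorem lintegral_abs_sin_rpow_lt_top {k : ℝ} (hk : -1 / 2 < k) :
    ∫⁻ θ in Ioo (-Real.pi) Real.pi, ENNReal.ofReal (|Real.sin θ| ^ (2 * k)) < ∞ := by
  have h1 : ∫⁻ θ in Ioo 0 Real.pi, ENNReal.ofReal (|Real.sin θ| ^ (2 * k)) < ∞ := by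
    have h := lintegral_one_sub_sq_rpow_eq (k := k) (fun _ => 1)
    simp only [mul_one] at h
    rw [← h]
    have hi := intervalIntegrable_one_sub_sq_rpow hk
    rw [intervalIntegrable_iff_integrableOn_Ioo_of_le (by norm_num)] at hi
    refine lt_of_le_of_lt (lintegral_mono fun t => ?_) hi.2
    rw [← ofReal_norm]
    exact ENNReal.ofReal_le_ofReal (Real.le_norm_self _)
  have h2 : ∫⁻ θ in Ioo (-Real.pi) 0, ENNReal.ofReal (|Real.sin θ| ^ (2 * k)) < ∞ := by
    have h := (Measure.measurePreserving_neg (volume : Measure ℝ)).setLIntegral_comp_preimage_emb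
      (Homeomorph.neg ℝ).measurableEmbedding
      (fun θ => ENNReal.ofReal (|Real.sin θ| ^ (2 * k))) (Ioo 0 Real.pi)
    simp only [Real.sin_neg, abs_neg, neg_preimage, neg_Ioo, neg_zero] at h
    rw [h]
    exact h1
  refine lt_of_le_of_lt (lintegral_mono_set (t := Ioo (-Real.pi) 0 ∪ ({0} ∪ Ioo 0 Real.pi)) ?_) ?_
  · intro θ hθ
    rcases lt_trichotomy θ 0 with h | h | h
    · exact Or.inl ⟨hθ.1, h⟩
    · exact Or.inr (Or.inl h)
    · exact Or.inr (Or.inr ⟨h, hθ.2⟩)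
  · refine lt_of_le_of_lt (lintegral_union_le _ _ _) (ENNReal.add_lt_top.2 ⟨h2, ?_⟩)
    refine lt_of_le_of_lt (lintegral_union_le _ _ _) (ENNReal.add_lt_top.2 ⟨?_, h1⟩)
    simp

/-- The spherical means with weight `(1 - t²)^(k - 1/2)` are bounded on `L¹`. -/
theorem lintegral_Ioi_spherical_le {k : ℝ} {G : ℝ → ℝ≥0∞} (hG : Measurable G) (x : ℝ) :
    ∫⁻ y in Ioi (0 : ℝ), ENNReal.ofReal (y ^ (2 * k + 1)) *
      ∫⁻ t in Ioo (-1 : ℝ) 1, ENNReal.ofReal ((1 - t ^ 2) ^ (k - 1 / 2)) *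
        G √(x ^ 2 + y ^ 2 + 2 * x * y * t)
      ≤ (∫⁻ θ in Ioo (-Real.pi) Real.pi, ENNReal.ofReal (|Real.sin θ| ^ (2 * k))) *
        ∫⁻ y in Ioi (0 : ℝ), ENNReal.ofReal (y ^ (2 * k + 1)) * G y := by
  -- The centre is moved from (-x, 0) to the origin, where G depends on the radius alone and the
  -- angular integral factors out.
  have h := (polar_spherical (k := k) hG x).trans
    ((lintegral_translate_prod hG x).trans (polar_spherical hG 0).symm)
  calc _ ≤ ∫⁻ y in Ioi (0 : ℝ), ENNReal.ofReal (y ^ (2 * k + 1)) *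
      ∫⁻ θ in Ioo (-Real.pi) Real.pi, ENNReal.ofReal (|Real.sin θ| ^ (2 * k)) *
        G √(x ^ 2 + y ^ 2 + 2 * x * y * Real.cos θ) := by
        refine lintegral_mono fun y => ?_
        refine mul_le_mul_right ?_ _
        rw [lintegral_one_sub_sq_rpow_eq (fun t => G √(x ^ 2 + y ^ 2 + 2 * x * y * t))]
        -- Passing from (0, π) to the full circle makes polar coordinates available and only
        -- increases the integral.
        exact lintegral_mono_set (Ioo_subset_Ioo_left (by linarith [Real.pi_pos]))
    _ = _ := h
    _ = ∫⁻ y in Ioi (0 : ℝ), (∫⁻ θ in Ioo (-Real.pi) Real.pi,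
          ENNReal.ofReal (|Real.sin θ| ^ (2 * k))) *
          (ENNReal.ofReal (y ^ (2 * k + 1)) * G y) := by
        refine setLIntegral_congr_fun measurableSet_Ioi fun y hy => ?_
        have hy : 0 < y := hy
        simp only [ne_eq, OfNat.ofNat_ne_zero, not_false_eq_true, zero_pow, zero_add, mul_zero,
          zero_mul, add_zero, Real.sqrt_sq hy.le]
        rw [lintegral_mul_const _ (by fun_prop)]
        ring
    _ = _ := lintegral_const_mul _ (by fun_prop)

theorem lintegral_eq_Ioi_add {f : ℝ → ℝ≥0∞} :
    ∫⁻ y, f y = (∫⁻ y in Ioi (0 : ℝ), f y) + ∫⁻ y in Ioi (0 : ℝ), f (-y) := by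
  have h := (Measure.measurePreserving_neg (volume : Measure ℝ)).setLIntegral_comp_preimage_emb
      (Homeomorph.neg ℝ).measurableEmbedding f (Iio 0)
  simp only [neg_preimage, neg_Iio, neg_zero] at h
  rw [h, setLIntegral_congr Iio_ae_eq_Iic, ← lintegral_add_compl f measurableSet_Ioi, compl_Ioi]

/-- The weight `1 + 2 / (1 + t)`, which bounds the square of the kernel of the translation. -/
def translationWeight (t : ℝ) : ℝ≥0∞ := ENNReal.ofReal (1 + 2 / (1 + t))

theorem measurable_translationWeight : Measurable translationWeight := by
  unfold translationWeight; fun_prop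

/-- The factor 1 + t of the angular weight cancels the pole at t = -1, since (1 + t)(1 + 2/(1 + t))
= 3 + t ≤ 4. -/
theorem lintegral_translationWeight_le {k : ℝ} (hk : -1 / 2 < k) {F : ℝ → ℝ≥0∞}
    (hF : Measurable F) :
    ∫⁻ t, translationWeight t * F t ∂angularMeasure k ≤ ENNReal.ofReal (4 * angularConst k) *
      ∫⁻ t in Ioo (-1 : ℝ) 1, ENNReal.ofReal ((1 - t ^ 2) ^ (k - 1 / 2)) * F t := by
  have hc := angularConst_pos hk
  have hm := measurable_translationWeight
  rw [lintegral_angularMeasure hk (fun t => translationWeight t * F t) (by fun_prop),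
    ← lintegral_const_mul _ (by fun_prop), ← restrict_Ioo_eq_restrict_Ioc]
  refine setLIntegral_mono (by fun_prop) fun t ht => ?_
  have h1 : 0 < 1 + t := by linarith [ht.1]
  have h2 : 0 ≤ (1 - t ^ 2) ^ (k - 1 / 2) := Real.rpow_nonneg (by nlinarith [ht.1, ht.2]) _
  rw [translationWeight, ← mul_assoc, ← mul_assoc, 
    ← ENNReal.ofReal_mul (mul_nonneg hc.le (angularWeight_nonneg k ⟨ht.1, ht.2.le⟩)),
    ← ENNReal.ofReal_mul (by positivity)]
  refine mul_le_mul_left (ENNReal.ofReal_le_ofReal ?_) _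
  have e : angularConst k * angularWeight k t * (1 + 2 / (1 + t))
      = angularConst k * (1 - t ^ 2) ^ (k - 1 / 2) * (3 + t) := by
    rw [angularWeight]; field_simp; ring
  rw [e]
  nlinarith [mul_nonneg hc.le h2, ht.2]

theorem exists_lintegral_translation_le {k : ℝ} (hk : -1 / 2 ≤ k) : ∃ C : NNReal, ∀ (x : ℝ)
    (G : ℝ → ℝ≥0∞), Measurable G →
    ∫⁻ y, ∫⁻ t, translationWeight t * G √(x ^ 2 + y ^ 2 + 2 * x * y * t) ∂angularMeasure k ∂mu k
      ≤ C * ∫⁻ y, G |y| ∂mu k := by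
  rcases hk.eq_or_lt with rfl | hk
  -- 2 is the value of `translationWeight` at t = 1, the only point charged when k = -1/2.
  · refine ⟨2, fun x G hG => ?_⟩
    simp only [angularMeasure_neg_half]
    have e : ∀ y : ℝ, ∫⁻ t, translationWeight t * G √(x ^ 2 + y ^ 2 + 2 * x * y * t)
        ∂Measure.dirac 1 = 2 * G |x + y| := by
      intro y
      rw [lintegral_dirac' _ (by have := measurable_translationWeight; fun_prop),
        show x ^ 2 + y ^ 2 + 2 * x * y * 1 = (x + y) ^ 2 by ring, Real.sqrt_sq_eq_abs,
        translationWeight]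
      norm_num
    have hd : ∀ y : ℝ, muDensity (-1 / 2) y = muDensity (-1 / 2) 1 := by
      intro y
      simp only [muDensity]
      norm_num
    simp_rw [e]
    rw [lintegral_const_mul _ (by fun_prop), lintegral_mu, lintegral_mu]
    simp_rw [hd]
    refine le_of_eq ?_
    congr 1
    exact lintegral_add_left_eq_self (fun y => ENNReal.ofReal (muDensity (-1 / 2) 1) * G |y|) x
  · set D := ∫⁻ θ in Ioo (-Real.pi) Real.pi, ENNReal.ofReal (|Real.sin θ| ^ (2 * k)) with hD
    have hDt : D ≠ ∞ := (lintegral_abs_sin_rpow_lt_top hk).ne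
    set c := 2 ^ (k + 1) * Real.Gamma (k + 1) with hcdef
    have hc : 0 < c := muDensity_const_pos hk.le
    -- The factor 4 `angularConst` comes from the weight, D from the circle, and 2 from the two
    -- half-lines.
    refine ⟨(ENNReal.ofReal (4 * angularConst k) * (2 * D)).toNNReal, fun x G hG => ?_⟩
    rw [ENNReal.coe_toNNReal (ENNReal.mul_ne_top ENNReal.ofReal_ne_top
      (ENNReal.mul_ne_top ENNReal.ofNat_ne_top hDt))]
    set J : ℝ → ℝ → ℝ≥0∞ := fun x y => ∫⁻ t in Ioo (-1 : ℝ) 1,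
      ENNReal.ofReal ((1 - t ^ 2) ^ (k - 1 / 2)) * G √(x ^ 2 + y ^ 2 + 2 * x * y * t) with hJ
    have hJm : ∀ x, Measurable (J x) := fun x => by
      refine Measurable.lintegral_prod_right' (f := fun p : ℝ × ℝ =>
        ENNReal.ofReal ((1 - p.2 ^ 2) ^ (k - 1 / 2)) *
          G √(x ^ 2 + p.1 ^ 2 + 2 * x * p.1 * p.2)) ?_
      fun_prop
    have hden : ∀ y : ℝ, 0 < y →
        ENNReal.ofReal (muDensity k y) = ENNReal.ofReal c⁻¹ * ENNReal.ofReal (y ^ (2 * k + 1)) := by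
      intro y hy
      rw [← ENNReal.ofReal_mul (inv_pos.2 hc).le, muDensity, abs_of_pos hy, div_eq_inv_mul]
    have hR : ENNReal.ofReal c⁻¹ * ∫⁻ y in Ioi (0 : ℝ), ENNReal.ofReal (y ^ (2 * k + 1)) * G y
        ≤ ∫⁻ y, G |y| ∂mu k := by
      rw [lintegral_mu, ← lintegral_const_mul _ (by fun_prop)]
      refine le_trans (le_of_eq ?_) (setLIntegral_le_lintegral (Ioi (0 : ℝ)) _)
      refine setLIntegral_congr_fun measurableSet_Ioi fun y hy => ?_
      rw [hden y hy, abs_of_pos hy, mul_assoc]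
    have hN : ∀ x, ∫⁻ y in Ioi (0 : ℝ), ENNReal.ofReal (muDensity k y) * J x y
        ≤ D * ∫⁻ y, G |y| ∂mu k := by
      intro x
      have h := lintegral_Ioi_spherical_le (k := k) hG x
      calc ∫⁻ y in Ioi (0 : ℝ), ENNReal.ofReal (muDensity k y) * J x y
          = ENNReal.ofReal c⁻¹ * ∫⁻ y in Ioi (0 : ℝ), ENNReal.ofReal (y ^ (2 * k + 1)) * J x y := by
            have := hJm x
            rw [← lintegral_const_mul _ (by fun_prop)]
            refine setLIntegral_congr_fun measurableSet_Ioi fun y hy => ?_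
            rw [hden y hy, mul_assoc]
        _ ≤ ENNReal.ofReal c⁻¹ *
            (D * ∫⁻ y in Ioi (0 : ℝ), ENNReal.ofReal (y ^ (2 * k + 1)) * G y) := by gcongr
        _ = D * (ENNReal.ofReal c⁻¹ *
            ∫⁻ y in Ioi (0 : ℝ), ENNReal.ofReal (y ^ (2 * k + 1)) * G y) := by ring
        _ ≤ _ := by gcongr
    calc _ ≤ ∫⁻ y, ENNReal.ofReal (4 * angularConst k) * J x y ∂mu k :=
          lintegral_mono fun y => lintegral_translationWeight_le hk (by fun_prop)
      _ = ENNReal.ofReal (4 * angularConst k) * ∫⁻ y, ENNReal.ofReal (muDensity k y) * J x y := by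
          rw [lintegral_const_mul _ (hJm x), lintegral_mu]
      _ ≤ ENNReal.ofReal (4 * angularConst k) * (D * (∫⁻ y, G |y| ∂mu k) +
          D * (∫⁻ y, G |y| ∂mu k)) := by
          gcongr
          rw [lintegral_eq_Ioi_add]
          -- A negative y with centre x is a positive y with centre -x.
          refine add_le_add (hN x) (le_trans (le_of_eq ?_) (hN (-x)))
          congr 1
          funext y
          rw [muDensity_neg]
          congr 1
          simp only [hJ]
          congr 1
          funext t
          ring_nf
      _ = _ := by ring

/-! ### The generalized translation on `L²` -/

theorem one_le_translationWeight {t : ℝ} (ht : t ∈ Ioc (-1 : ℝ) 1) : 1 ≤ translationWeight t := by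
  rw [translationWeight, ← ENNReal.ofReal_one]
  refine ENNReal.ofReal_le_ofReal ?_
  have : 0 < 1 + t := by linarith [ht.1]
  have := div_pos two_pos this
  linarith

theorem quasiMeasurePreserving_abs_mu (k : ℝ) :
    Measure.QuasiMeasurePreserving (fun y : ℝ => |y|) (mu k) (mu k) := by
  refine ⟨by fun_prop, Measure.AbsolutelyContinuous.mk fun s hs h0 => ?_⟩
  rw [Measure.map_apply (by fun_prop) hs]
  have h1 := (measurePreserving_neg_mu k).measure_preimage hs.nullMeasurableSet
  refine measure_mono_null (t := s ∪ (fun x : ℝ => -x) ⁻¹' s) ?_ (measure_union_null h0 (h1.trans h0))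
  intro y hy
  rcases abs_choice y with h | h
  · left; simpa [h] using hy
  · right; simpa [h] using hy

/-- The L¹ bound applied to the indicator of a null set. It makes the composition of f with A well
defined up to null sets, hence measurable for f merely almost everywhere measurable. -/
theorem quasiMeasurePreserving_sqrt {k : ℝ} (hk : -1 / 2 ≤ k) (x : ℝ) :
    Measure.QuasiMeasurePreserving (fun p : ℝ × ℝ => √(x ^ 2 + p.1 ^ 2 + 2 * x * p.1 * p.2))
      ((mu k).prod (angularMeasure k)) (mu k) := by
  have := isProbabilityMeasure_angularMeasure hk
  refine ⟨by fun_prop, Measure.AbsolutelyContinuous.mk fun s hs h0 => ?_⟩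
  rw [Measure.map_apply (by fun_prop) hs]
  obtain ⟨C, hC⟩ := exists_lintegral_translation_le hk
  have h1 := hC x (s.indicator 1) (measurable_one.indicator hs)
  have h2 : ∫⁻ y, s.indicator (1 : ℝ → ℝ≥0∞) |y| ∂mu k = 0 := by
    have e : (fun y : ℝ => s.indicator (1 : ℝ → ℝ≥0∞) |y|)
        = ((fun y : ℝ => |y|) ⁻¹' s).indicator 1 := by
      funext y; simp [indicator]; rfl
    rw [e, lintegral_indicator_one ((by fun_prop : Measurable fun y : ℝ => |y|) hs)]
    exact (quasiMeasurePreserving_abs_mu k).preimage_null h0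
  rw [h2, mul_zero] at h1
  have hm : MeasurableSet ((fun p : ℝ × ℝ => √(x ^ 2 + p.1 ^ 2 + 2 * x * p.1 * p.2)) ⁻¹' s) :=
    (by fun_prop : Measurable fun p : ℝ × ℝ => √(x ^ 2 + p.1 ^ 2 + 2 * x * p.1 * p.2)) hs
  rw [← lintegral_indicator_one hm, lintegral_prod _ (measurable_one.indicator hm).aemeasurable]
  refine le_antisymm (le_trans ?_ h1) bot_le
  refine lintegral_mono fun y => lintegral_mono_ae ?_
  filter_upwards [ae_angularMeasure k] with t ht
  refine le_trans ?_ (mul_le_mul_left (one_le_translationWeight ht) _)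
  rw [one_mul]
  exact le_of_eq (by simp [indicator]; rfl)

theorem quasiMeasurePreserving_neg_sqrt {k : ℝ} (hk : -1 / 2 ≤ k) (x : ℝ) :
    Measure.QuasiMeasurePreserving (fun p : ℝ × ℝ => -√(x ^ 2 + p.1 ^ 2 + 2 * x * p.1 * p.2))
      ((mu k).prod (angularMeasure k)) (mu k) :=
  (measurePreserving_neg_mu k).quasiMeasurePreserving.comp (quasiMeasurePreserving_sqrt hk x)

theorem aestronglyMeasurable_translationKernel {k : ℝ} (hk : -1 / 2 ≤ k) (x : ℝ) {f : ℝ → ℂ}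
    (hf : AEStronglyMeasurable f (mu k)) :
    AEStronglyMeasurable (fun p : ℝ × ℝ => translationKernel f x p.1 p.2)
      ((mu k).prod (angularMeasure k)) := by
  have h1 := hf.comp_quasiMeasurePreserving (quasiMeasurePreserving_sqrt hk x)
  have h2 := hf.comp_quasiMeasurePreserving (quasiMeasurePreserving_neg_sqrt hk x)
  have h3 : AEStronglyMeasurable (fun p : ℝ × ℝ =>
      (((x + p.1) / √(x ^ 2 + p.1 ^ 2 + 2 * x * p.1 * p.2) : ℝ) : ℂ))
      ((mu k).prod (angularMeasure k)) :=
    (by fun_prop : Measurable _).aestronglyMeasurable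
  have h4 := ((h1.add h2).mul_const (2⁻¹ : ℂ)).add (h3.mul ((h1.sub h2).mul_const (2⁻¹ : ℂ)))
  refine h4.congr (Eventually.of_forall fun p => ?_)
  simp only [Pi.add_apply, Pi.mul_apply, Pi.sub_apply, Function.comp, translationKernel,
    div_eq_mul_inv]

/-- The quotient (x + y)/A is unbounded near t = -1, but 2A² - (1 + t)(x + y)² = (1 - t)(x - y)² ≥ 0
controls its square by a quantity that the angular weight absorbs. -/
theorem sq_div_sqrt_le {x y t : ℝ} (ht : t ∈ Ioc (-1 : ℝ) 1) :
    ((x + y) / √(x ^ 2 + y ^ 2 + 2 * x * y * t)) ^ 2 ≤ 2 / (1 + t) := by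
  have h1 : 0 < 1 + t := by linarith [ht.1]
  have h2 : (x + y) ^ 2 * (1 + t) ≤ 2 * (x ^ 2 + y ^ 2 + 2 * x * y * t) := by
    nlinarith [mul_nonneg (sub_nonneg.2 ht.2) (sq_nonneg (x - y))]
  rcases le_or_gt (x ^ 2 + y ^ 2 + 2 * x * y * t) 0 with h | h
  · rw [Real.sqrt_eq_zero_of_nonpos h, div_zero, zero_pow two_ne_zero]
    exact (div_pos two_pos h1).le
  · rw [div_pow, Real.sq_sqrt h.le, div_le_div_iff₀ h h1]
    exact h2

theorem enorm_translationKernel_sq_le (f : ℝ → ℂ) {x y t : ℝ} (ht : t ∈ Ioc (-1 : ℝ) 1) :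
    ‖translationKernel f x y t‖ₑ ^ 2 ≤ translationWeight t *
      (‖f √(x ^ 2 + y ^ 2 + 2 * x * y * t)‖ₑ ^ 2 + ‖f (-√(x ^ 2 + y ^ 2 + 2 * x * y * t))‖ₑ ^ 2) := by
  have hc := sq_div_sqrt_le (x := x) (y := y) ht
  have h1 : 0 < 1 + t := by linarith [ht.1]
  rw [translationKernel]
  generalize (x + y) / √(x ^ 2 + y ^ 2 + 2 * x * y * t) = c at *
  generalize f √(x ^ 2 + y ^ 2 + 2 * x * y * t) = a
  generalize f (-√(x ^ 2 + y ^ 2 + 2 * x * y * t)) = b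
  have hn : ‖(a + b) / 2 + (c : ℂ) * ((a - b) / 2)‖ ≤ (1 + |c|) / 2 * (‖a‖ + ‖b‖) := by
    refine (norm_add_le _ _).trans ?_
    rw [norm_mul, norm_div, norm_div, Complex.norm_real, Real.norm_eq_abs]
    have := norm_add_le a b
    have := norm_sub_le a b
    have h2 : ‖(2 : ℂ)‖ = 2 := by simp
    rw [h2]
    nlinarith [abs_nonneg c, mul_le_mul_of_nonneg_left this (abs_nonneg c)]
  rw [translationWeight, ← ofReal_norm, ← ofReal_norm, ← ofReal_norm,
    ← ENNReal.ofReal_pow (norm_nonneg _), ← ENNReal.ofReal_pow (norm_nonneg _),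
    ← ENNReal.ofReal_pow (norm_nonneg _), ← ENNReal.ofReal_add (by positivity) (by positivity),
    ← ENNReal.ofReal_mul (by positivity)]
  refine ENNReal.ofReal_le_ofReal ?_
  calc ‖(a + b) / 2 + (c : ℂ) * ((a - b) / 2)‖ ^ 2
      ≤ ((1 + |c|) / 2 * (‖a‖ + ‖b‖)) ^ 2 := pow_le_pow_left₀ (norm_nonneg _) hn 2
    _ = ((1 + |c|) ^ 2 / 2) * ((‖a‖ + ‖b‖) ^ 2 / 2) := by ring
    _ ≤ (1 + c ^ 2) * (‖a‖ ^ 2 + ‖b‖ ^ 2) := by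
        have e1 : (1 + |c|) ^ 2 / 2 ≤ 1 + c ^ 2 := by
          rw [← sq_abs c]; nlinarith [sq_nonneg (1 - |c|)]
        have e2 : (‖a‖ + ‖b‖) ^ 2 / 2 ≤ ‖a‖ ^ 2 + ‖b‖ ^ 2 := by nlinarith [sq_nonneg (‖a‖ - ‖b‖)]
        exact mul_le_mul e1 e2 (by positivity) (by positivity)
    _ ≤ _ := by gcongr

/-- The pointwise bound of the squared kernel reduces this to the L¹ estimate for |f(r)|² +
|f(-r)|². That estimate needs a measurable function, so f is replaced by a measurable
representative. -/
theorem exists_lintegral_translationKernel_le {k : ℝ} (hk : -1 / 2 ≤ k) : ∃ C : NNReal,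
    ∀ (x : ℝ) (f : ℝ → ℂ), AEStronglyMeasurable f (mu k) →
      ∫⁻ y, ∫⁻ t, ‖translationKernel f x y t‖ₑ ^ 2 ∂angularMeasure k ∂mu k
        ≤ C ^ 2 * ∫⁻ y, ‖f y‖ₑ ^ 2 ∂mu k := by
  have := isProbabilityMeasure_angularMeasure hk
  obtain ⟨C, hC⟩ := exists_lintegral_translation_le hk
  have key : ∀ (x : ℝ) (f : ℝ → ℂ), StronglyMeasurable f →
      ∫⁻ y, ∫⁻ t, ‖translationKernel f x y t‖ₑ ^ 2 ∂angularMeasure k ∂mu k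
        ≤ C * (2 * ∫⁻ y, ‖f y‖ₑ ^ 2 ∂mu k) := by
    intro x f hf
    have hfm := hf.measurable
    have hG : Measurable fun r => ‖f r‖ₑ ^ 2 + ‖f (-r)‖ₑ ^ 2 := by fun_prop
    calc _ ≤ ∫⁻ y, ∫⁻ t, translationWeight t * (‖f √(x ^ 2 + y ^ 2 + 2 * x * y * t)‖ₑ ^ 2
          + ‖f (-√(x ^ 2 + y ^ 2 + 2 * x * y * t))‖ₑ ^ 2) ∂angularMeasure k ∂mu k :=
          lintegral_mono fun y => lintegral_mono_ae
            ((ae_angularMeasure k).mono fun t ht => enorm_translationKernel_sq_le f ht)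
      _ ≤ C * ∫⁻ y, (‖f |y|‖ₑ ^ 2 + ‖f (-|y|)‖ₑ ^ 2) ∂mu k := hC x _ hG
      _ = C * ∫⁻ y, (‖f y‖ₑ ^ 2 + ‖f (-y)‖ₑ ^ 2) ∂mu k := by
          congr 2
          funext y
          rcases abs_choice y with h | h
          · rw [h]
          · rw [h, neg_neg, add_comm]
      _ = C * (2 * ∫⁻ y, ‖f y‖ₑ ^ 2 ∂mu k) := by
          rw [lintegral_add_left (by fun_prop),
            (measurePreserving_neg_mu k).lintegral_comp (f := fun y => ‖f y‖ₑ ^ 2) (by fun_prop),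
            two_mul]
  -- The estimate holds with 2C, and 2C ≤ (2C + 1)² puts the constant in squared form.
  refine ⟨2 * C + 1, fun x f hf => ?_⟩
  have hm := aestronglyMeasurable_translationKernel hk x hf
  have hm' := aestronglyMeasurable_translationKernel hk x hf.stronglyMeasurable_mk.aestronglyMeasurable
  have e1 := (quasiMeasurePreserving_sqrt hk x).ae_eq_comp hf.ae_eq_mk
  have e2 := (quasiMeasurePreserving_neg_sqrt hk x).ae_eq_comp hf.ae_eq_mk
  have e3 : ∫⁻ y, ‖f y‖ₑ ^ 2 ∂mu k = ∫⁻ y, ‖hf.mk f y‖ₑ ^ 2 ∂mu k :=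
    lintegral_congr_ae (hf.ae_eq_mk.mono fun y hy => by simp only [hy])
  have e4 : ∫⁻ y, ∫⁻ t, ‖translationKernel f x y t‖ₑ ^ 2 ∂angularMeasure k ∂mu k
      = ∫⁻ y, ∫⁻ t, ‖translationKernel (hf.mk f) x y t‖ₑ ^ 2 ∂angularMeasure k ∂mu k := by
    rw [← lintegral_prod (fun p : ℝ × ℝ => ‖translationKernel f x p.1 p.2‖ₑ ^ 2)
      (hm.enorm.pow_const 2),
      ← lintegral_prod (fun p : ℝ × ℝ => ‖translationKernel (hf.mk f) x p.1 p.2‖ₑ ^ 2)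
      (hm'.enorm.pow_const 2)]
    refine lintegral_congr_ae ?_
    filter_upwards [e1, e2] with p h1 h2
    simp only [Function.comp] at h1 h2
    simp only [translationKernel, h1, h2]
  rw [e3, e4]
  refine (key x _ hf.stronglyMeasurable_mk).trans ?_
  rw [← mul_assoc]
  gcongr
  have : C * 2 ≤ (2 * C + 1) ^ 2 := by
    rw [← NNReal.coe_le_coe]; push_cast; nlinarith [C.2, sq_nonneg (C : ℝ)]
  exact_mod_cast this

theorem ae_memLp_translationKernel {k : ℝ} (hk : -1 / 2 ≤ k) (x : ℝ) {f : ℝ → ℂ}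
    (hf : MemLp f 2 (mu k)) :
    ∀ᵐ y ∂mu k, MemLp (translationKernel f x y) 2 (angularMeasure k) := by
  have := isProbabilityMeasure_angularMeasure hk
  obtain ⟨C, hC⟩ := exists_lintegral_translationKernel_le hk
  have hm := aestronglyMeasurable_translationKernel hk x hf.1
  have hfin : ∫⁻ y, ‖f y‖ₑ ^ 2 ∂mu k < ∞ := by
    rw [← eLpNorm_two_sq]; exact ENNReal.pow_lt_top hf.2
  have hlt := (hC x f hf.1).trans_lt (ENNReal.mul_lt_top (ENNReal.pow_lt_top ENNReal.coe_lt_top) hfin)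
  have hae := ae_lt_top' (hm.enorm.pow_const 2).lintegral_prod_right' hlt.ne
  filter_upwards [hae, hm.prodMk_left] with y h1 h2
  refine ⟨h2, ?_⟩
  rw [← eLpNorm_two_sq] at h1
  exact (ENNReal.pow_lt_top_iff.1 h1).resolve_right two_ne_zero

theorem aestronglyMeasurable_dunklTranslation {k : ℝ} (hk : -1 / 2 ≤ k) (x : ℝ) {f : ℝ → ℂ}
    (hf : AEStronglyMeasurable f (mu k)) :
    AEStronglyMeasurable (dunklTranslation k x f) (mu k) := by
  have := isProbabilityMeasure_angularMeasure hk
  rw [show dunklTranslation k x f = fun y => ∫ t, translationKernel f x y t ∂angularMeasure k from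
    funext fun y => dunklTranslation_eq hk x f y]
  exact (aestronglyMeasurable_translationKernel hk x hf).integral_prod_right'

/-- Since the angular measure has mass 1, the square of the mean of the kernel is at most the mean
of its square. -/
theorem exists_eLpNorm_dunklTranslation_le {k : ℝ} (hk : -1 / 2 ≤ k) : ∃ C : NNReal,
    ∀ (x : ℝ) (f : ℝ → ℂ), MemLp f 2 (mu k) →
      eLpNorm (dunklTranslation k x f) 2 (mu k) ≤ C * eLpNorm f 2 (mu k) := by
  have := isProbabilityMeasure_angularMeasure hk
  obtain ⟨C, hC⟩ := exists_lintegral_translationKernel_le hk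
  refine ⟨C, fun x f hf => eLpNorm_two_le_of_lintegral_le (le_trans ?_ (hC x f hf.1))⟩
  refine lintegral_mono_ae ?_
  filter_upwards [ae_memLp_translationKernel hk x hf] with y hy
  rw [dunklTranslation_eq hk, ← eLpNorm_two_sq]
  gcongr
  refine (enorm_integral_le_lintegral_enorm _).trans ?_
  rw [← eLpNorm_one_eq_lintegral_enorm]
  exact eLpNorm_le_eLpNorm_of_exponent_le one_le_two hy.1

theorem memLp_dunklTranslation {k : ℝ} (hk : -1 / 2 ≤ k) (x : ℝ) {f : ℝ → ℂ}
    (hf : MemLp f 2 (mu k)) : MemLp (dunklTranslation k x f) 2 (mu k) := by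
  obtain ⟨C, hC⟩ := exists_eLpNorm_dunklTranslation_le hk
  exact ⟨aestronglyMeasurable_dunklTranslation hk x hf.1,
    (hC x f hf).trans_lt (ENNReal.mul_lt_top ENNReal.coe_lt_top hf.2)⟩

theorem exists_translationOp {k : ℝ} (hk : -1 / 2 ≤ k) (x : ℝ) :
    ∃ A : Lp ℂ 2 (mu k) →L[ℂ] Lp ℂ 2 (mu k),
      ∀ f (hf : MemLp f 2 (mu k)), A (hf.toLp f) =ᵐ[mu k] dunklTranslation k x f := by
  have := isProbabilityMeasure_angularMeasure hk
  obtain ⟨C, hC⟩ := exists_eLpNorm_dunklTranslation_le hk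
  refine exists_clm_of_bound (dunklTranslation k x) C
    (fun f hf => aestronglyMeasurable_dunklTranslation hk x hf.1) (hC x) ?_ ?_
  · intro f g hf hg
    filter_upwards [ae_memLp_translationKernel hk x hf, ae_memLp_translationKernel hk x hg]
      with y h1 h2
    rw [Pi.add_apply, dunklTranslation_eq hk, dunklTranslation_eq hk, dunklTranslation_eq hk,
      ← integral_add (h1.integrable one_le_two) (h2.integrable one_le_two)]
    congr 1
    funext t
    simp only [translationKernel, Pi.add_apply]
    ring
  · intro c f hf
    refine Eventually.of_forall fun y => ?_
    rw [Pi.smul_apply, dunklTranslation_eq hk, dunklTranslation_eq hk, ← integral_smul]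
    congr 1
    funext t
    simp only [translationKernel, Pi.smul_apply, smul_eq_mul]
    ring

/-! ### Translations of Gaussians -/

/-- A² is affine in t, so the Gaussian of A splits as a product of Gaussians in x and y times
exp(-zxyt), whose angular mean is e(-zxy). For odd Gaussians, the factor A cancels the denominator
of (x + y)/A. -/
theorem dunklTranslation_gaussFamily {k : ℝ} (hk : -1 / 2 ≤ k) (x y : ℝ)
    (i : Ioi (0 : ℝ) × Bool) :
    dunklTranslation k x (gaussFamily i) y = (bif i.2 then (x : ℂ) + y else 1) *
      (gauss i.1 x * gauss i.1 y * dexp k (-(i.1 * x : ℝ) * y)) := by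
  rw [dunklTranslation_eq hk, dexp, ← integral_const_mul, ← integral_const_mul]
  refine integral_congr_ae ?_
  filter_upwards [ae_angularMeasure k] with t ht
  have h1 : 0 < 1 + t := by linarith [ht.1]
  have hS2 : (x + y) ^ 2 * (1 + t) ≤ 2 * (x ^ 2 + y ^ 2 + 2 * x * y * t) := by
    nlinarith [mul_nonneg (sub_nonneg.2 ht.2) (sq_nonneg (x - y))]
  have hS : 0 ≤ x ^ 2 + y ^ 2 + 2 * x * y * t := by
    nlinarith [mul_nonneg (sq_nonneg (x + y)) h1.le]
  have hg : ∀ z : ℝ, gauss z √(x ^ 2 + y ^ 2 + 2 * x * y * t)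
      = gauss z x * gauss z y * Complex.exp (-(z * x : ℝ) * y * t) := by
    intro z
    rw [gauss, gauss, gauss, Real.sq_sqrt hS, Complex.ofReal_exp, Complex.ofReal_exp,
      Complex.ofReal_exp, ← Complex.exp_add, ← Complex.exp_add]
    congr 1
    push_cast
    ring
  rcases i with ⟨⟨z, hz⟩, _ | _⟩
  · simp only [translationKernel, gaussFamily, cond_false, one_mul, gauss_neg, hg]
    ring
  · have hA : ((x + y) / √(x ^ 2 + y ^ 2 + 2 * x * y * t)) * √(x ^ 2 + y ^ 2 + 2 * x * y * t)
        = x + y := by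
      rcases hS.eq_or_lt with h | h
      -- If A = 0 then x + y = 0, so the default value of the quotient is harmless.
      · have h0 : (x + y) ^ 2 * (1 + t) ≤ 0 := by rw [← h] at hS2; simpa using hS2
        have h3 : (x + y) ^ 2 = 0 := by nlinarith [sq_nonneg (x + y)]
        rw [pow_eq_zero_iff two_ne_zero] at h3
        rw [h3, zero_div, zero_mul]
      · exact div_mul_cancel₀ _ (Real.sqrt_pos.2 h).ne'
    have hA' : (((x + y) / √(x ^ 2 + y ^ 2 + 2 * x * y * t) : ℝ) : ℂ) *
        (√(x ^ 2 + y ^ 2 + 2 * x * y * t) : ℝ) = x + y := by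
      rw [← Complex.ofReal_mul, hA]; push_cast; ring
    simp only [translationKernel, gaussFamily, cond_true, gauss_neg, hg, Complex.ofReal_neg]
    rw [← hA']
    ring

theorem exp_sq_div_dual {z w : ℝ} (hz : 0 < z) (hw : 0 < w) (x : ℝ) :
    gauss z x * Complex.exp ((-(z * x : ℝ)) ^ 2 / (2 * (z + w⁻¹ : ℝ)))
      = Complex.exp ((Complex.I * x) ^ 2 / (2 * (w + z⁻¹ : ℝ))) := by
  have hz' : (z : ℂ) ≠ 0 := by exact_mod_cast hz.ne'
  have hw' : (w : ℂ) ≠ 0 := by exact_mod_cast hw.ne'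
  have h1 : (z * w + 1 : ℂ) ≠ 0 := by exact_mod_cast (by positivity : z * w + 1 ≠ 0)
  have e1 : (z + (w : ℂ)⁻¹) = (z * w + 1) / w := by field_simp
  have e2 : (w + (z : ℂ)⁻¹) = (z * w + 1) / z := by field_simp
  rw [gauss, Complex.ofReal_exp, ← Complex.exp_add]
  congr 1
  push_cast
  rw [e1, e2, mul_pow, Complex.I_sq]
  field_simp
  ring

theorem rpow_mul_dual {z w : ℝ} (hz : 0 < z) (hw : 0 < w) (r : ℝ) :
    w ^ r * (z + w⁻¹) ^ r = z ^ r * (w + z⁻¹) ^ r := by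
  rw [← Real.mul_rpow hw.le (by positivity), ← Real.mul_rpow hz.le (by positivity)]
  congr 1
  field_simp

/-- The weak form, tested on Gaussians, of the rule that F turns T_x into multiplication by E_k(ix,
l). Both sides are explicit Gaussian integrals, with parameters z + 1/w and w + 1/z; these are (zw +
1)/w and (zw + 1)/z, which makes the two values equal in each of the four parities. -/
theorem integral_dunklTranslation_gaussFamily {k : ℝ} (hk : -1 / 2 ≤ k) (x : ℝ)
    (i j : Ioi (0 : ℝ) × Bool) :
    ∫ y, dunklTranslation k x (gaussFamily i) y * dunklF k (gaussFamily j) y ∂mu k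
      = ∫ l, dexp k (Complex.I * x * l) * dunklF k (gaussFamily i) l * gaussFamily j l ∂mu k := by
  rcases i with ⟨⟨z, hz⟩, a⟩
  rcases j with ⟨⟨w, hw⟩, b⟩
  have hz : 0 < z := hz
  have hw : 0 < w := hw
  have hZ : 0 < z + w⁻¹ := by positivity
  have hW : 0 < w + z⁻¹ := by positivity
  have hz' : (z : ℂ) ≠ 0 := by exact_mod_cast hz.ne'
  have hw' : (w : ℂ) ≠ 0 := by exact_mod_cast hw.ne'
  have h1 : (z * w + 1 : ℂ) ≠ 0 := by exact_mod_cast (by positivity : z * w + 1 ≠ 0)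
  have e1 : (z + (w : ℂ)⁻¹) = (z * w + 1) / w := by field_simp
  have e2 : (w + (z : ℂ)⁻¹) = (z * w + 1) / z := by field_simp
  set q : ℂ := -(z * x : ℝ) with hq
  set E : ℂ := Complex.exp ((Complex.I * x) ^ 2 / (2 * (w + z⁻¹ : ℝ))) with hE
  set N : ℂ := ((z ^ (-(k + 1)) * (w + z⁻¹) ^ (-(k + 1)) : ℝ) : ℂ) with hN
  have hN' : ((w ^ (-(k + 1)) : ℝ) : ℂ) * (((z + w⁻¹) ^ (-(k + 1)) : ℝ) : ℂ) = N := by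
    rw [hN, ← rpow_mul_dual hz hw]; push_cast; ring
  have hN2 : ((z ^ (-(k + 1)) : ℝ) : ℂ) * (((w + z⁻¹) ^ (-(k + 1)) : ℝ) : ℂ) = N := by
    rw [hN]; push_cast; ring
  have hEq : gauss z x * Complex.exp (q ^ 2 / (2 * (z + w⁻¹ : ℝ))) = E :=
    exp_sq_div_dual hz hw x
  have hL0 := integral_gauss_mul_dexp hk hZ q
  have hL1 := integral_mul_gauss_mul_dexp hk hZ q
  have hL2 := integral_sq_mul_gauss_mul_dexp hk hZ q
  have hR0 := integral_gauss_mul_dexp hk hW (Complex.I * x)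
  have hR1 := integral_mul_gauss_mul_dexp hk hW (Complex.I * x)
  have hR2 := integral_sq_mul_gauss_mul_dexp hk hW (Complex.I * x)
  have i0 := integrable_pow_mul_gauss_mul_dexp hk hZ 0 q
  have i1 := integrable_pow_mul_gauss_mul_dexp hk hZ 1 q
  have i2 := integrable_pow_mul_gauss_mul_dexp hk hZ 2 q
  rw [← hE] at hR0 hR1 hR2
  set X : ℂ := Complex.exp (q ^ 2 / (2 * (z + w⁻¹ : ℝ))) with hX
  simp only [pow_zero, pow_one, one_mul] at i0 i1
  have gZ : ∀ y : ℝ, gauss z y * gauss w⁻¹ y = gauss (z + w⁻¹) y := gauss_mul_gauss _ _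
  have gW : ∀ y : ℝ, gauss w y * gauss z⁻¹ y = gauss (w + z⁻¹) y := gauss_mul_gauss _ _
  rw [dunklF_gaussFamily hk, dunklF_gaussFamily hk]
  simp only [dunklTranslation_gaussFamily hk]
  rcases a with _ | _ <;> rcases b with _ | _ <;>
    simp only [gaussFamily, gaussFactor, dualIndex, cond_true, cond_false, one_mul]
  · have l : ∀ y : ℝ, gauss z x * gauss z y * dexp k (-(z * x : ℝ) * y)
        * ((w ^ (-(k + 1)) : ℝ) * gauss w⁻¹ y)
        = ((w ^ (-(k + 1)) : ℝ) * gauss z x) * (gauss (z + w⁻¹) y * dexp k (q * y)) := by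
      intro y; rw [← gZ]; ring
    have r : ∀ y : ℝ, dexp k (Complex.I * x * y) * ((z ^ (-(k + 1)) : ℝ) * gauss z⁻¹ y) * gauss w y
        = ((z ^ (-(k + 1)) : ℝ) : ℂ) * (gauss (w + z⁻¹) y * dexp k (Complex.I * x * y)) := by
      intro y; rw [← gW]; ring
    simp only [l, r]
    rw [integral_const_mul, integral_const_mul, hL0, hR0]
    linear_combination (gauss z x * X) * hN' + N * hEq - E * hN2
  · have l : ∀ y : ℝ, gauss z x * gauss z y * dexp k (-(z * x : ℝ) * y)
        * (-Complex.I / w * (w ^ (-(k + 1)) : ℝ) * (y * gauss w⁻¹ y))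
        = (-Complex.I / w * ((w ^ (-(k + 1)) : ℝ) * gauss z x))
          * (y * gauss (z + w⁻¹) y * dexp k (q * y)) := by
      intro y; rw [← gZ]; ring
    have r : ∀ y : ℝ, dexp k (Complex.I * x * y) * ((z ^ (-(k + 1)) : ℝ) * gauss z⁻¹ y)
        * (y * gauss w y)
        = ((z ^ (-(k + 1)) : ℝ) : ℂ) * (y * gauss (w + z⁻¹) y * dexp k (Complex.I * x * y)) := by
      intro y; rw [← gW]; ring
    simp only [l, r]
    rw [integral_const_mul, integral_const_mul, hL1, hR1]
    have hc : -Complex.I / w * (q / (z + w⁻¹ : ℝ)) = Complex.I * x / (w + z⁻¹ : ℝ) := by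
      rw [hq]; push_cast; rw [e1, e2]; field_simp
    linear_combination (-Complex.I / w * (q / (z + w⁻¹ : ℝ))) *
      ((gauss z x * X) * hN' + N * hEq) + N * E * hc - (Complex.I * x / (w + z⁻¹ : ℝ)) * E * hN2
  · have l : ∀ y : ℝ, ((x : ℂ) + y) * (gauss z x * gauss z y * dexp k (-(z * x : ℝ) * y))
        * ((w ^ (-(k + 1)) : ℝ) * gauss w⁻¹ y)
        = ((w ^ (-(k + 1)) : ℝ) * gauss z x * x) * (gauss (z + w⁻¹) y * dexp k (q * y))
          + ((w ^ (-(k + 1)) : ℝ) * gauss z x) * (y * gauss (z + w⁻¹) y * dexp k (q * y)) := by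
      intro y; rw [← gZ]; ring
    have r : ∀ y : ℝ, dexp k (Complex.I * x * y) *
        (-Complex.I / z * (z ^ (-(k + 1)) : ℝ) * (y * gauss z⁻¹ y)) * gauss w y
        = (-Complex.I / z * ((z ^ (-(k + 1)) : ℝ) : ℂ)) *
          (y * gauss (w + z⁻¹) y * dexp k (Complex.I * x * y)) := by
      intro y; rw [← gW]; ring
    simp only [l, r]
    rw [integral_add (i0.const_mul _) (i1.const_mul _), integral_const_mul, integral_const_mul,
      integral_const_mul, hL0, hL1, hR1]
    have hc : x + q / (z + w⁻¹ : ℝ) = -Complex.I / z * (Complex.I * x / (w + z⁻¹ : ℝ)) := by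
      rw [hq]; push_cast; rw [e1, e2]; field_simp; rw [Complex.I_sq]; ring
    linear_combination (x + q / (z + w⁻¹ : ℝ)) * ((gauss z x * X) * hN' + N * hEq) + N * E * hc
      - (-Complex.I / z * (Complex.I * x / (w + z⁻¹ : ℝ))) * E * hN2
  · have l : ∀ y : ℝ, ((x : ℂ) + y) * (gauss z x * gauss z y * dexp k (-(z * x : ℝ) * y))
        * (-Complex.I / w * (w ^ (-(k + 1)) : ℝ) * (y * gauss w⁻¹ y))
        = (-Complex.I / w * ((w ^ (-(k + 1)) : ℝ) * gauss z x) * x)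
            * (y * gauss (z + w⁻¹) y * dexp k (q * y))
          + (-Complex.I / w * ((w ^ (-(k + 1)) : ℝ) * gauss z x))
            * (y ^ 2 * gauss (z + w⁻¹) y * dexp k (q * y)) := by
      intro y; rw [← gZ]; ring
    have r : ∀ y : ℝ, dexp k (Complex.I * x * y) *
        (-Complex.I / z * (z ^ (-(k + 1)) : ℝ) * (y * gauss z⁻¹ y)) * (y * gauss w y)
        = (-Complex.I / z * ((z ^ (-(k + 1)) : ℝ) : ℂ)) *
          (y ^ 2 * gauss (w + z⁻¹) y * dexp k (Complex.I * x * y)) := by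
      intro y; rw [← gW]; ring
    simp only [l, r]
    rw [integral_add (i1.const_mul _) (i2.const_mul _), integral_const_mul, integral_const_mul,
      integral_const_mul, hL1, hL2, hR2]
    have hc : -Complex.I / w * (x * (q / (z + w⁻¹ : ℝ)) + (2 * (k + 1) / (z + w⁻¹ : ℝ)
          + q ^ 2 / (z + w⁻¹ : ℝ) ^ 2))
        = -Complex.I / z * (2 * (k + 1) / (w + z⁻¹ : ℝ)
          + (Complex.I * x) ^ 2 / (w + z⁻¹ : ℝ) ^ 2) := by
      rw [hq, mul_pow, Complex.I_sq]; push_cast; rw [e1, e2]; field_simp; ring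
    linear_combination (-Complex.I / w * (x * (q / (z + w⁻¹ : ℝ)) + (2 * (k + 1) / (z + w⁻¹ : ℝ)
          + q ^ 2 / (z + w⁻¹ : ℝ) ^ 2))) * ((gauss z x * X) * hN' + N * hEq) + N * E * hc
      - (-Complex.I / z * (2 * (k + 1) / (w + z⁻¹ : ℝ)
          + (Complex.I * x) ^ 2 / (w + z⁻¹ : ℝ) ^ 2)) * E * hN2

theorem memLp_dexp_mul {k : ℝ} (hk : -1 / 2 ≤ k) (x : ℝ) {f : ℝ → ℂ} (hf : MemLp f 2 (mu k)) :
    MemLp (fun l : ℝ => dexp k (Complex.I * x * l) * f l) 2 (mu k) := by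
  have := continuous_dexp hk
  refine hf.of_le_mul (c := 1) ((by fun_prop : Continuous fun l : ℝ =>
    dexp k (Complex.I * x * l)).aestronglyMeasurable.mul hf.1) (Eventually.of_forall fun l => ?_)
  rw [norm_mul]
  exact mul_le_mul_of_nonneg_right (norm_dexp_I_le hk x l) (norm_nonneg _)

theorem exists_dexpMulOp {k : ℝ} (hk : -1 / 2 ≤ k) (x : ℝ) :
    ∃ A : Lp ℂ 2 (mu k) →L[ℂ] Lp ℂ 2 (mu k), ∀ f (hf : MemLp f 2 (mu k)),
      A (hf.toLp f) =ᵐ[mu k] fun l => dexp k (Complex.I * x * l) * f l := by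
  refine exists_clm_of_bound (fun f (l : ℝ) => dexp k (Complex.I * x * l) * f l) 1
    (fun f hf => (memLp_dexp_mul hk x hf).1) (fun f hf => ?_) (fun f g _ _ => ?_)
    (fun c f _ => ?_)
  · rw [ENNReal.coe_one, one_mul]
    refine eLpNorm_mono fun l => ?_
    rw [norm_mul]
    exact mul_le_of_le_one_left (norm_nonneg _) (norm_dexp_I_le hk x l)
  · exact Eventually.of_forall fun l => by simp [mul_add]
  · exact Eventually.of_forall fun l => by simp [mul_left_comm]

theorem dunklL2_translation_gaussFamily {k : ℝ} (hk : -1 / 2 ≤ k) (x : ℝ)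
    (i : Ioi (0 : ℝ) × Bool) :
    dunklL2 hk ((memLp_dunklTranslation hk x (memLp_gaussFamily hk i)).toLp _)
      =ᵐ[mu k] fun l => dexp k (Complex.I * x * l) * dunklF k (gaussFamily i) l := by
  have hm := memLp_dexp_mul hk x (memLp_dunklF hk (memLp_gaussFamily hk i) (integrable_gaussFamily hk i))
  have hi1 : ∀ j, Integrable (fun l => dunklL2 hk
      ((memLp_dunklTranslation hk x (memLp_gaussFamily hk i)).toLp _) l * gaussFamily j l) (mu k) :=
    fun j => integrable_mul_of_memLp (Lp.memLp _) (memLp_gaussFamily hk j)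
  have hi2 := fun j => integrable_mul_of_memLp hm (memLp_gaussFamily hk j)
  have := ae_eq_zero_of_integral_gaussFamily hk (g := fun l : ℝ => dunklL2 hk
      ((memLp_dunklTranslation hk x (memLp_gaussFamily hk i)).toLp _) l -
      dexp k (Complex.I * x * l) * dunklF k (gaussFamily i) l) ?_ ?_
  · filter_upwards [this] with l hl using sub_eq_zero.1 hl
  · intro j
    simp only [sub_mul]
    exact (hi1 j).sub (hi2 j)
  · intro j
    simp only [sub_mul]
    rw [integral_sub (hi1 j) (hi2 j), integral_dunklL2_mul_gaussFamily, sub_eq_zero,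
      ← integral_dunklTranslation_gaussFamily hk]
    refine integral_congr_ae ?_
    filter_upwards [(memLp_dunklTranslation hk x (memLp_gaussFamily hk i)).coeFn_toLp] with y hy
    rw [hy]

/-- Both sides are bounded operators on L² applied to f, and they agree on Gaussians. -/
theorem dunklL2_translation {k : ℝ} (hk : -1 / 2 ≤ k) (x : ℝ) {f : ℝ → ℂ}
    (hf : MemLp f 2 (mu k)) :
    dunklL2 hk ((memLp_dunklTranslation hk x hf).toLp _)
      =ᵐ[mu k] fun l => dexp k (Complex.I * x * l) * dunklL2 hk (hf.toLp f) l := by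
  obtain ⟨A, hA⟩ := exists_translationOp hk x
  obtain ⟨B, hB⟩ := exists_dexpMulOp hk x
  have hAB : (dunklL2 hk).toContinuousLinearMap.comp A
      = B.comp (dunklL2 hk).toContinuousLinearMap := by
    refine ContinuousLinearMap.ext_on (dense_span_gaussLp hk) ?_
    rintro _ ⟨i, rfl⟩
    have hi := memLp_gaussFamily hk i
    have h1 : A (gaussLp hk i) = (memLp_dunklTranslation hk x hi).toLp _ :=
      Lp.ext ((hA _ hi).trans (MemLp.coeFn_toLp _).symm)
    have h2 : dunklL2 hk (gaussLp hk i)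
        = (memLp_dunklF hk hi (integrable_gaussFamily hk i)).toLp _ :=
      Lp.ext ((dunklL2_toLp hk hi (integrable_gaussFamily hk i)).trans (MemLp.coeFn_toLp _).symm)
    simp only [ContinuousLinearMap.comp_apply, LinearIsometry.coe_toContinuousLinearMap]
    rw [h1, h2]
    exact Lp.ext ((dunklL2_translation_gaussFamily hk x i).trans
      (hB _ (memLp_dunklF hk hi (integrable_gaussFamily hk i))).symm)
  have h1 : A (hf.toLp f) = (memLp_dunklTranslation hk x hf).toLp _ :=
    Lp.ext ((hA _ hf).trans (MemLp.coeFn_toLp _).symm)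
  have h2 := congrArg (fun T => T (hf.toLp f)) hAB
  simp only [ContinuousLinearMap.comp_apply, LinearIsometry.coe_toContinuousLinearMap, h1] at h2
  rw [h2]
  have h3 := hB _ (Lp.memLp (dunklL2 hk (hf.toLp f)))
  rwa [Lp.toLp_coeFn] at h3

/-! ### Recognizing Schwartz functions -/

theorem contDiff_and_iteratedDeriv_of_hasDerivAt {u : ℕ → ℝ → ℂ}
    (h : ∀ n x, HasDerivAt (u n) (u (n + 1) x) x) :
    ContDiff ℝ (⊤ : ℕ∞) (u 0) ∧ ∀ n, iteratedDeriv n (u 0) = u n := by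
  have h1 : ∀ n, iteratedDeriv n (u 0) = u n := by
    intro n
    induction n with
    | zero => exact iteratedDeriv_zero
    | succ n ih => rw [iteratedDeriv_succ, ih]; funext x; exact (h n x).deriv
  exact ⟨contDiff_of_differentiable_iteratedDeriv fun m _ x => by
    rw [h1]; exact (h m x).differentiableAt, h1⟩

theorem hasDerivAt_iteratedDeriv {u : ℝ → ℂ} (hu : ContDiff ℝ (⊤ : ℕ∞) u) (n : ℕ) (x : ℝ) :
    HasDerivAt (iteratedDeriv n u) (iteratedDeriv (n + 1) u x) x := by
  rw [iteratedDeriv_succ]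
  exact ((hu.differentiable_iteratedDeriv n (by exact_mod_cast ENat.natCast_lt_top n)) x).hasDerivAt

theorem iteratedDeriv_succ_id_mul {u : ℝ → ℂ} (hu : ContDiff ℝ (⊤ : ℕ∞) u) (n : ℕ) :
    iteratedDeriv (n + 1) (fun x : ℝ => (x : ℂ) * u x)
      = fun x : ℝ => x * iteratedDeriv (n + 1) u x + (n + 1) * iteratedDeriv n u x := by
  -- At n = 0 the truncated index n - 1 is harmless, as its term carries the factor n.
  have key : ∀ n (x : ℝ), HasDerivAt (fun x : ℝ => x * iteratedDeriv n u x + n * iteratedDeriv (n - 1) u x)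
      (x * iteratedDeriv (n + 1) u x + (n + 1 : ℕ) * iteratedDeriv n u x) x := by
    intro n x
    have h1 := (hasDerivAt_id x).ofReal_comp.mul (hasDerivAt_iteratedDeriv hu n x)
    rcases n with _ | n
    · convert! h1 using 1
      · funext y; simp
      · simp; ring
    · convert! h1.add ((hasDerivAt_iteratedDeriv hu n x).const_mul ((n + 1 : ℕ) : ℂ)) using 1
      simp; ring
  have h0 := (contDiff_and_iteratedDeriv_of_hasDerivAt (u := fun n (x : ℝ) =>
    x * iteratedDeriv n u x + n * iteratedDeriv (n - 1) u x) key).2 (n + 1)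
  simpa using h0

/-- The Leibniz rule expresses x u⁽ⁿ⁾ through (xu)⁽ⁿ⁾ and a lower derivative of u. So u gains one
order of decay whenever xu has the current one; this is the induction step for proving Schwartz
decay. -/
theorem exists_pow_succ_mul_iteratedDeriv_le {u w : ℝ → ℂ} (hu : ContDiff ℝ (⊤ : ℕ∞) u)
    (hw : ∀ x : ℝ, w x = x * u x) (m : ℕ)
    (bu : ∀ n, ∃ C, ∀ x, |x| ^ m * ‖iteratedDeriv n u x‖ ≤ C)
    (bw : ∀ n, ∃ C, ∀ x, |x| ^ m * ‖iteratedDeriv n w x‖ ≤ C) (n : ℕ) :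
    ∃ C, ∀ x, |x| ^ (m + 1) * ‖iteratedDeriv n u x‖ ≤ C := by
  obtain rfl : w = fun x : ℝ => (x : ℂ) * u x := funext hw
  obtain ⟨C, hC⟩ := bw n
  rcases n with _ | n
  · refine ⟨C, fun x => le_trans (le_of_eq ?_) (hC x)⟩
    simp only [iteratedDeriv_zero, norm_mul, Complex.norm_real, Real.norm_eq_abs]
    ring
  · obtain ⟨D, hD⟩ := bu n
    refine ⟨C + (n + 1) * D, fun x => ?_⟩
    have h1 := hC x
    rw [iteratedDeriv_succ_id_mul hu] at h1
    have h2 : (x : ℂ) * iteratedDeriv (n + 1) u x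
        = (x * iteratedDeriv (n + 1) u x + (n + 1) * iteratedDeriv n u x)
          - (n + 1) * iteratedDeriv n u x := by ring
    have h3 : |x| * ‖iteratedDeriv (n + 1) u x‖
        ≤ ‖x * iteratedDeriv (n + 1) u x + (n + 1) * iteratedDeriv n u x‖
          + (n + 1) * ‖iteratedDeriv n u x‖ := by
      have h4 := norm_sub_le (x * iteratedDeriv (n + 1) u x + (n + 1) * iteratedDeriv n u x)
        ((n + 1) * iteratedDeriv n u x)
      rw [← h2, norm_mul, norm_mul, Complex.norm_real, Real.norm_eq_abs] at h4
      have h5 : ‖(n + 1 : ℂ)‖ = n + 1 := by exact_mod_cast Complex.norm_natCast (n + 1)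
      rwa [h5] at h4
    calc |x| ^ (m + 1) * ‖iteratedDeriv (n + 1) u x‖
        = |x| ^ m * (|x| * ‖iteratedDeriv (n + 1) u x‖) := by ring
      _ ≤ |x| ^ m * (‖x * iteratedDeriv (n + 1) u x + (n + 1) * iteratedDeriv n u x‖
          + (n + 1) * ‖iteratedDeriv n u x‖) := by gcongr
      _ = |x| ^ m * ‖x * iteratedDeriv (n + 1) u x + (n + 1) * iteratedDeriv n u x‖
          + (n + 1) * (|x| ^ m * ‖iteratedDeriv n u x‖) := by ring
      _ ≤ _ := by
          have := hD x
          gcongr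

theorem exists_abs_pow_mul_iteratedDeriv_le (φ : 𝓢(ℝ, ℂ)) (m n : ℕ) :
    ∃ C, ∀ x, |x| ^ m * ‖iteratedDeriv n φ x‖ ≤ C := by
  obtain ⟨C, -, hC⟩ := φ.decay m n
  refine ⟨C, fun x => ?_⟩
  simpa [norm_iteratedFDeriv_eq_norm_iteratedDeriv] using hC x

theorem exists_schwartz_eq {u : ℝ → ℂ} (hu : ContDiff ℝ (⊤ : ℕ∞) u)
    (b : ∀ m n, ∃ C, ∀ x, |x| ^ m * ‖iteratedDeriv n u x‖ ≤ C) :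
    ∃ φ : 𝓢(ℝ, ℂ), ∀ x, φ x = u x :=
  ⟨⟨u, hu, fun m n => by
    obtain ⟨C, hC⟩ := b m n
    exact ⟨C, fun x => by
      simpa [norm_iteratedFDeriv_eq_norm_iteratedDeriv] using hC x⟩⟩, fun _ => rfl⟩

/-! ### The Dunkl operator on Schwartz functions -/

/-- The difference quotient `(φ(x) - φ(-x)) / (2x)` is a Schwartz function. -/
theorem exists_schwartz_oddQuotient (φ : 𝓢(ℝ, ℂ)) :
    ∃ q : 𝓢(ℝ, ℂ), ∀ x : ℝ, x * q x = (φ x - φ (-x)) / 2 := by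
  have hφ : ContDiff ℝ (⊤ : ℕ∞) φ := φ.smooth ⊤
  -- The quotient is ½ ∫ φ'(xt) dt over [-1, 1], which is smooth across x = 0; Q n is its n-th
  -- derivative.
  set Q : ℕ → ℝ → ℂ := fun n x =>
    2⁻¹ * ∫ t in (-1 : ℝ)..1, (t : ℂ) ^ n * iteratedDeriv (n + 1) φ (x * t) with hQ
  have hcont : ∀ n, Continuous (iteratedDeriv n φ) := fun n =>
    continuous_iff_continuousAt.2 fun x => (hasDerivAt_iteratedDeriv hφ n x).continuousAt
  have hpow : ∀ (n : ℕ) {t : ℝ}, t ∈ uIoc (-1 : ℝ) 1 → ‖(t : ℂ) ^ n‖ ≤ 1 := by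
    intro n t ht
    rw [uIoc_of_le (by norm_num)] at ht
    rw [norm_pow, Complex.norm_real, Real.norm_eq_abs]
    exact pow_le_one₀ (abs_nonneg _) (abs_le.2 ⟨ht.1.le, ht.2⟩)
  have hbd : ∀ n, ∃ C, ∀ x, ‖iteratedDeriv n φ x‖ ≤ C := fun n => by
    simpa using exists_abs_pow_mul_iteratedDeriv_le φ 0 n
  have hd : ∀ n x, HasDerivAt (Q n) (Q (n + 1) x) x := by
    intro n x
    obtain ⟨C, hC⟩ := hbd (n + 2)
    have h1 := hcont (n + 1)
    have h2 := hcont (n + 2)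
    refine HasDerivAt.const_mul _ (intervalIntegral.hasDerivAt_integral_of_dominated_loc_of_deriv_le
      (F := fun (x t : ℝ) => (t : ℂ) ^ n * iteratedDeriv (n + 1) φ (x * t))
      (F' := fun (x t : ℝ) => (t : ℂ) ^ (n + 1) * iteratedDeriv (n + 2) φ (x * t))
      (bound := fun _ => C) univ_mem ?_ ?_ ?_ ?_ intervalIntegrable_const ?_).2
    · exact Eventually.of_forall fun y => (by fun_prop : Continuous _).aestronglyMeasurable
    · exact (by fun_prop : Continuous _).intervalIntegrable _ _
    · exact (by fun_prop : Continuous _).aestronglyMeasurable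
    · refine Eventually.of_forall fun t ht y _ => ?_
      rw [norm_mul]
      exact (mul_le_of_le_one_left (norm_nonneg _) (hpow _ ht)).trans (hC _)
    · refine Eventually.of_forall fun t ht y _ => ?_
      have h3 : HasDerivAt (fun y : ℝ => y * t) t y := by simpa using (hasDerivAt_id y).mul_const t
      have h4 := ((hasDerivAt_iteratedDeriv hφ (n + 1) (y * t)).scomp y h3).const_mul ((t : ℂ) ^ n)
      convert! h4 using 1
      rw [Complex.real_smul]; ring
  obtain ⟨hs, hi⟩ := contDiff_and_iteratedDeriv_of_hasDerivAt hd
  have hx : ∀ x : ℝ, x * Q 0 x = (φ x - φ (-x)) / 2 := by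
    intro x
    have h1 : ∀ t ∈ uIcc (-1 : ℝ) 1, HasDerivAt (fun t : ℝ => φ (x * t))
        (x * iteratedDeriv 1 φ (x * t)) t := by
      intro t _
      have h3 : HasDerivAt (fun t : ℝ => x * t) x t := by simpa using (hasDerivAt_id t).const_mul x
      have h4 := (hasDerivAt_iteratedDeriv hφ 0 (x * t)).scomp t h3
      simp only [iteratedDeriv_zero, zero_add] at h4
      convert! h4 using 1
    have h5 := hcont 1
    have h2 := intervalIntegral.integral_eq_sub_of_hasDerivAt h1
      ((by fun_prop : Continuous fun t : ℝ => (x : ℂ) * iteratedDeriv 1 φ (x * t)).intervalIntegrable _ _)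
    rw [intervalIntegral.integral_const_mul] at h2
    simp only [hQ, pow_zero, one_mul, zero_add]
    rw [mul_left_comm, h2, mul_one, mul_neg, mul_one]
    ring
  have h0 : ∀ n, ∃ C, ∀ x, |x| ^ 0 * ‖iteratedDeriv n (Q 0) x‖ ≤ C := by
    intro n
    obtain ⟨C, hC⟩ := hbd (n + 1)
    refine ⟨2⁻¹ * (C * |1 - (-1)|), fun x => ?_⟩
    rw [hi, pow_zero, one_mul]
    simp only [hQ]
    rw [norm_mul, norm_inv, Complex.norm_ofNat]
    gcongr
    refine intervalIntegral.norm_integral_le_of_norm_le_const fun t ht => ?_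
    rw [norm_mul]
    exact (mul_le_of_le_one_left (norm_nonneg _) (hpow _ ht)).trans (hC _)
  set o : 𝓢(ℝ, ℂ) := (2⁻¹ : ℂ) • (φ - compCLMOfContinuousLinearEquiv ℂ
    (ContinuousLinearEquiv.neg ℝ (M := ℝ)) φ) with ho
  have hox : ∀ x : ℝ, o x = x * Q 0 x := by
    intro x
    rw [hx, ho]
    simp [compCLMOfContinuousLinearEquiv_apply]
    ring
  -- x times the quotient is the odd part of φ, a Schwartz function, so decay is gained one power at
  -- a time.
  have hdec : ∀ m n, ∃ C, ∀ x, |x| ^ m * ‖iteratedDeriv n (Q 0) x‖ ≤ C := by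
    intro m
    induction m with
    | zero => exact h0
    | succ m ih =>
      exact exists_pow_succ_mul_iteratedDeriv_le hs hox m ih
        fun n => exists_abs_pow_mul_iteratedDeriv_le o m n
  obtain ⟨q, hq⟩ := exists_schwartz_eq hs hdec
  exact ⟨q, fun x => by rw [hq, hx]⟩

/-- ψ is the Dunkl operator applied to φ, that is φ' + (2k + 1) times the odd quotient. The relation
is multiplied by x to avoid dividing at the origin. -/
theorem exists_schwartz_dunklOperator (k : ℝ) (φ : 𝓢(ℝ, ℂ)) :
    ∃ ψ : 𝓢(ℝ, ℂ), ∀ x : ℝ, x * ψ x = x * deriv φ x + (2 * k + 1) / 2 * (φ x - φ (-x)) := by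
  obtain ⟨q, hq⟩ := exists_schwartz_oddQuotient φ
  refine ⟨derivCLM ℂ ℂ φ + (2 * k + 1 : ℂ) • q, fun x => ?_⟩
  rw [add_apply, smul_apply, derivCLM_apply, smul_eq_mul, mul_add, mul_left_comm, hq]
  ring

/-! ### The Dunkl transform of Schwartz functions -/

theorem SchwartzMap.integrable_mu {k : ℝ} (hk : -1 / 2 ≤ k) (φ : 𝓢(ℝ, ℂ)) : Integrable φ (mu k) :=
  have := hasTemperateGrowth_mu hk
  φ.integrable

theorem SchwartzMap.memLp_mu {k : ℝ} (hk : -1 / 2 ≤ k) (φ : 𝓢(ℝ, ℂ)) : MemLp φ 2 (mu k) :=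
  have := hasTemperateGrowth_mu hk
  φ.memLp 2 (mu k)

theorem hasDerivAt_dexp_mul {k : ℝ} (hk : -1 / 2 ≤ k) (n : ℕ) (c : ℂ) (x : ℝ) :
    HasDerivAt (fun x : ℝ => dexpDeriv k n (c * x)) (c * dexpDeriv k (n + 1) (c * x)) x := by
  have h1 : HasDerivAt (fun x : ℝ => c * (x : ℂ)) c x := by
    simpa using (hasDerivAt_id x).ofReal_comp.const_mul c
  have h2 := (hasDerivAt_dexpDeriv hk n (c * x)).comp x h1
  rwa [mul_comm]

/-- Integration by parts: the Dunkl operator is skew-symmetric. -/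
theorem dunklF_dunklOperator {k : ℝ} (hk : -1 / 2 ≤ k) {φ ψ : 𝓢(ℝ, ℂ)}
    (hψ : ∀ x : ℝ, x * ψ x = x * deriv φ x + (2 * k + 1) / 2 * (φ x - φ (-x))) (l : ℝ) :
    dunklF k ψ l = Complex.I * l * dunklF k φ l := by
  set η : ℝ → ℂ := fun x => dexp k (-Complex.I * l * x) with hη
  set η' : ℝ → ℂ := fun x => -Complex.I * l * dexpDeriv k 1 (-Complex.I * l * x) with hη'
  have hηd : ∀ x, HasDerivAt η (η' x) x := by
    intro x
    have := hasDerivAt_dexp_mul hk 0 (-Complex.I * l) x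
    simpa only [dexpDeriv_zero] using this
  have hηT : ∀ x : ℝ, x * η' x + (2 * k + 1) / 2 * (η x - η (-x)) = -Complex.I * l * x * η x := by
    intro x
    have := dexp_sub_dexp_neg hk (-Complex.I * l * x)
    simp only [hη, hη', Complex.ofReal_neg, mul_neg]
    rw [← this]; ring
  have hφd : ∀ x, HasDerivAt φ (deriv φ x) x := fun x => φ.differentiableAt.hasDerivAt
  set c : ℝ := 2 ^ (k + 1) * Real.Gamma (k + 1) with hc
  -- The claim is that H has integral zero. Folded onto the half-line, H times the density is up to
  -- a constant the derivative of x^(2k+1) (φη(x) - φη(-x)), the function G below; the reflection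
  -- terms of the two Dunkl operators combine into that derivative.
  set H : ℝ → ℂ := fun x => ψ x * η x - Complex.I * l * (φ x * η x) with hH
  have iψ := integrable_mul_dexp hk (SchwartzMap.integrable_mu hk ψ) l
  have iφ := integrable_mul_dexp hk (SchwartzMap.integrable_mu hk φ) l
  have iH : Integrable H (mu k) := iψ.sub (iφ.const_mul _)
  have iH' := (integrable_mu_iff hk).1 iH
  have iφ' := (integrable_mu_iff hk).1 iφ
  set f : ℝ → ℂ := fun x => φ x * η x - φ (-x) * η (-x) with hf
  set f' : ℝ → ℂ := fun x => (deriv φ x * η x + φ x * η' x) +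
    (deriv φ (-x) * η (-x) + φ (-x) * η' (-x)) with hf'
  have hfd : ∀ x, HasDerivAt f (f' x) x := by
    intro x
    have h1 := (hφd x).mul (hηd x)
    have h2 := ((hφd (-x)).mul (hηd (-x))).scomp x (hasDerivAt_neg x)
    convert! h1.sub h2 using 1
    simp only [hf', neg_smul, one_smul]; ring
  set G : ℝ → ℂ := fun x => ((x ^ (2 * k + 1) : ℝ) : ℂ) * f x with hG
  set G' : ℝ → ℂ := fun x => ((x ^ (2 * k + 1) : ℝ) : ℂ) * (f' x + (2 * k + 1) / x * f x) with hG'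
  have hGd : ∀ x ∈ Ioi (0 : ℝ), HasDerivAt G (G' x) x := by
    intro x hx
    have hx : 0 < x := hx
    have hx' : (x : ℂ) ≠ 0 := by exact_mod_cast hx.ne'
    have h1 := (Real.hasDerivAt_rpow_const (p := 2 * k + 1) (Or.inl hx.ne')).ofReal_comp.mul (hfd x)
    convert! h1 using 1
    simp only [hG']
    rw [Real.rpow_sub_one hx.ne']
    push_cast
    field_simp
    ring
  have hdens : ∀ x ∈ Ioi (0 : ℝ), muDensity k x = x ^ (2 * k + 1) / c := by
    intro x hx
    rw [muDensity, abs_of_pos hx]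
  have hc0 : c ≠ 0 := by
    have : 0 < k + 1 := by linarith
    have := Real.Gamma_pos_of_pos this
    positivity
  have hc' : (c : ℂ) ≠ 0 := by exact_mod_cast hc0
  have hGH : ∀ x ∈ Ioi (0 : ℝ), G' x
      = c * (muDensity k x • H x + muDensity k (-x) • H (-x)) := by
    intro x hx
    rw [muDensity_neg, hdens x hx]
    have hx : 0 < x := hx
    have hx' : (x : ℂ) ≠ 0 := by exact_mod_cast hx.ne'
    have e1 : ψ x = deriv φ x + (2 * k + 1) / 2 * (φ x - φ (-x)) / x := by
      have := hψ x
      field_simp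
      linear_combination 2 * this
    have e2 : ψ (-x) = deriv φ (-x) + (2 * k + 1) / 2 * (φ x - φ (-x)) / x := by
      have := hψ (-x)
      push_cast at this
      rw [neg_neg] at this
      field_simp
      linear_combination -2 * this
    have e3 : η' x = -Complex.I * l * η x - (2 * k + 1) / 2 * (η x - η (-x)) / x := by
      have := hηT x
      field_simp
      linear_combination 2 * this
    have e4 : η' (-x) = -Complex.I * l * η (-x) - (2 * k + 1) / 2 * (η x - η (-x)) / x := by
      have := hηT (-x)
      push_cast at this
      rw [neg_neg] at this
      field_simp
      linear_combination -2 * this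
    simp only [hG', hH, hf, hf', Complex.real_smul]
    rw [e1, e2, e3, e4]
    push_cast
    field_simp
    ring
  have iG' : IntegrableOn G' (Ioi 0) := by
    refine IntegrableOn.congr_fun ?_ (fun x hx => (hGH x hx).symm) measurableSet_Ioi
    exact ((iH'.add iH'.comp_neg).const_mul _).integrableOn
  have iG : IntegrableOn G (Ioi 0) := by
    refine IntegrableOn.congr_fun (f := fun x => c * (muDensity k x • (φ x * η x)
      - muDensity k (-x) • (φ (-x) * η (-x)))) ?_ (fun x hx => ?_) measurableSet_Ioi
    · exact ((iφ'.sub iφ'.comp_neg).const_mul _).integrableOn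
    · simp only [hG, hf]
      rw [muDensity_neg, hdens x hx, Complex.real_smul, Complex.real_smul]
      push_cast
      field_simp
  -- The antisymmetry of f is what matters here: for k = -1/2 the power of x is 1 and does not
  -- vanish at 0.
  have hG0 : G 0 = 0 := by simp [hG, hf]
  have hGc : Continuous G := by
    have h1 := Real.continuous_rpow_const (by linarith : 0 ≤ 2 * k + 1)
    have h2 : Continuous f := continuous_iff_continuousAt.2 fun x => (hfd x).continuousAt
    fun_prop
  have hint := integral_Ioi_of_hasDerivAt_of_tendsto hGc.continuousWithinAt hGd iG'
    (tendsto_zero_of_hasDerivAt_of_integrableOn_Ioi hGd iG' iG)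
  rw [hG0, sub_zero, setIntegral_congr_fun measurableSet_Ioi hGH, integral_const_mul,
    ← integral_eq_integral_Ioi_add iH', ← integral_mu hk, mul_eq_zero] at hint
  have h0 := hint.resolve_left hc'
  simp only [hH] at h0
  rw [integral_sub iψ (iφ.const_mul _), integral_const_mul, sub_eq_zero] at h0
  exact h0

theorem hasDerivAt_dunklF_schwartz {k : ℝ} (hk : -1 / 2 ≤ k) (φ : 𝓢(ℝ, ℂ)) (n : ℕ) (l : ℝ) :
    HasDerivAt (fun l : ℝ => ∫ x : ℝ, φ x * ((-Complex.I * x) ^ n * dexpDeriv k n (-Complex.I * l * x)) ∂mu k)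
      (∫ x : ℝ, φ x * ((-Complex.I * x) ^ (n + 1) * dexpDeriv k (n + 1) (-Complex.I * l * x)) ∂mu k) l := by
  have := hasTemperateGrowth_mu hk
  have hc : ∀ n, Continuous (dexpDeriv k n) := continuous_dexpDeriv hk
  have hφ := φ.continuous
  have hb : ∀ n (l x : ℝ), ‖φ x * ((-Complex.I * x) ^ n * dexpDeriv k n (-Complex.I * l * x))‖
      ≤ ‖x‖ ^ n * ‖φ x‖ := by
    intro n l x
    have h1 := norm_dexpDeriv_le_one hk n (w := -Complex.I * l * x) (by simp)
    rw [norm_mul, norm_mul, norm_pow, norm_mul, norm_neg, Complex.norm_I, one_mul, Complex.norm_real]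
    calc _ ≤ ‖φ x‖ * (‖x‖ ^ n * 1) := by gcongr
      _ = _ := by ring
  refine (hasDerivAt_integral_of_dominated_loc_of_deriv_le (F := fun (l x : ℝ) =>
    φ x * ((-Complex.I * x) ^ n * dexpDeriv k n (-Complex.I * l * x))) (F' := fun (l x : ℝ) =>
    φ x * ((-Complex.I * x) ^ (n + 1) * dexpDeriv k (n + 1) (-Complex.I * l * x)))
    univ_mem ?_ ?_ ?_ ?_ (φ.integrable_pow_mul (mu k) (n + 1)) ?_).2
  · have := hc n
    exact Eventually.of_forall fun y => (by fun_prop : Continuous _).aestronglyMeasurable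
  · have := hc n
    exact (φ.integrable_pow_mul (mu k) n).mono' (by fun_prop : Continuous _).aestronglyMeasurable
      (Eventually.of_forall (hb n l))
  · have := hc (n + 1)
    exact (by fun_prop : Continuous _).aestronglyMeasurable
  · exact Eventually.of_forall fun x y _ => hb (n + 1) y x
  · refine Eventually.of_forall fun x y _ => ?_
    have h1 := ((hasDerivAt_dexp_mul hk n (-Complex.I * x) y).const_mul
      ((-Complex.I * x) ^ n)).const_mul (φ x)
    have e : ∀ y : ℝ, -Complex.I * y * x = -Complex.I * x * y := fun y => by ring
    simp only [e]
    convert! h1 using 1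
    ring

/-- The Dunkl transform maps Schwartz functions to Schwartz functions. -/
theorem exists_schwartz_dunklF {k : ℝ} (hk : -1 / 2 ≤ k) (φ : 𝓢(ℝ, ℂ)) :
    ∃ χ : 𝓢(ℝ, ℂ), ∀ l, χ l = dunklF k φ l := by
  have h0 : ∀ φ : 𝓢(ℝ, ℂ), (fun l : ℝ => ∫ x : ℝ, φ x * ((-Complex.I * x) ^ 0 *
      dexpDeriv k 0 (-Complex.I * l * x)) ∂mu k) = dunklF k φ := by
    intro φ
    funext l
    simp only [pow_zero, one_mul, dexpDeriv_zero, dunklF]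
  have hs : ∀ φ : 𝓢(ℝ, ℂ), ContDiff ℝ (⊤ : ℕ∞) (dunklF k φ) := fun φ => by
    have := (contDiff_and_iteratedDeriv_of_hasDerivAt (u := fun n (l : ℝ) => ∫ x : ℝ, φ x *
      ((-Complex.I * x) ^ n * dexpDeriv k n (-Complex.I * l * x)) ∂mu k)
      (hasDerivAt_dunklF_schwartz hk φ)).1
    rwa [h0] at this
  -- Multiplication of the transform by l is the transform of -i times the Dunkl operator of φ. The
  -- induction on m therefore changes φ and must quantify over all Schwartz functions.
  have hdec : ∀ m (φ : 𝓢(ℝ, ℂ)) n, ∃ C, ∀ x, |x| ^ m * ‖iteratedDeriv n (dunklF k φ) x‖ ≤ C := by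
    intro m
    induction m with
    | zero =>
      intro φ n
      have := hasTemperateGrowth_mu hk
      have hi := (contDiff_and_iteratedDeriv_of_hasDerivAt (u := fun n (l : ℝ) => ∫ x : ℝ, φ x *
        ((-Complex.I * x) ^ n * dexpDeriv k n (-Complex.I * l * x)) ∂mu k)
        (hasDerivAt_dunklF_schwartz hk φ)).2 n
      rw [h0] at hi
      refine ⟨∫ x, ‖x‖ ^ n * ‖φ x‖ ∂mu k, fun l => ?_⟩
      rw [pow_zero, one_mul, hi]
      refine norm_integral_le_of_norm_le (φ.integrable_pow_mul (mu k) n)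
        (Eventually.of_forall fun x => ?_)
      have h1 := norm_dexpDeriv_le_one hk n (w := -Complex.I * l * x) (by simp)
      rw [norm_mul, norm_mul, norm_pow, norm_mul, norm_neg, Complex.norm_I, one_mul,
        Complex.norm_real]
      calc _ ≤ ‖φ x‖ * (‖x‖ ^ n * 1) := by gcongr
        _ = _ := by ring
    | succ m ih =>
      intro φ
      obtain ⟨ψ, hψ⟩ := exists_schwartz_dunklOperator k φ
      obtain ⟨w, hw⟩ : ∃ w : 𝓢(ℝ, ℂ), ∀ x, w x = -Complex.I * ψ x :=
        ⟨-Complex.I • ψ, fun x => rfl⟩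
      refine exists_pow_succ_mul_iteratedDeriv_le (w := dunklF k w) (hs φ) (fun l => ?_) m (ih φ)
        (ih w)
      have h1 := dunklF_dunklOperator hk hψ l
      have h2 : dunklF k w l = -Complex.I * dunklF k ψ l := by
        simp only [dunklF, ← integral_const_mul, hw, mul_assoc]
      rw [h2, h1, ← mul_assoc, ← mul_assoc, neg_mul, Complex.I_mul_I, neg_neg, one_mul]
  exact exists_schwartz_eq (hs φ) fun m => hdec m φ

/-- Inversion of the Dunkl transform on Schwartz functions. -/
theorem dunklF_dunklF_schwartz {k : ℝ} (hk : -1 / 2 ≤ k) (φ : 𝓢(ℝ, ℂ)) (x : ℝ) :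
    dunklF k (dunklF k φ) x = φ (-x) := by
  obtain ⟨χ, hχ⟩ := exists_schwartz_dunklF hk φ
  have hχ' : dunklF k φ = χ := funext fun l => (hχ l).symm
  have h1 := dunklL2_dunklL2 hk (SchwartzMap.memLp_mu hk φ)
  have h2 : dunklL2 hk ((SchwartzMap.memLp_mu hk φ).toLp φ) = (SchwartzMap.memLp_mu hk χ).toLp χ := by
    refine Lp.ext ?_
    refine (dunklL2_toLp hk _ (SchwartzMap.integrable_mu hk φ)).trans ?_
    rw [hχ']
    exact (MemLp.coeFn_toLp _).symm
  rw [h2] at h1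
  have h3 := (dunklL2_toLp hk (SchwartzMap.memLp_mu hk χ) (SchwartzMap.integrable_mu hk χ)).symm.trans h1
  -- The L² inversion gives equality almost everywhere; both sides are continuous and the measure
  -- charges every nonempty open set.
  have := (absolutelyContinuous_mu hk).isOpenPosMeasure
  have h4 := (Continuous.ae_eq_iff_eq (mu k) (continuous_dunklF hk (SchwartzMap.integrable_mu hk χ))
    (φ.continuous.comp continuous_neg)).1 h3
  rw [hχ']
  exact congrFun h4 x

/-! ### Chirps -/

theorem norm_chirp (r x : ℝ) : ‖chirp r x‖ = 1 := by
  rw [chirp, show Complex.I / 2 * r * x ^ 2 = ((r * x ^ 2 / 2 : ℝ) : ℂ) * Complex.I by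
    push_cast; ring, Complex.norm_exp_ofReal_mul_I]

theorem continuous_chirp (r : ℝ) : Continuous (chirp r) := by
  unfold chirp; fun_prop

theorem chirp_mul_chirp (r t x : ℝ) : chirp r x * chirp t x = chirp (r + t) x := by
  rw [chirp, chirp, chirp, ← Complex.exp_add]
  congr 1
  push_cast
  ring

theorem chirp_zero (x : ℝ) : chirp 0 x = 1 := by simp [chirp]

theorem chirp_mul_neg (r x : ℝ) : chirp r x * chirp (-r) x = 1 := by
  rw [chirp_mul_chirp, add_neg_cancel, chirp_zero]

theorem chirp_neg_mul (r x : ℝ) : chirp (-r) x * chirp r x = 1 := by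
  rw [mul_comm, chirp_mul_neg]

theorem conj_chirp (r x : ℝ) : (starRingEnd ℂ) (chirp r x) = chirp (-r) x := by
  rw [chirp, chirp, ← Complex.exp_conj]
  congr 1
  rw [map_mul, map_mul, map_div₀, map_pow, Complex.conj_ofReal, Complex.conj_ofReal, Complex.conj_I,
    map_ofNat]
  push_cast
  ring

theorem hasTemperateGrowth_exp_mul_I :
    Function.HasTemperateGrowth fun t : ℝ => Complex.exp (t * Complex.I) := by
  have h : ∀ (n : ℕ) (t : ℝ), HasDerivAt (fun t : ℝ => Complex.I ^ n * Complex.exp (t * Complex.I))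
      (Complex.I ^ (n + 1) * Complex.exp (t * Complex.I)) t := by
    intro n t
    have h1 : HasDerivAt (fun t : ℝ => (t : ℂ) * Complex.I) Complex.I t := by
      simpa using (hasDerivAt_id t).ofReal_comp.mul_const Complex.I
    convert! h1.cexp.const_mul (Complex.I ^ n) using 1
    ring
  obtain ⟨h1, h2⟩ := contDiff_and_iteratedDeriv_of_hasDerivAt h
  simp only [pow_zero, one_mul] at h1 h2
  refine ⟨h1, fun n => ⟨0, 1, fun t => ?_⟩⟩
  rw [norm_iteratedFDeriv_eq_norm_iteratedDeriv, h2 n]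
  simp [Complex.norm_exp_ofReal_mul_I]

theorem hasTemperateGrowth_chirp (r : ℝ) : Function.HasTemperateGrowth (chirp r) := by
  have h1 : Function.HasTemperateGrowth fun x : ℝ => r / 2 * x ^ 2 :=
    (Function.HasTemperateGrowth.const _).mul (Function.HasTemperateGrowth.id'.pow 2)
  have h2 := hasTemperateGrowth_exp_mul_I.comp h1
  convert! h2 using 1
  funext x
  simp only [chirp, Function.comp]
  congr 1
  push_cast
  ring

theorem exists_schwartz_chirp_mul (r : ℝ) (φ : 𝓢(ℝ, ℂ)) :
    ∃ χ : 𝓢(ℝ, ℂ), ∀ x, χ x = chirp r x * φ x :=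
  ⟨smulLeftCLM ℂ (chirp r) φ, fun x => by
    rw [smulLeftCLM_apply_apply (hasTemperateGrowth_chirp r), smul_eq_mul]⟩

theorem exists_schwartz_comp_mul {c : ℝ} (hc : c ≠ 0) (φ : 𝓢(ℝ, ℂ)) :
    ∃ χ : 𝓢(ℝ, ℂ), ∀ x, χ x = φ (c * x) :=
  ⟨compCLMOfContinuousLinearEquiv ℂ (ContinuousLinearEquiv.unitsEquivAut ℝ (Units.mk0 c hc)) φ,
    fun x => by
      rw [compCLMOfContinuousLinearEquiv_apply]
      simp [mul_comm]⟩

/-! ### The linear canonical transform on `L²` -/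

theorem memLp_chirp_mul {k : ℝ} (r : ℝ) {f : ℝ → ℂ} (hf : MemLp f 2 (mu k)) :
    MemLp (fun x => chirp r x * f x) 2 (mu k) :=
  hf.of_le ((continuous_chirp r).aestronglyMeasurable.mul hf.1)
    (Eventually.of_forall fun x => by rw [norm_mul, norm_chirp, one_mul])

theorem eLpNorm_chirp_mul (k r : ℝ) (f : ℝ → ℂ) :
    eLpNorm (fun x => chirp r x * f x) 2 (mu k) = eLpNorm f 2 (mu k) :=
  eLpNorm_congr_norm_ae (Eventually.of_forall fun x => by rw [norm_mul, norm_chirp, one_mul])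

/-- The factorization that transfers every fact about the Dunkl transform to the canonical one. -/
theorem lcdt_eq {k : ℝ} (hk : -1 / 2 ≤ k) (M : SL2) (f : ℝ → ℂ) (l : ℝ) :
    lcdt k M f l = normFactor k M * (chirp (M 1 1 / M 0 1) l *
      dunklF k (fun x => chirp (M 0 0 / M 0 1) x * f x) ((M 0 1)⁻¹ * l)) := by
  rw [lcdt, dunklF, ← integral_const_mul (chirp (M 1 1 / M 0 1) l)]
  congr 2
  funext x
  rw [kernelM, dunklKernel_eq hk]
  have : -Complex.I * l / (M 0 1 : ℝ) * x = -Complex.I * ((M 0 1)⁻¹ * l : ℝ) * x := by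
    push_cast; ring
  rw [this]
  ring

theorem eLpNorm_comp_mul_left (k : ℝ) {r : ℝ} (hr : r ≠ 0) (f : ℝ → ℂ) :
    eLpNorm (fun x => f (r * x)) 2 (mu k)
      = ENNReal.ofReal (|r| ^ (-(k + 1))) * eLpNorm f 2 (mu k) := by
  rw [← ENNReal.pow_right_strictMono two_ne_zero |>.injective.eq_iff, mul_pow, eLpNorm_two_sq,
    eLpNorm_two_sq, lintegral_sq_comp_mul_left k hr]

theorem tendsto_eLpNorm_of_sq {α : Type*} [MeasurableSpace α] {μ : Measure α} {F : ℕ → α → ℂ}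
    (h : Tendsto (fun n => ∫⁻ x, ‖F n x‖ₑ ^ 2 ∂μ) atTop (𝓝 0)) :
    Tendsto (fun n => eLpNorm (F n) 2 μ) atTop (𝓝 0) := by
  have h1 := (ENNReal.continuous_rpow_const (y := 2⁻¹)).tendsto 0 |>.comp h
  have h2 : (0 : ℝ≥0∞) ^ (2⁻¹ : ℝ) = 0 := ENNReal.zero_rpow_of_pos (by norm_num)
  rw [h2] at h1
  refine h1.congr fun n => ?_
  rw [Function.comp, ← eLpNorm_two_sq, ← ENNReal.rpow_natCast_mul]
  norm_num

theorem tendsto_eLpNorm_truncation {k : ℝ} {f : ℝ → ℂ} (hf : MemLp f 2 (mu k)) :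
    Tendsto (fun n : ℕ => eLpNorm (fun x => indicator (Icc (-(n : ℝ)) n) f x - f x) 2 (mu k))
      atTop (𝓝 0) := by
  refine tendsto_eLpNorm_of_sq ?_
  have hfin : ∫⁻ y, ‖f y‖ₑ ^ 2 ∂mu k ≠ ∞ := by
    rw [← eLpNorm_two_sq]; exact (ENNReal.pow_lt_top hf.2).ne
  have hm : ∀ n : ℕ, AEStronglyMeasurable (fun x => indicator (Icc (-(n : ℝ)) n) f x - f x) (mu k) :=
    fun n => (hf.1.indicator measurableSet_Icc).sub hf.1
  have := tendsto_lintegral_of_dominated_convergence' (μ := mu k)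
    (F := fun (n : ℕ) x => ‖indicator (Icc (-(n : ℝ)) n) f x - f x‖ₑ ^ 2) (f := fun _ => 0)
    (fun x => ‖f x‖ₑ ^ 2) (fun n => (hm n).enorm.pow_const 2) (fun n => Eventually.of_forall fun x => ?_)
    hfin (Eventually.of_forall fun x => ?_)
  · simpa using this
  · by_cases hx : x ∈ Icc (-(n : ℝ)) n <;> simp [hx]
  · obtain ⟨N, hN⟩ := exists_nat_ge |x|
    refine tendsto_const_nhds.congr' ?_
    filter_upwards [eventually_ge_atTop N] with n hn
    have hx : x ∈ Icc (-(n : ℝ)) n := by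
      have h1 : |x| ≤ n := hN.trans (by exact_mod_cast hn)
      exact abs_le.1 h1
    simp [hx]

theorem integrable_truncation {k : ℝ} (hk : -1 / 2 ≤ k) {f : ℝ → ℂ} (hf : MemLp f 2 (mu k)) (n : ℕ) :
    Integrable (indicator (Icc (-(n : ℝ)) n) f) (mu k) := by
  have := isLocallyFiniteMeasure_mu hk
  rw [integrable_indicator_iff measurableSet_Icc]
  have : IsFiniteMeasure ((mu k).restrict (Icc (-(n : ℝ)) n)) :=
    ⟨by rw [Measure.restrict_apply_univ]; exact isCompact_Icc.measure_lt_top⟩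
  exact (hf.restrict _).integrable one_le_two

/-- Truncations are in L¹ ∩ L², where the integral formula and the isometry agree. The error of the
transforms is then a fixed multiple of the norm of the truncation error. -/
theorem isLcdtL2_of_dunklL2 {k : ℝ} (hk : -1 / 2 ≤ k) {M : SL2} (hb : M 0 1 ≠ 0) {f : ℝ → ℂ}
    (hf : MemLp f 2 (mu k)) :
    IsLcdtL2 k M f fun l => normFactor k M * (chirp (M 1 1 / M 0 1) l *
      dunklL2 hk ((memLp_chirp_mul (M 0 0 / M 0 1) hf).toLp _) ((M 0 1)⁻¹ * l)) := by
  have hb' := inv_ne_zero hb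
  set r := M 0 0 / M 0 1
  set v : Lp ℂ 2 (mu k) := dunklL2 hk ((memLp_chirp_mul r hf).toLp _)
  refine ⟨(memLp_chirp_mul _ (memLp_comp_mul_left hb' (Lp.memLp v))).const_mul _, ?_⟩
  have key : ∀ n : ℕ, eLpNorm (fun l => lcdt k M (indicator (Icc (-(n : ℝ)) n) f) l -
      normFactor k M * (chirp (M 1 1 / M 0 1) l * v ((M 0 1)⁻¹ * l))) 2 (mu k)
      = ‖normFactor k M‖ₑ * (ENNReal.ofReal (|(M 0 1)⁻¹| ^ (-(k + 1))) *
        eLpNorm (fun x => indicator (Icc (-(n : ℝ)) n) f x - f x) 2 (mu k)) := by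
    intro n
    have hft : MemLp (indicator (Icc (-(n : ℝ)) n) f) 2 (mu k) := hf.indicator measurableSet_Icc
    have hct := memLp_chirp_mul r hft
    have hi : Integrable (fun x => chirp r x * indicator (Icc (-(n : ℝ)) n) f x) (mu k) :=
      (integrable_truncation hk hf n).bdd_mul (c := 1) (continuous_chirp r).aestronglyMeasurable
        (Eventually.of_forall fun x => (norm_chirp r x).le)
    have e1 : (fun l => lcdt k M (indicator (Icc (-(n : ℝ)) n) f) l -
        normFactor k M * (chirp (M 1 1 / M 0 1) l * v ((M 0 1)⁻¹ * l)))
        = normFactor k M • fun l => chirp (M 1 1 / M 0 1) l *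
          (fun x => dunklF k (fun x => chirp r x * indicator (Icc (-(n : ℝ)) n) f x) x - v x)
            ((M 0 1)⁻¹ * l) := by
      funext l
      rw [lcdt_eq hk, Pi.smul_apply, smul_eq_mul]
      ring
    rw [e1, eLpNorm_const_smul, eLpNorm_chirp_mul, eLpNorm_comp_mul_left k hb' fun x =>
      dunklF k (fun x => chirp r x * indicator (Icc (-(n : ℝ)) n) f x) x - v x]
    congr 2
    have e2 : (fun x => dunklF k (fun x => chirp r x * indicator (Icc (-(n : ℝ)) n) f x) x - v x)
        =ᵐ[mu k] ⇑(dunklL2 hk (hct.toLp _ - (memLp_chirp_mul r hf).toLp _)) := by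
      rw [map_sub]
      filter_upwards [dunklL2_toLp hk hct hi, Lp.coeFn_sub (dunklL2 hk (hct.toLp _)) v] with x h1 h2
      rw [h2, Pi.sub_apply, h1]
    rw [eLpNorm_congr_ae e2, ← Lp.enorm_def, ← ofReal_norm, LinearIsometry.norm_map, ofReal_norm,
      ← MemLp.toLp_sub, Lp.enorm_toLp,
      ← eLpNorm_chirp_mul k r fun x => indicator (Icc (-(n : ℝ)) n) f x - f x]
    congr 1
    funext x
    simp only [Pi.sub_apply]
    ring
  simp only [key]
  have h1 := ENNReal.Tendsto.const_mul (a := ENNReal.ofReal (|(M 0 1)⁻¹| ^ (-(k + 1))))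
    (tendsto_eLpNorm_truncation hf) (Or.inr ENNReal.ofReal_ne_top)
  have h2 := ENNReal.Tendsto.const_mul (a := ‖normFactor k M‖ₑ) h1 (Or.inr enorm_ne_top)
  simpa using h2

theorem aestronglyMeasurable_lcdt_truncation {k : ℝ} (hk : -1 / 2 ≤ k) (M : SL2) {f : ℝ → ℂ}
    (hf : MemLp f 2 (mu k)) (n : ℕ) :
    AEStronglyMeasurable (lcdt k M (indicator (Icc (-(n : ℝ)) n) f)) (mu k) := by
  have hi : Integrable (fun x => chirp (M 0 0 / M 0 1) x * indicator (Icc (-(n : ℝ)) n) f x) (mu k) :=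
    (integrable_truncation hk hf n).bdd_mul (c := 1) (continuous_chirp _).aestronglyMeasurable
      (Eventually.of_forall fun x => (norm_chirp _ x).le)
  have h1 := continuous_dunklF hk hi
  have h2 := continuous_chirp (M 1 1 / M 0 1)
  rw [funext (lcdt_eq hk M _)]
  exact (by fun_prop : Continuous _).aestronglyMeasurable

theorem IsLcdtL2.ae_eq {k : ℝ} (hk : -1 / 2 ≤ k) {M : SL2} {f g₁ g₂ : ℝ → ℂ}
    (hf : MemLp f 2 (mu k)) (h₁ : IsLcdtL2 k M f g₁) (h₂ : IsLcdtL2 k M f g₂) :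
    g₁ =ᵐ[mu k] g₂ := by
  have hm := aestronglyMeasurable_lcdt_truncation hk M hf
  have h0 : eLpNorm (g₁ - g₂) 2 (mu k) = 0 := by
    have hlim := h₂.2.add h₁.2
    rw [add_zero] at hlim
    refine le_antisymm (ge_of_tendsto' hlim fun n => ?_) bot_le
    have e : g₁ - g₂ = (fun l => lcdt k M (indicator (Icc (-(n : ℝ)) n) f) l - g₂ l) -
        (fun l => lcdt k M (indicator (Icc (-(n : ℝ)) n) f) l - g₁ l) := by
      funext l; simp
    rw [e]
    exact eLpNorm_sub_le ((hm n).sub h₂.1.1) ((hm n).sub h₁.1.1) one_le_two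
  rw [eLpNorm_eq_zero_iff (h₁.1.1.sub h₂.1.1) two_ne_zero] at h0
  filter_upwards [h0] with x hx using sub_eq_zero.1 hx

theorem lcdtL2_ae_eq {k : ℝ} (hk : -1 / 2 ≤ k) {M : SL2} (hb : M 0 1 ≠ 0) {f : ℝ → ℂ}
    (hf : MemLp f 2 (mu k)) :
    lcdtL2 k M f =ᵐ[mu k] fun l => normFactor k M * (chirp (M 1 1 / M 0 1) l *
      dunklL2 hk ((memLp_chirp_mul (M 0 0 / M 0 1) hf).toLp _) ((M 0 1)⁻¹ * l)) := by
  have h := isLcdtL2_of_dunklL2 hk hb hf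
  have he : ∃ g, IsLcdtL2 k M f g := ⟨_, h⟩
  rw [lcdtL2, dif_pos he]
  exact IsLcdtL2.ae_eq hk hf he.choose_spec h

/-! ### The wavelet transform on the transform side -/

/-- The product of transforms whose Dunkl transform is the wavelet transform. -/
def symbolProduct (u v : ℝ → ℂ) (α l : ℝ) : ℂ := u l * (starRingEnd ℂ) (v (α * l))

/-- The chirp in the dilation is chosen so that r - r(1 - 1/α²) = r/α² for r = a/b: chirping the
dilated ψ is dilating the chirped ψ. -/
theorem chirp_mul_dilationM (k : ℝ) (M : SL2) (ψ : ℝ → ℂ) {α : ℝ} (hα : 0 < α) (z : ℝ) :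
    chirp (M 0 0 / M 0 1) z * dilationM k M ψ α z
      = ((α ^ (-(2 * k + 2)) : ℝ) : ℂ) * (chirp (M 0 0 / M 0 1) (α⁻¹ * z) * ψ (α⁻¹ * z)) := by
  have h1 : chirp (M 0 0 / M 0 1) z * chirp (-(M 0 0 / M 0 1 * (1 - 1 / α ^ 2))) z
      = chirp (M 0 0 / M 0 1) (α⁻¹ * z) := by
    rw [chirp_mul_chirp, chirp, chirp]
    congr 1
    push_cast
    ring
  have h2 : 1 / α ^ (2 * k + 2) = α ^ (-(2 * k + 2)) := by rw [Real.rpow_neg hα.le, one_div]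
  rw [dilationM, ← h1, h2, div_eq_inv_mul z α]
  ring

theorem memLp_chirp_mul_dilationM {k : ℝ} (M : SL2) {ψ : ℝ → ℂ} (hψ : MemLp ψ 2 (mu k)) {α : ℝ}
    (hα : 0 < α) : MemLp (fun z => chirp (M 0 0 / M 0 1) z * dilationM k M ψ α z) 2 (mu k) := by
  simp only [chirp_mul_dilationM k M ψ hα]
  exact (memLp_comp_mul_left (inv_ne_zero hα.ne') (memLp_chirp_mul _ hψ)).const_mul _

/-- The factor α^(-(2k+2)) is exactly undone by the scaling rule of the Dunkl transform, leaving the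
plain dilation l ↦ αl. -/
theorem dunklL2_chirp_mul_dilationM {k : ℝ} (hk : -1 / 2 ≤ k) (M : SL2) {ψ : ℝ → ℂ}
    (hψ : MemLp ψ 2 (mu k)) {α : ℝ} (hα : 0 < α) :
    dunklL2 hk ((memLp_chirp_mul_dilationM M hψ hα).toLp _) =ᵐ[mu k] fun l =>
      dunklL2 hk ((memLp_chirp_mul (M 0 0 / M 0 1) hψ).toLp _) (α * l) := by
  have hα' := inv_ne_zero hα.ne'
  have hv := memLp_chirp_mul (M 0 0 / M 0 1) hψ
  have h1 : (memLp_chirp_mul_dilationM M hψ hα).toLp _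
      = ((α ^ (-(2 * k + 2)) : ℝ) : ℂ) • (memLp_comp_mul_left hα' hv).toLp _ := by
    rw [← MemLp.toLp_const_smul]
    congr 1
    funext z
    exact chirp_mul_dilationM k M ψ hα z
  rw [h1, map_smul]
  filter_upwards [Lp.coeFn_smul ((α ^ (-(2 * k + 2)) : ℝ) : ℂ)
    (dunklL2 hk ((memLp_comp_mul_left hα' hv).toLp _)), dunklL2_comp_mul_left hk hα' hv] with l h2 h3
  rw [h2, Pi.smul_apply, h3, inv_inv, smul_eq_mul, ← mul_assoc, ← Complex.ofReal_mul,
    abs_of_pos (inv_pos.2 hα), Real.inv_rpow hα.le, mul_inv_cancel₀ (Real.rpow_pos_of_pos hα _).ne',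
    Complex.ofReal_one, one_mul]

theorem memLp_waveletFamily {k : ℝ} (hk : -1 / 2 ≤ k) (M : SL2) {ψ : ℝ → ℂ}
    (hψ : MemLp ψ 2 (mu k)) {α : ℝ} (hα : 0 < α) (β : ℝ) :
    MemLp (waveletFamily k M ψ α β) 2 (mu k) := by
  have h := memLp_chirp_mul (-(M 0 0 / M 0 1))
    (memLp_dunklTranslation hk β (memLp_chirp_mul_dilationM M hψ hα))
  refine (h.const_mul (((α ^ (k + 1) : ℝ) : ℂ) * chirp (-(M 0 0 / M 0 1)) β)).ae_eq
    (Eventually.of_forall fun y => ?_)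
  simp only [waveletFamily, translationM]
  ring

/-- Parseval for the chirped f and the translate of the chirped dilate. The translation becomes the
factor E_k(iβ, l), whose conjugate E_k(-iβ, l) is the kernel of a Dunkl transform evaluated at β. -/
theorem waveletTransform_eq {k : ℝ} (hk : -1 / 2 ≤ k) (M : SL2) {ψ f : ℝ → ℂ}
    (hψ : MemLp ψ 2 (mu k)) (hf : MemLp f 2 (mu k)) {α : ℝ} (hα : 0 < α) (β : ℝ) :
    waveletTransform k M ψ f (α, β) = normFactor k M * (((α ^ (k + 1) : ℝ) : ℂ) *
      chirp (M 0 0 / M 0 1) β * dunklF k (symbolProduct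
        (dunklL2 hk ((memLp_chirp_mul (M 0 0 / M 0 1) hf).toLp _))
        (dunklL2 hk ((memLp_chirp_mul (M 0 0 / M 0 1) hψ).toLp _)) α) β) := by
  have hv := memLp_chirp_mul_dilationM M hψ hα
  have hT := memLp_dunklTranslation hk β hv
  have hP := integral_dunklL2_mul_conj hk (memLp_chirp_mul (M 0 0 / M 0 1) hf) hT
  have e1 : ∫ y, f y * (starRingEnd ℂ) (waveletFamily k M ψ α β y) ∂mu k
      = ((α ^ (k + 1) : ℝ) : ℂ) * chirp (M 0 0 / M 0 1) β * ∫ y, chirp (M 0 0 / M 0 1) y * f y * (starRingEnd ℂ)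
        (dunklTranslation k β (fun z => chirp (M 0 0 / M 0 1) z * dilationM k M ψ α z) y) ∂mu k := by
    rw [← integral_const_mul]
    congr 1
    funext y
    simp only [waveletFamily, translationM, map_mul, conj_chirp, Complex.conj_ofReal, neg_neg]
    ring
  rw [waveletTransform, e1, hP, dunklF]
  congr 2
  refine integral_congr_ae ?_
  filter_upwards [dunklL2_translation hk β hv, dunklL2_chirp_mul_dilationM hk M hψ hα] with l h1 h2
  rw [h1, h2, map_mul, conj_dexp_I, symbolProduct]
  ring

theorem integrable_symbolProduct {k : ℝ} {u v : ℝ → ℂ} (hu : MemLp u 2 (mu k))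
    (hv : MemLp v 2 (mu k)) {α : ℝ} (hα : 0 < α) : Integrable (symbolProduct u v α) (mu k) :=
  integrable_mul_of_memLp hu (memLp_comp_mul_left hα.ne' hv).star

theorem stronglyMeasurable_dunklF_symbolProduct {k : ℝ} (hk : -1 / 2 ≤ k) {u v : ℝ → ℂ}
    (hu : StronglyMeasurable u) (hv : StronglyMeasurable v) :
    StronglyMeasurable fun p : ℝ × ℝ => dunklF k (symbolProduct u v p.1) p.2 := by
  have hu := hu.measurable
  have hv := hv.measurable
  have hc := (continuous_dexp hk).measurable
  refine StronglyMeasurable.integral_prod_right' (f := fun q : (ℝ × ℝ) × ℝ =>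
    symbolProduct u v q.1.1 q.2 * dexp k (-Complex.I * q.1.2 * q.2)) ?_
  unfold symbolProduct
  exact (Measurable.mul ((hu.comp measurable_snd).mul
    (Complex.continuous_conj.measurable.comp (hv.comp (by fun_prop))))
    (hc.comp (by fun_prop))).stronglyMeasurable

/-- The products of transforms are in L¹ but need not be in L² for every α; when f is not in L² the
right side is infinite, so no such hypothesis is needed. -/
theorem lintegral_dunklF_sq_le {k : ℝ} (hk : -1 / 2 ≤ k) {f : ℝ → ℂ} (hf : Integrable f (mu k)) :
    ∫⁻ l, ‖dunklF k f l‖ₑ ^ 2 ∂mu k ≤ ∫⁻ x, ‖f x‖ₑ ^ 2 ∂mu k := by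
  by_cases h : eLpNorm f 2 (mu k) = ∞
  · rw [← eLpNorm_two_sq (mu k) f, h]; simp
  · rw [← eLpNorm_two_sq, ← eLpNorm_two_sq, eLpNorm_dunklF hk ⟨hf.1, lt_top_iff_ne_top.2 h⟩ hf]

theorem lintegral_nu (k : ℝ) {F : ℝ × ℝ → ℝ≥0∞} (hF : Measurable F) :
    ∫⁻ p, F p ∂nu k = ∫⁻ α in Ioi (0 : ℝ), ENNReal.ofReal (1 / α ^ (2 * k + 3)) *
      ∫⁻ β, F (α, β) ∂mu k := by
  rw [nu, lintegral_prod _ hF.aemeasurable,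
    lintegral_withDensity_eq_lintegral_mul _ (by fun_prop) hF.lintegral_prod_right']
  rfl

theorem ae_nu_pos (k : ℝ) : ∀ᵐ p ∂nu k, 0 < p.1 := by
  have h : ∀ᵐ α ∂(volume.restrict (Ioi (0 : ℝ))).withDensity fun α =>
      ENNReal.ofReal (1 / α ^ (2 * k + 3)), 0 < α :=
    (withDensity_absolutelyContinuous _ _).ae_le (ae_restrict_mem measurableSet_Ioi)
  exact Measure.quasiMeasurePreserving_fst.ae h

/-- The scale integral of a function. -/
def scaleIntegral (v : ℝ → ℂ) (l : ℝ) : ℝ≥0∞ :=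
  ∫⁻ α in Ioi (0 : ℝ), ENNReal.ofReal (1 / α) * ‖v (α * l)‖ₑ ^ 2

/-- Plancherel in β for fixed α. The squared factor α^(2k+2) reduces the measure dα/α^(2k+3) to
dα/α. -/
theorem lintegral_symbolProduct_sq_le {k : ℝ} (hk : -1 / 2 ≤ k) {u v : ℝ → ℂ}
    (hu : MemLp u 2 (mu k)) (hv : MemLp v 2 (mu k)) {α : ℝ} (hα : 0 < α) :
    ENNReal.ofReal (1 / α ^ (2 * k + 3)) *
        ∫⁻ β, ‖((α ^ (k + 1) : ℝ) : ℂ) * dunklF k (symbolProduct u v α) β‖ₑ ^ 2 ∂mu k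
      ≤ ENNReal.ofReal (1 / α) * ∫⁻ l, ‖u l‖ₑ ^ 2 * ‖v (α * l)‖ₑ ^ 2 ∂mu k := by
  have hi := integrable_symbolProduct hu hv hα
  have e1 : ∀ β, ‖((α ^ (k + 1) : ℝ) : ℂ) * dunklF k (symbolProduct u v α) β‖ₑ ^ 2
      = ENNReal.ofReal (α ^ (2 * k + 2)) * ‖dunklF k (symbolProduct u v α) β‖ₑ ^ 2 := by
    intro β
    rw [enorm_mul, mul_pow, ← ofReal_norm, Complex.norm_real,
      Real.norm_of_nonneg (Real.rpow_nonneg hα.le _),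
      ← ENNReal.ofReal_pow (Real.rpow_nonneg hα.le _), ← Real.rpow_mul_natCast hα.le]
    push_cast
    ring_nf
  have e2 : ENNReal.ofReal (1 / α ^ (2 * k + 3)) * ENNReal.ofReal (α ^ (2 * k + 2))
      = ENNReal.ofReal (1 / α) := by
    rw [← ENNReal.ofReal_mul (by positivity)]
    congr 1
    rw [show 2 * k + 3 = (2 * k + 2) + 1 by ring, Real.rpow_add hα, Real.rpow_one]
    have := (Real.rpow_pos_of_pos hα (2 * k + 2)).ne'
    field_simp
  have e3 : ∀ l, ‖symbolProduct u v α l‖ₑ ^ 2 = ‖u l‖ₑ ^ 2 * ‖v (α * l)‖ₑ ^ 2 := fun l => by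
    rw [symbolProduct, enorm_mul, mul_pow, RCLike.enorm_conj]
  simp only [e1, ← e3]
  rw [lintegral_const_mul' _ _ ENNReal.ofReal_ne_top, ← mul_assoc, e2]
  exact mul_le_mul_right (lintegral_dunklF_sq_le hk hi) _

/-- Integrates the bound at fixed α, then Tonelli moves the scale integral inside, where it acts on
v alone. -/
theorem lintegral_dunklF_symbolProduct_le {k : ℝ} (hk : -1 / 2 ≤ k) {u v : ℝ → ℂ}
    (hu : StronglyMeasurable u) (hv : StronglyMeasurable v) (hu2 : MemLp u 2 (mu k))
    (hv2 : MemLp v 2 (mu k)) :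
    ∫⁻ p : ℝ × ℝ, ‖((p.1 ^ (k + 1) : ℝ) : ℂ) * dunklF k (symbolProduct u v p.1) p.2‖ₑ ^ 2 ∂nu k
      ≤ ∫⁻ l, ‖u l‖ₑ ^ 2 * scaleIntegral v l ∂mu k := by
  have hm := (stronglyMeasurable_dunklF_symbolProduct hk hu hv).measurable
  have hp : Measurable fun p : ℝ × ℝ => ((p.1 ^ (k + 1) : ℝ) : ℂ) :=
    Complex.measurable_ofReal.comp (measurable_fst.pow_const _)
  have hum : Measurable fun l => ‖u l‖ₑ ^ 2 := hu.enorm.pow_const 2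
  have hvm : Measurable fun p : ℝ × ℝ => ‖v (p.1 * p.2)‖ₑ ^ 2 :=
    (hv.measurable.comp (measurable_fst.mul measurable_snd)).enorm.pow_const 2
  have hw : Measurable fun p : ℝ × ℝ => ENNReal.ofReal (1 / p.1) :=
    (measurable_fst.const_div 1).ennreal_ofReal
  have hF : Measurable fun p : ℝ × ℝ =>
      ‖((p.1 ^ (k + 1) : ℝ) : ℂ) * dunklF k (symbolProduct u v p.1) p.2‖ₑ ^ 2 :=
    (hp.mul hm).enorm.pow_const 2
  rw [lintegral_nu k hF]
  refine (setLIntegral_mono' measurableSet_Ioi fun α hα =>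
    lintegral_symbolProduct_sq_le hk hu2 hv2 hα).trans (le_of_eq ?_)
  have e : ∀ α : ℝ, ENNReal.ofReal (1 / α) * ∫⁻ l, ‖u l‖ₑ ^ 2 * ‖v (α * l)‖ₑ ^ 2 ∂mu k
      = ∫⁻ l, ‖u l‖ₑ ^ 2 * (ENNReal.ofReal (1 / α) * ‖v (α * l)‖ₑ ^ 2) ∂mu k := by
    intro α
    rw [← lintegral_const_mul' _ _ ENNReal.ofReal_ne_top]
    congr 1
    funext l
    ring
  simp only [e]
  rw [lintegral_lintegral_swap ((hum.comp measurable_snd).mul (hw.mul hvm)).aemeasurable]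
  congr 1
  funext l
  rw [scaleIntegral, lintegral_const_mul' _ _ (by finiteness)]

/-! ### The admissibility constant -/

/-- The transform of ψ is known only almost everywhere. For l ≠ 0 the map α ↦ lα pulls null sets
back to null sets, so its formula may be used under the integral. -/
theorem admissibilityIntegral_eq {k : ℝ} (hk : -1 / 2 ≤ k) {M : SL2} (hb : M 0 1 ≠ 0) {ψ : ℝ → ℂ}
    (hψ : MemLp ψ 2 (mu k)) {l : ℝ} (hl : l ≠ 0) :
    admissibilityIntegral k M ψ l = ‖normFactor k M‖ₑ ^ 2 *
      scaleIntegral (dunklL2 hk ((memLp_chirp_mul (M 0 0 / M 0 1) hψ).toLp _)) ((M 0 1)⁻¹ * l) := by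
  rw [admissibilityIntegral, scaleIntegral, ← lintegral_const_mul' _ _ (by finiteness)]
  have h1 := (absolutelyContinuous_mu hk).ae_le (lcdtL2_ae_eq hk hb hψ)
  have hq : Measure.QuasiMeasurePreserving (fun α : ℝ => l * α) volume volume :=
    ⟨by fun_prop, by
      rw [Real.map_volume_mul_left hl]
      exact Measure.smul_absolutelyContinuous⟩
  refine setLIntegral_congr_fun_ae measurableSet_Ioi ?_
  filter_upwards [hq.ae h1] with α h2 hα
  have hα : 0 < α := hα
  rw [h2, norm_mul, norm_mul, norm_chirp, one_mul, div_eq_mul_inv, ENNReal.ofReal_mul (by positivity),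
    mul_pow, ENNReal.ofReal_mul (by positivity), ENNReal.ofReal_pow (norm_nonneg _),
    ENNReal.ofReal_pow (norm_nonneg _), ofReal_norm, ofReal_norm, one_div,
    show (M 0 1)⁻¹ * (l * α) = α * ((M 0 1)⁻¹ * l) by ring]
  ring

theorem IsWavelet.scaleIntegral_ae_eq {k : ℝ} (hk : -1 / 2 ≤ k) {M : SL2} (hb : M 0 1 ≠ 0)
    {ψ : ℝ → ℂ} (hψ : IsWavelet k M ψ) :
    ∀ᵐ l ∂mu k, ‖normFactor k M‖ₑ ^ 2 * scaleIntegral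
      (dunklL2 hk ((memLp_chirp_mul (M 0 0 / M 0 1) hψ.memLp).toLp _)) l
        = admissibilityConstant k M ψ := by
  have h0 : ∀ᵐ l : ℝ ∂mu k, l ≠ 0 :=
    (mu_absolutelyContinuous k).ae_le (Measure.ae_ne volume 0)
  have h1 := (mu_absolutelyContinuous k).ae_le hψ.const
  filter_upwards [h0, (quasiMeasurePreserving_mul_left_mu k hb).ae h1] with l hl h2
  rw [← h2, admissibilityIntegral_eq hk hb hψ.memLp (mul_ne_zero hb hl), inv_mul_cancel_left₀ hb]

theorem aestronglyMeasurable_waveletTransform {k : ℝ} (hk : -1 / 2 ≤ k) (M : SL2) {ψ f : ℝ → ℂ}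
    (hψ : MemLp ψ 2 (mu k)) (hf : MemLp f 2 (mu k)) :
    AEStronglyMeasurable (waveletTransform k M ψ f) (nu k) := by
  have hm := stronglyMeasurable_dunklF_symbolProduct hk
    (Lp.stronglyMeasurable (dunklL2 hk ((memLp_chirp_mul (M 0 0 / M 0 1) hf).toLp _)))
    (Lp.stronglyMeasurable (dunklL2 hk ((memLp_chirp_mul (M 0 0 / M 0 1) hψ).toLp _)))
  have hp : Measurable fun p : ℝ × ℝ => ((p.1 ^ (k + 1) : ℝ) : ℂ) :=
    Complex.measurable_ofReal.comp (measurable_fst.pow_const _)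
  have hc : Measurable fun p : ℝ × ℝ => chirp (M 0 0 / M 0 1) p.2 :=
    (continuous_chirp _).measurable.comp measurable_snd
  refine (((hp.mul hc).mul hm.measurable).const_mul
    (normFactor k M)).aestronglyMeasurable.congr ?_
  filter_upwards [ae_nu_pos k] with p hp
  exact (waveletTransform_eq hk M hψ hf hp p.2).symm

/-- The central estimate. The factor |(ib)^(-(k+1))|² from the wavelet transform is the one that
completes the scale integral of v to the admissibility constant, and the isometry gives ‖u‖ = ‖f‖.
-/
theorem lintegral_waveletTransform_sq_le {k : ℝ} (hk : -1 / 2 ≤ k) {M : SL2} (hb : M 0 1 ≠ 0)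
    {ψ f : ℝ → ℂ} (hψ : IsWavelet k M ψ) (hf : MemLp f 2 (mu k)) :
    ∫⁻ p, ‖waveletTransform k M ψ f p‖ₑ ^ 2 ∂nu k
      ≤ admissibilityConstant k M ψ * ∫⁻ x, ‖f x‖ₑ ^ 2 ∂mu k := by
  set u := dunklL2 hk ((memLp_chirp_mul (M 0 0 / M 0 1) hf).toLp _) with hu
  set v := dunklL2 hk ((memLp_chirp_mul (M 0 0 / M 0 1) hψ.memLp).toLp _) with hv
  have h1 : ∫⁻ p, ‖waveletTransform k M ψ f p‖ₑ ^ 2 ∂nu k = ‖normFactor k M‖ₑ ^ 2 *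
      ∫⁻ p : ℝ × ℝ, ‖((p.1 ^ (k + 1) : ℝ) : ℂ) * dunklF k (symbolProduct u v p.1) p.2‖ₑ ^ 2 ∂nu k := by
    rw [← lintegral_const_mul' _ _ (by finiteness)]
    refine lintegral_congr_ae ?_
    filter_upwards [ae_nu_pos k] with p hp
    rw [show p = (p.1, p.2) from rfl, waveletTransform_eq hk M hψ.memLp hf hp p.2, enorm_mul,
      mul_pow, enorm_mul, enorm_mul, ← ofReal_norm (chirp _ _), norm_chirp, ENNReal.ofReal_one,
      mul_one, ← enorm_mul]
  have h2 := lintegral_dunklF_symbolProduct_le hk (Lp.stronglyMeasurable u) (Lp.stronglyMeasurable v)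
    (Lp.memLp u) (Lp.memLp v)
  have h3 : ∫⁻ l, ‖u l‖ₑ ^ 2 ∂mu k = ∫⁻ x, ‖f x‖ₑ ^ 2 ∂mu k := by
    rw [← eLpNorm_two_sq, ← eLpNorm_two_sq, ← Lp.enorm_def, ← ofReal_norm, hu,
      LinearIsometry.norm_map, ofReal_norm, Lp.enorm_toLp, eLpNorm_chirp_mul]
  rw [h1, ← h3, ← lintegral_const_mul' _ _ hψ.lt_top.ne]
  refine (mul_le_mul_right h2 _).trans (le_of_eq ?_)
  rw [← lintegral_const_mul' _ _ (by finiteness)]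
  refine lintegral_congr_ae ?_
  filter_upwards [hψ.scaleIntegral_ae_eq hk hb] with l hl
  rw [← hl]
  ring

theorem memLp_waveletTransform {k : ℝ} (hk : -1 / 2 ≤ k) {M : SL2} (hb : M 0 1 ≠ 0)
    {ψ f : ℝ → ℂ} (hψ : IsWavelet k M ψ) (hf : MemLp f 2 (mu k)) :
    MemLp (waveletTransform k M ψ f) 2 (nu k) := by
  refine ⟨aestronglyMeasurable_waveletTransform hk M hψ.memLp hf, ?_⟩
  have h1 := (lintegral_waveletTransform_sq_le hk hb hψ hf).trans_lt
    (ENNReal.mul_lt_top hψ.lt_top (by rw [← eLpNorm_two_sq]; exact ENNReal.pow_lt_top hf.2))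
  rw [← eLpNorm_two_sq] at h1
  exact (ENNReal.pow_lt_top_iff.1 h1).resolve_right two_ne_zero

theorem norm_toLp_waveletTransform_le {k : ℝ} (hk : -1 / 2 ≤ k) {M : SL2} (hb : M 0 1 ≠ 0)
    {ψ f : ℝ → ℂ} (hψ : IsWavelet k M ψ) (hf : MemLp f 2 (mu k)) :
    ‖(memLp_waveletTransform hk hb hψ hf).toLp _‖
      ≤ √(admissibilityConstant k M ψ).toReal * ‖hf.toLp f‖ := by
  have h1 := lintegral_waveletTransform_sq_le hk hb hψ hf
  rw [← eLpNorm_two_sq, ← eLpNorm_two_sq] at h1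
  have h2 := ENNReal.toReal_mono
    (ENNReal.mul_ne_top hψ.lt_top.ne (ENNReal.pow_lt_top hf.2).ne) h1
  rw [ENNReal.toReal_mul, ENNReal.toReal_pow, ENNReal.toReal_pow] at h2
  rw [Lp.norm_toLp, Lp.norm_toLp]
  refine abs_le_of_sq_le_sq' ?_ (by positivity) |>.2
  rwa [mul_pow, Real.sq_sqrt ENNReal.toReal_nonneg]

theorem waveletTransform_add {k : ℝ} (hk : -1 / 2 ≤ k) (M : SL2) {ψ f g : ℝ → ℂ}
    (hψ : MemLp ψ 2 (mu k)) (hf : MemLp f 2 (mu k)) (hg : MemLp g 2 (mu k)) {p : ℝ × ℝ}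
    (hp : 0 < p.1) : waveletTransform k M ψ (f + g) p
      = waveletTransform k M ψ f p + waveletTransform k M ψ g p := by
  have h := (memLp_waveletFamily hk M hψ hp p.2).star
  have h1 : Integrable (fun y => f y * (starRingEnd ℂ) (waveletFamily k M ψ p.1 p.2 y)) (mu k) :=
    integrable_mul_of_memLp hf h
  have h2 : Integrable (fun y => g y * (starRingEnd ℂ) (waveletFamily k M ψ p.1 p.2 y)) (mu k) :=
    integrable_mul_of_memLp hg h
  rw [waveletTransform, waveletTransform, waveletTransform, ← mul_add, ← integral_add h1 h2]
  congr 2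
  funext y
  rw [Pi.add_apply, add_mul]

theorem waveletTransform_smul (k : ℝ) (M : SL2) (ψ f : ℝ → ℂ) (c : ℂ) (p : ℝ × ℝ) :
    waveletTransform k M ψ (c • f) p = c * waveletTransform k M ψ f p := by
  rw [waveletTransform, waveletTransform, mul_left_comm, ← integral_const_mul c]
  simp only [Pi.smul_apply, smul_eq_mul, mul_assoc]

theorem waveletTransform_congr {k : ℝ} (M : SL2) (ψ : ℝ → ℂ) {f g : ℝ → ℂ} (h : f =ᵐ[mu k] g) :
    waveletTransform k M ψ f = waveletTransform k M ψ g := by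
  funext p
  rw [waveletTransform, waveletTransform, integral_congr_ae]
  filter_upwards [h] with y hy
  rw [hy]

/-! ### Distributions that are functions -/

/-- Smooth compactly supported functions are Schwartz and suffice to detect a locally integrable
function. -/
theorem ae_eq_zero_of_integral_schwartz {k : ℝ} (hk : -1 / 2 ≤ k) {g : ℝ → ℂ}
    (hi : ∀ φ : 𝓢(ℝ, ℂ), Integrable (fun x => g x * φ x) (mu k))
    (h0 : ∀ φ : 𝓢(ℝ, ℂ), ∫ x, g x * φ x ∂mu k = 0) : g =ᵐ[mu k] 0 := by
  have := isLocallyFiniteMeasure_mu hk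
  have hs : ∀ u : ℝ → ℝ, ContDiff ℝ (⊤ : ℕ∞) u → HasCompactSupport u →
      ∃ φ : 𝓢(ℝ, ℂ), ∀ x, φ x = u x := by
    intro u hu hc
    have h1 : HasCompactSupport fun x => (u x : ℂ) := hc.comp_left (g := Complex.ofReal) rfl
    exact ⟨h1.toSchwartzMap (Complex.ofRealCLM.contDiff.comp hu), fun x => rfl⟩
  have hloc : LocallyIntegrable g (mu k) := by
    intro x
    -- Testing against a bump equal to 1 on the unit ball yields integrability of g there.
    let u : ContDiffBump x := ⟨1, 2, one_pos, one_lt_two⟩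
    obtain ⟨φ, hφ⟩ := hs u u.contDiff u.hasCompactSupport
    refine ⟨Metric.closedBall x 1, Metric.closedBall_mem_nhds x one_pos, ?_⟩
    refine (hi φ).integrableOn.congr_fun (fun y hy => ?_) measurableSet_closedBall
    simp only [hφ, u.one_of_mem_closedBall hy, Complex.ofReal_one, mul_one]
  refine ae_eq_zero_of_integral_contDiff_smul_eq_zero hloc fun u hu hc => ?_
  obtain ⟨φ, hφ⟩ := hs u hu hc
  rw [← h0 φ]
  congr 1
  funext x
  rw [hφ, Complex.real_smul, mul_comm]

theorem IsFunction.ae_eq {k : ℝ} (hk : -1 / 2 ≤ k) {h : 𝓢'(ℝ, ℂ)} {f₁ f₂ : ℝ → ℂ}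
    (h₁ : IsFunction k h f₁) (h₂ : IsFunction k h f₂) : f₁ =ᵐ[mu k] f₂ := by
  have := ae_eq_zero_of_integral_schwartz hk (g := fun x => f₁ x - f₂ x)
    (fun φ => by simp only [sub_mul]; exact (h₁ φ).1.sub (h₂ φ).1)
    (fun φ => by
      simp only [sub_mul]
      rw [integral_sub (h₁ φ).1 (h₂ φ).1, ← (h₁ φ).2, ← (h₂ φ).2, sub_self])
  filter_upwards [this] with x hx using sub_eq_zero.1 hx

theorem IsFunction.add {k : ℝ} {h₁ h₂ : 𝓢'(ℝ, ℂ)} {f₁ f₂ : ℝ → ℂ} (e₁ : IsFunction k h₁ f₁)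
    (e₂ : IsFunction k h₂ f₂) : IsFunction k (h₁ + h₂) (f₁ + f₂) := by
  intro φ
  simp only [Pi.add_apply, add_mul]
  refine ⟨(e₁ φ).1.add (e₂ φ).1, ?_⟩
  rw [integral_add (e₁ φ).1 (e₂ φ).1, ← (e₁ φ).2, ← (e₂ φ).2]
  rfl

theorem IsFunction.smul {k : ℝ} {h : 𝓢'(ℝ, ℂ)} {f : ℝ → ℂ} (c : ℂ) (e : IsFunction k h f) :
    IsFunction k (c • h) (c • f) := by
  intro φ
  simp only [Pi.smul_apply, smul_eq_mul, mul_assoc]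
  refine ⟨(e φ).1.const_mul c, ?_⟩
  rw [integral_const_mul, ← (e φ).2]
  rfl

/-! ### The transposed transform on Schwartz functions -/

theorem lcdt_transposed {k : ℝ} (hk : -1 / 2 ≤ k) (M : SL2) (φ : ℝ → ℂ) (x : ℝ) :
    lcdt k (transposed M) φ x = normFactor k M * (chirp (M 0 0 / M 0 1) x *
      dunklF k (fun l => chirp (M 1 1 / M 0 1) l * φ l) ((M 0 1)⁻¹ * x)) :=
  lcdt_eq hk (transposed M) φ x

theorem norm_normFactor (k : ℝ) {M : SL2} (hb : M 0 1 ≠ 0) :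
    ‖normFactor k M‖ = |M 0 1| ^ (-(k + 1)) := by
  have h1 : Complex.I * ((M 0 1 : ℝ) : ℂ) ≠ 0 := by simp [hb]
  have h2 : ((k : ℂ) + 1) = ((k + 1 : ℝ) : ℂ) := by push_cast; ring
  rw [normFactor, norm_div, norm_one, h2, Complex.norm_cpow_real, norm_mul, Complex.norm_I, one_mul,
    Complex.norm_real, Real.norm_eq_abs, Real.rpow_neg (abs_nonneg _), one_div]

theorem normFactor_ne_zero (k : ℝ) {M : SL2} (hb : M 0 1 ≠ 0) : normFactor k M ≠ 0 := by
  rw [← norm_ne_zero_iff, norm_normFactor k hb]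
  exact (Real.rpow_pos_of_pos (abs_pos.2 hb) _).ne'

/-- Without this, the condition defining D^M h would be vacuous at some test functions and could not
determine it. -/
theorem exists_schwartz_lcdt_transposed {k : ℝ} (hk : -1 / 2 ≤ k) {M : SL2} (hb : M 0 1 ≠ 0)
    (φ : 𝓢(ℝ, ℂ)) : ∃ χ : 𝓢(ℝ, ℂ), ∀ x, χ x = lcdt k (transposed M) φ x := by
  obtain ⟨p, hp⟩ := exists_schwartz_chirp_mul (M 1 1 / M 0 1) φ
  obtain ⟨q, hq⟩ := exists_schwartz_dunklF hk p
  obtain ⟨w, hw⟩ := exists_schwartz_comp_mul (inv_ne_zero hb) q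
  obtain ⟨χ, hχ⟩ := exists_schwartz_chirp_mul (M 0 0 / M 0 1) w
  refine ⟨normFactor k M • χ, fun x => ?_⟩
  rw [lcdt_transposed hk, smul_apply, smul_eq_mul, hχ, hw, hq, funext hp]

theorem dunklF_dunklF_neg_schwartz {k : ℝ} (hk : -1 / 2 ≤ k) (φ : 𝓢(ℝ, ℂ)) (x : ℝ) :
    dunklF k (fun y => dunklF k φ (-y)) x = φ x := by
  have h := dunklF_comp_mul_left k (r := -1) (by norm_num) (dunklF k φ) x
  simp only [neg_mul, one_mul, abs_neg, abs_one, Real.one_rpow, Complex.ofReal_one, inv_neg,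
    inv_one] at h
  rw [h, dunklF_dunklF_schwartz hk, neg_neg]

/-- Each factor of the transform is inverted within the Schwartz space. Surjectivity is needed
because D^M h records the values of h only on transforms of test functions. -/
theorem exists_schwartz_eq_lcdt_transposed {k : ℝ} (hk : -1 / 2 ≤ k) {M : SL2} (hb : M 0 1 ≠ 0)
    (χ : 𝓢(ℝ, ℂ)) : ∃ φ : 𝓢(ℝ, ℂ), ∀ x, χ x = lcdt k (transposed M) φ x := by
  obtain ⟨p, hp⟩ := exists_schwartz_chirp_mul (-(M 0 0 / M 0 1)) χ
  obtain ⟨q, hq⟩ := exists_schwartz_comp_mul hb ((normFactor k M)⁻¹ • p)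
  obtain ⟨w, hw⟩ := exists_schwartz_dunklF hk q
  obtain ⟨y, hy⟩ := exists_schwartz_comp_mul (c := -1) (by norm_num) w
  obtain ⟨φ, hφ⟩ := exists_schwartz_chirp_mul (-(M 1 1 / M 0 1)) y
  refine ⟨φ, fun x => ?_⟩
  have h1 : (fun l => chirp (M 1 1 / M 0 1) l * φ l) = fun l => dunklF k q (-l) := by
    funext l
    rw [hφ, ← mul_assoc, chirp_mul_neg, one_mul, hy, hw, neg_one_mul]
  rw [lcdt_transposed hk, h1, dunklF_dunklF_neg_schwartz hk, hq, mul_inv_cancel_left₀ hb, smul_apply,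
    smul_eq_mul, hp, mul_left_comm _ (normFactor k M)⁻¹, mul_inv_cancel_left₀ (normFactor_ne_zero k hb),
    ← mul_assoc, chirp_mul_neg, one_mul]

/-! ### Elements of the Sobolev space -/

theorem IsLcdtDist.ae_eq {k : ℝ} (hk : -1 / 2 ≤ k) {M : SL2} (hb : M 0 1 ≠ 0) {h : 𝓢'(ℝ, ℂ)}
    {g₁ g₂ : ℝ → ℂ} (h₁ : IsLcdtDist k M h g₁) (h₂ : IsLcdtDist k M h g₂) : g₁ =ᵐ[mu k] g₂ := by
  have e : ∀ φ : 𝓢(ℝ, ℂ), (Integrable (fun l => g₁ l * φ l) (mu k) ∧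
      Integrable (fun l => g₂ l * φ l) (mu k)) ∧
      ∫ l, g₁ l * φ l ∂mu k = ∫ l, g₂ l * φ l ∂mu k := by
    intro φ
    obtain ⟨χ, hχ⟩ := exists_schwartz_lcdt_transposed hk hb φ
    exact ⟨⟨(h₁ φ χ hχ).1, (h₂ φ χ hχ).1⟩, by rw [← (h₁ φ χ hχ).2, (h₂ φ χ hχ).2]⟩
  have := ae_eq_zero_of_integral_schwartz hk (g := fun x => g₁ x - g₂ x)
    (fun φ => by simp only [sub_mul]; exact (e φ).1.1.sub (e φ).1.2)
    (fun φ => by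
      simp only [sub_mul]
      rw [integral_sub (e φ).1.1 (e φ).1.2, (e φ).2, sub_self])
  filter_upwards [this] with x hx using sub_eq_zero.1 hx

/-- Inverts the transform on L² to obtain f from g, then checks that h and f agree on every Schwartz
function, written as a transposed transform. -/
theorem exists_isFunction_of_isLcdtDist {k : ℝ} (hk : -1 / 2 ≤ k) {M : SL2} (hb : M 0 1 ≠ 0)
    {h : 𝓢'(ℝ, ℂ)} {g : ℝ → ℂ} (hg : MemLp g 2 (mu k)) (hh : IsLcdtDist k M h g) :
    ∃ f : ℝ → ℂ, MemLp f 2 (mu k) ∧ IsFunction k h f ∧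
      eLpNorm f 2 (mu k) = eLpNorm g 2 (mu k) := by
  have hb' := inv_ne_zero hb
  have hN := normFactor_ne_zero k hb
  have hg' := memLp_chirp_mul (-(M 1 1 / M 0 1)) hg
  set v : Lp ℂ 2 (mu k) := dunklL2 hk (hg'.toLp _) with hv
  have hvn : MemLp (fun x => v (-(M 0 1)⁻¹ * x)) 2 (mu k) :=
    memLp_comp_mul_left (neg_ne_zero.2 hb') (Lp.memLp v)
  -- The inverse of `normFactor` undoes the scalar of the transform, and the power of |b| is the
  -- Jacobian of the dilation by 1/b.
  set f : ℝ → ℂ := fun x => ((|M 0 1| ^ (-(2 * k + 2)) : ℝ) * (normFactor k M)⁻¹) *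
    (chirp (-(M 0 0 / M 0 1)) x * v (-(M 0 1)⁻¹ * x)) with hf
  have hfm : MemLp f 2 (mu k) := (memLp_chirp_mul _ hvn).const_mul _
  refine ⟨f, hfm, fun χ => ⟨integrable_mul_of_memLp hfm (SchwartzMap.memLp_mu hk χ), ?_⟩, ?_⟩
  · obtain ⟨φ, hφ⟩ := exists_schwartz_eq_lcdt_transposed hk hb χ
    obtain ⟨p, hp⟩ := exists_schwartz_chirp_mul (M 1 1 / M 0 1) φ
    obtain ⟨w, hw⟩ := exists_schwartz_dunklF hk p
    obtain ⟨q, hq⟩ := exists_schwartz_comp_mul (c := -1) (by norm_num) w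
    have hqp : ∀ x, dunklF k q x = p x := by
      intro x
      rw [← dunklF_dunklF_neg_schwartz hk p x]
      congr 1
      funext y
      rw [hq, hw, neg_one_mul]
    rw [(hh φ χ hφ).2]
    -- The chirp is moved from g to φ, and the chirped φ is written as the Dunkl transform of q, so
    -- that transposition applies.
    have e1 : ∫ l, g l * φ l ∂mu k = ∫ l, hg'.toLp _ l * dunklF k q l ∂mu k := by
      refine integral_congr_ae ?_
      filter_upwards [hg'.coeFn_toLp] with l hl
      rw [hl, hqp, hp, mul_mul_mul_comm, chirp_neg_mul, one_mul]
    rw [e1, ← integral_dunklL2_mul hk (SchwartzMap.memLp_mu hk q) (SchwartzMap.integrable_mu hk q),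
      ← hv, ← integral_mu_neg]
    have e2 := integral_mu_mul_left (k := k) hb' fun x => v (-x) * q (-x)
    have e3 : ∀ x, f x * χ x = ((|M 0 1| ^ (-(2 * k + 2)) : ℝ) : ℂ) *
        (v (-((M 0 1)⁻¹ * x)) * q (-((M 0 1)⁻¹ * x))) := by
      intro x
      rw [hf, hφ, lcdt_transposed hk, hq, hw, ← funext hp]
      simp only [neg_mul, mul_neg, one_mul, neg_neg]
      linear_combination ((|M 0 1| ^ (-(2 * k + 2)) : ℝ) * v (-((M 0 1)⁻¹ * x)) *
        dunklF k p ((M 0 1)⁻¹ * x)) * (chirp (-(M 0 0 / M 0 1)) x * chirp (M 0 0 / M 0 1) x *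
          inv_mul_cancel₀ hN + chirp_neg_mul (M 0 0 / M 0 1) x)
    simp only [e3]
    rw [integral_const_mul, e2, Complex.real_smul, ← mul_assoc, ← Complex.ofReal_mul, abs_inv,
      Real.inv_rpow (abs_nonneg _), mul_inv_cancel₀ (Real.rpow_pos_of_pos (abs_pos.2 hb) _).ne',
      Complex.ofReal_one, one_mul]
  · have e1 : f = ((|M 0 1| ^ (-(2 * k + 2)) : ℝ) * (normFactor k M)⁻¹ : ℂ) •
        fun x => chirp (-(M 0 0 / M 0 1)) x * v (-(M 0 1)⁻¹ * x) := rfl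
    have hpos := abs_pos.2 hb
    -- The powers of |b| cancel: -(2k+2) from the Jacobian, k+1 from the inverse of `normFactor`,
    -- k+1 from the norm of the dilation.
    rw [e1, eLpNorm_const_smul, eLpNorm_chirp_mul, eLpNorm_comp_mul_left k (neg_ne_zero.2 hb'),
      ← Lp.enorm_def, ← ofReal_norm v, hv, LinearIsometry.norm_map, ofReal_norm, Lp.enorm_toLp,
      eLpNorm_chirp_mul, ← mul_assoc, ← ofReal_norm, ← ENNReal.ofReal_mul (norm_nonneg _), norm_mul,
      norm_inv, norm_normFactor k hb, Complex.norm_real, Real.norm_of_nonneg (Real.rpow_nonneg hpos.le _),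
      abs_neg, abs_inv, Real.inv_rpow hpos.le, ← Real.rpow_neg hpos.le, neg_neg, ← Real.rpow_add hpos,
      ← Real.rpow_add hpos, show -(2 * k + 2) + (k + 1) + (k + 1) = 0 by ring, Real.rpow_zero,
      ENNReal.ofReal_one, one_mul]

theorem one_le_sobolevWeight {s : ℝ} (hs : 0 ≤ s) (l : ℝ) : 1 ≤ (1 + l ^ 2) ^ (s / 2) :=
  Real.one_le_rpow (by nlinarith [sq_nonneg l]) (by positivity)

theorem memLp_of_sobolevWeight_mul {k s : ℝ} (hs : 0 ≤ s) {g : ℝ → ℂ}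
    (hg : MemLp (fun l : ℝ => (((1 + l ^ 2) ^ (s / 2) : ℝ) : ℂ) * g l) 2 (mu k)) :
    MemLp g 2 (mu k) := by
  have hw : Measurable fun l : ℝ => (((1 + l ^ 2) ^ (s / 2) : ℝ) : ℂ)⁻¹ := by fun_prop
  have hm : AEStronglyMeasurable g (mu k) := by
    refine (hw.aestronglyMeasurable.mul hg.1).congr (Eventually.of_forall fun l => ?_)
    have : (((1 + l ^ 2) ^ (s / 2) : ℝ) : ℂ) ≠ 0 := by
      exact_mod_cast (one_pos.trans_le (one_le_sobolevWeight hs l)).ne'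
    exact inv_mul_cancel_left₀ this _
  refine hg.of_le hm (Eventually.of_forall fun l => ?_)
  have h1 := one_le_sobolevWeight hs l
  rw [norm_mul, Complex.norm_real, Real.norm_of_nonneg (by linarith)]
  exact le_mul_of_one_le_left (norm_nonneg _) h1

theorem isLcdtDist_lcdtDist {k : ℝ} {M : SL2} {s : ℝ} (h : sobolevSpace k M s) :
    IsLcdtDist k M h (lcdtDist k M h) := by
  obtain ⟨g, hg, -⟩ := h.2
  have e : ∃ g, IsLcdtDist k M h g := ⟨g, hg⟩
  rw [lcdtDist, dif_pos e]
  exact e.choose_spec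

theorem memLp_sobolevWeight_mul_lcdtDist {k : ℝ} (hk : -1 / 2 ≤ k) {M : SL2} (hb : M 0 1 ≠ 0)
    {s : ℝ} (h : sobolevSpace k M s) :
    MemLp (fun l : ℝ => (((1 + l ^ 2) ^ (s / 2) : ℝ) : ℂ) * lcdtDist k M h l) 2 (mu k) := by
  obtain ⟨g, hg, hm⟩ := h.2
  refine hm.ae_eq ?_
  filter_upwards [hg.ae_eq hk hb (isLcdtDist_lcdtDist h)] with l hl
  rw [hl]

theorem sobolevNorm_eq {k : ℝ} (hk : -1 / 2 ≤ k) {M : SL2} (hb : M 0 1 ≠ 0) {s : ℝ}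
    (h : sobolevSpace k M s) :
    sobolevNorm k M s h = ‖(memLp_sobolevWeight_mul_lcdtDist hk hb h).toLp _‖ := by
  have hm := memLp_sobolevWeight_mul_lcdtDist hk hb h
  have h1 : sobolevInner k M s h h = inner ℂ (hm.toLp _) (hm.toLp _) := by
    rw [L2.inner_def, sobolevInner]
    refine integral_congr_ae ?_
    filter_upwards [hm.coeFn_toLp] with l hl
    have h2 : (1 + l ^ 2) ^ s = (1 + l ^ 2) ^ (s / 2) * (1 + l ^ 2) ^ (s / 2) := by
      rw [← Real.rpow_add (by positivity)]; ring_nf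
    rw [hl, h2, RCLike.inner_apply, map_mul, Complex.conj_ofReal]
    push_cast
    ring
  rw [sobolevNorm, h1]
  have h3 := inner_self_eq_norm_sq (𝕜 := ℂ) (hm.toLp _)
  rw [RCLike.re_eq_complex_re] at h3
  rw [h3, Real.sqrt_sq (norm_nonneg _)]

/-- For s ≥ 0 the weight is at least 1, so the L² norm of D^M h, which equals that of f, is at most
the Sobolev norm. -/
theorem exists_isFunction {k : ℝ} (hk : -1 / 2 ≤ k) {M : SL2} (hb : M 0 1 ≠ 0) {s : ℝ} (hs : 0 ≤ s)
    (h : sobolevSpace k M s) : ∃ f : ℝ → ℂ, ∃ hf : MemLp f 2 (mu k),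
      IsFunction k (h : 𝓢'(ℝ, ℂ)) f ∧ ‖hf.toLp f‖ ≤ sobolevNorm k M s h := by
  have hm := memLp_sobolevWeight_mul_lcdtDist hk hb h
  have hg := memLp_of_sobolevWeight_mul hs hm
  obtain ⟨f, hf, hfun, hn⟩ := exists_isFunction_of_isLcdtDist hk hb hg (isLcdtDist_lcdtDist h)
  refine ⟨f, hf, hfun, ?_⟩
  rw [sobolevNorm_eq hk hb, Lp.norm_toLp, Lp.norm_toLp, hn]
  refine ENNReal.toReal_mono hm.2.ne (eLpNorm_mono fun l => ?_)
  have h1 := one_le_sobolevWeight hs l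
  rw [norm_mul, Complex.norm_real, Real.norm_of_nonneg (by linarith)]
  exact le_mul_of_one_le_left (norm_nonneg _) h1

theorem toLp_waveletTransform_congr {k : ℝ} (hk : -1 / 2 ≤ k) {M : SL2} (hb : M 0 1 ≠ 0)
    {ψ f g : ℝ → ℂ} (hψ : IsWavelet k M ψ) (hf : MemLp f 2 (mu k)) (hg : MemLp g 2 (mu k))
    (h : f =ᵐ[mu k] g) : (memLp_waveletTransform hk hb hψ hf).toLp _
      = (memLp_waveletTransform hk hb hψ hg).toLp _ := by
  congr 1
  exact waveletTransform_congr M ψ h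

end LCDunkl

end

/-! ### The boundedness theorem -/

theorem propositionP (k : ℝ) (hk : -1 / 2 ≤ k) (M : LCDunkl.SL2) (hb : M 0 1 ≠ 0)
    (s : ℝ) (hs : 0 ≤ s) (ψ : ℝ → ℂ) (hψ : LCDunkl.IsWavelet k M ψ) :
    (∀ h : LCDunkl.sobolevSpace k M s, ∃ f : ℝ → ℂ,
      MemLp f 2 (LCDunkl.mu k) ∧ LCDunkl.IsFunction k (h : 𝓢'(ℝ, ℂ)) f) ∧
    ∃ Φ : LCDunkl.sobolevSpace k M s →ₗ[ℂ] Lp ℂ 2 (LCDunkl.nu k),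
      (∀ (h : LCDunkl.sobolevSpace k M s) (f : ℝ → ℂ),
        MemLp f 2 (LCDunkl.mu k) → LCDunkl.IsFunction k (h : 𝓢'(ℝ, ℂ)) f →
          Φ h =ᵐ[LCDunkl.nu k] LCDunkl.waveletTransform k M ψ f) ∧
      ∀ h : LCDunkl.sobolevSpace k M s,
        ‖Φ h‖ ≤ √(LCDunkl.admissibilityConstant k M ψ).toReal * LCDunkl.sobolevNorm k M s h := by
  -- The chosen functions need not depend linearly on h, but a representing function is unique
  -- almost everywhere, so F(h₁ + h₂) and F(c • h) may be replaced by F h₁ + F h₂ and c • F h.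
  choose F hF hfun hn using LCDunkl.exists_isFunction hk hb hs (M := M)
  refine ⟨fun h => ⟨F h, hF h, hfun h⟩, ⟨⟨fun h =>
    (LCDunkl.memLp_waveletTransform hk hb hψ (hF h)).toLp _, fun h₁ h₂ => ?_⟩, fun c h => ?_⟩, ?_, ?_⟩
  · rw [LCDunkl.toLp_waveletTransform_congr hk hb hψ (hF (h₁ + h₂)) ((hF h₁).add (hF h₂))
      ((hfun (h₁ + h₂)).ae_eq hk ((hfun h₁).add (hfun h₂))), ← MemLp.toLp_add]
    refine (MemLp.toLp_eq_toLp_iff _ _).2 ?_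
    -- The wavelets are known to be in L² only for α > 0, which holds almost everywhere for ν_k;
    -- additivity of the integral needs it.
    filter_upwards [LCDunkl.ae_nu_pos k] with p hp
    exact LCDunkl.waveletTransform_add hk M hψ.memLp (hF h₁) (hF h₂) hp
  · simp only [RingHom.id_apply]
    rw [LCDunkl.toLp_waveletTransform_congr hk hb hψ (hF (c • h)) ((hF h).const_smul c)
      ((hfun (c • h)).ae_eq hk ((hfun h).smul c)), ← MemLp.toLp_const_smul]
    refine (MemLp.toLp_eq_toLp_iff _ _).2 (Eventually.of_forall fun p => ?_)
    exact LCDunkl.waveletTransform_smul k M ψ (F h) c p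
  · intro h f hf hff
    rw [← LCDunkl.waveletTransform_congr M ψ ((hfun h).ae_eq hk hff)]
    exact (LCDunkl.memLp_waveletTransform hk hb hψ (hF h)).coeFn_toLp
  · intro h
    exact (LCDunkl.norm_toLp_waveletTransform_le hk hb hψ (hF h)).trans
      (mul_le_mul_of_nonneg_left (hn h) (Real.sqrt_nonneg _))
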